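/- Burling graphs. The Burling sequence $B_1,B_2,\ldots$ of graphs, together with families $\mathcal S_1,\mathcal S_2,\ldots$ of vertex sets, is defined as follows. $B_1$ has a single vertex, and $\mathcal S_1=\{V(B_1)\}$. The graph $B_{k+1}$ consists of a main copy of $B_k$ and, for every $S\in\mathcal S_k$ (viewed in the main copy), a further copy $H_S$ of $B_k$ and, for every $Q\in\mathcal S_k$ (viewed in $H_S$), a new vertex $v_{S,Q}$ whose neighbors are exactly the vertices of $Q$ in $H_S$. The family $\mathcal S_{k+1}$ comprises the sets $S\cup Q$ and $S\cup\{v_{S,Q}\}$ for all such $S$ and $Q$. A graph is a Burling graph if it is isomorphic to an induced subgraph of $B_k$ for some $k\geq 1$. Burling sets. A triple $(V,\prec,\rightsquigarrow)$ is a Burling set if $V$ is a non-empty finite set, $\prec$ is a strict partial order on $V$, $\rightsquigarrow$ is an acyclic relation on $V$, and for all $x,y,z\in V$: (1) if $x\prec y$, $x\prec z$ and $y\neq z$, then $y\prec z$ or $z\prec y$; (2) if $x\rightsquigarrow y$, $x\rightsquigarrow z$ and $y\neq z$, then $y\prec z$ or $z\prec y$; (3) if $x\rightsquigarrow y$ and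 $x\prec z$, then $y\prec z$; (4) if $x\rightsquigarrow y$ and $y\prec z$, then $x\rightsquigarrow z$ or $x\prec z$. Let $E(\rightsquigarrow)=\{xy : x\rightsquigarrow y\}$. Theorem. There is a polynomial-time algorithm which, given a non-empty finite simple graph $G$ with vertex set $V$, either declares $G$ a Burling graph and produces a Burling set $(V,\prec,\rightsquigarrow)$ such that $G=(V,E(\rightsquigarrow))$, or reports that $G$ is not a Burling graph; in the latter case there is also no Burling set $(V,\prec,\rightsquigarrow)$ such that $G=(V,E(\rightsquigarrow))$. Here the algorithm is a deterministic program for a random access machine with unit-cost addition, truncated subtraction, indirect memory access and tests for zero; the input $G$ on $V=\{0,\ldots,n-1\}$ is given by $n$ and its adjacency matrix, the relations $\prec$ and $\rightsquigarrow$ are output as their matrices, and the running time is bounded by a polynomial in $n$. -/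

import Mathlib

/-! ### Burling graphs -/

/-- A graph together with a distinguished family of sets of vertices. -/
structure ProbedGraph where
  V : Type
  graph : SimpleGraph V
  probes : Set (Set V)

namespace ProbedGraph

/-- Vertices of the next graph of the Burling sequence: a main copy of `P` and, for every
distinguished set `S` of the main copy, a further copy of `P` and one new vertex for every
distinguished set `Q` of that further copy. -/
abbrev NextV (P : ProbedGraph) : Type := P.V ⊕ (Σ _ : P.probes, P.V ⊕ P.probes)

/-- The vertex `v` of the main copy. -/
abbrev mainV (P : ProbedGraph) (v : P.V) : P.NextV := Sum.inl v

/-- The vertex `v` of the copy of `P` that belongs to the distinguished set `S`. -/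
abbrev copyV (P : ProbedGraph) (S : P.probes) (v : P.V) : P.NextV := Sum.inr ⟨S, Sum.inl v⟩

/-- The new vertex attached to the set `Q` of the copy of `P` that belongs to `S`. -/
abbrev newV (P : ProbedGraph) (S Q : P.probes) : P.NextV := Sum.inr ⟨S, Sum.inr Q⟩

/-- The edges of the next graph, each in one orientation. -/
inductive NextRel (P : ProbedGraph) : P.NextV → P.NextV → Prop
  | inMain {u v : P.V} (h : P.graph.Adj u v) : NextRel P (P.mainV u) (P.mainV v)
  | inCopy (S : P.probes) {u v : P.V} (h : P.graph.Adj u v) :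
      NextRel P (P.copyV S u) (P.copyV S v)
  | attach (S Q : P.probes) {u : P.V} (h : u ∈ Q.1) : NextRel P (P.newV S Q) (P.copyV S u)

/-- One step of Burling's construction. -/
def next (P : ProbedGraph) : ProbedGraph where
  V := P.NextV
  graph := SimpleGraph.fromRel P.NextRel
  probes := {T | ∃ S Q : P.probes,
    T = P.mainV '' S.1 ∪ P.copyV S '' Q.1 ∨ T = P.mainV '' S.1 ∪ {P.newV S Q}}

end ProbedGraph

/-- The Burling sequence: `burlingSeq k` is the `(k + 1)`-st graph `B_{k+1}` of the sequence
`B_1, B_2, …` (so `burlingSeq 0` is the one-vertex graph `B_1`), with its stable sets. -/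
def burlingSeq : ℕ → ProbedGraph
  | 0 => { V := Unit, graph := ⊥, probes := {Set.univ} }
  | k + 1 => (burlingSeq k).next

/-- A Burling graph is an induced subgraph of some graph of the Burling sequence. -/
def IsBurlingGraph {V : Type*} (G : SimpleGraph V) : Prop :=
  ∃ k : ℕ, Nonempty (G ↪g (burlingSeq k).graph)

/-! ### Burling sets -/

/-- `(S, prec, adj)` is a Burling set. Acyclicity of `adj` says that no element can be reached
from itself in one or more steps of `adj`. -/
structure IsBurlingSet {S : Type*} (prec adj : S → S → Prop) : Prop where
  finite : Finite S
  nonempty : Nonempty S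
  prec_irrefl : ∀ x, ¬ prec x x
  prec_trans : ∀ x y z, prec x y → prec y z → prec x z
  adj_acyclic : ∀ x, ¬ Relation.TransGen adj x x
  axiom1 : ∀ x y z, prec x y → prec x z → y ≠ z → prec y z ∨ prec z y
  axiom2 : ∀ x y z, adj x y → adj x z → y ≠ z → prec y z ∨ prec z y
  axiom3 : ∀ x y z, adj x y → prec x z → prec y z
  axiom4 : ∀ x y z, adj x y → prec y z → adj x z ∨ prec x z

/-! ### Random access machines

Programs for a random access machine whose memory consists of registers and of arrays, all
holding natural numbers, and whose arithmetic is addition and truncated subtraction. A program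
mentions finitely many registers and arrays by fixed names; only positions inside an array can be
computed at run time. Every operation costs one unit of time. Without multiplication the bit
length of the stored numbers grows by a constant amount per step, so polynomial time on this
machine is polynomial time on a Turing machine. -/

namespace RAM

/-- A memory: the contents of the registers, and of every position of every array. -/
@[ext]
structure State where
  reg : ℕ → ℕ
  arr : ℕ → ℕ → ℕ

/-- Arithmetic expressions. -/
inductive Expr
  /-- a constant -/
  | const (k : ℕ)
  /-- the content of register `x` -/
  | var (x : ℕ)
  /-- the content of array `a` at the position given by `e` -/
  | read (a : ℕ) (e : Expr)
  | add (e f : Expr)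
  /-- truncated subtraction -/
  | sub (e f : Expr)

/-- The value of an expression. -/
def Expr.eval (s : State) : Expr → ℕ
  | const k => k
  | var x => s.reg x
  | read a e => s.arr a (e.eval s)
  | add e f => e.eval s + f.eval s
  | sub e f => e.eval s - f.eval s

/-- The time to evaluate an expression: the number of its constants, registers and operations. -/
def Expr.cost : Expr → ℕ
  | const _ => 1
  | var _ => 1
  | read _ e => e.cost + 1
  | add e f => e.cost + f.cost + 1
  | sub e f => e.cost + f.cost + 1

/-- Programs. -/
inductive Cmd
  | skip
  /-- put the value of `e` into register `x` -/
  | assign (x : ℕ) (e : Expr)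
  /-- put the value of `e` into array `a` at the position given by `i` -/
  | write (a : ℕ) (i e : Expr)
  /-- run `c`, then `d` -/
  | seq (c d : Cmd)
  /-- run `c` if the value of `e` is non-zero, and `d` otherwise -/
  | ite (e : Expr) (c d : Cmd)
  /-- run `c` as long as the value of `e` is non-zero -/
  | loop (e : Expr) (c : Cmd)

/-- The memory after putting `v` into register `x`. -/
def State.setReg (s : State) (x v : ℕ) : State :=
  { s with reg := Function.update s.reg x v }

/-- The memory after putting `v` into array `a` at position `i`. -/
def State.setArr (s : State) (a i v : ℕ) : State :=
  { s with arr := Function.update s.arr a (Function.update (s.arr a) i v) }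

/-- `Exec c s s' t`: the program `c`, started with memory `s`, halts with memory `s'` after
exactly `t` units of time. -/
inductive Exec : Cmd → State → State → ℕ → Prop
  | skip (s : State) : Exec .skip s s 1
  | assign (x : ℕ) (e : Expr) (s : State) :
      Exec (.assign x e) s (s.setReg x (e.eval s)) (e.cost + 1)
  | write (a : ℕ) (i e : Expr) (s : State) :
      Exec (.write a i e) s (s.setArr a (i.eval s) (e.eval s)) (i.cost + e.cost + 1)
  | seq {c d : Cmd} {s s' s'' : State} {t u : ℕ} (hc : Exec c s s' t) (hd : Exec d s' s'' u) :
      Exec (.seq c d) s s'' (t + u)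
  | iteTrue {e : Expr} {c d : Cmd} {s s' : State} {t : ℕ} (he : e.eval s ≠ 0)
      (hc : Exec c s s' t) : Exec (.ite e c d) s s' (e.cost + 1 + t)
  | iteFalse {e : Expr} {c d : Cmd} {s s' : State} {t : ℕ} (he : e.eval s = 0)
      (hd : Exec d s s' t) : Exec (.ite e c d) s s' (e.cost + 1 + t)
  | loopTrue {e : Expr} {c : Cmd} {s s' s'' : State} {t u : ℕ} (he : e.eval s ≠ 0)
      (hc : Exec c s s' t) (hl : Exec (.loop e c) s' s'' u) :
      Exec (.loop e c) s s'' (e.cost + 1 + t + u)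
  | loopFalse {e : Expr} {c : Cmd} {s : State} (he : e.eval s = 0) :
      Exec (.loop e c) s s (e.cost + 1)

/-- The machine is deterministic: the final memory and the running time are unique. -/
theorem Exec.unique {c : Cmd} {s s₁ s₂ : State} {t₁ t₂ : ℕ} (h₁ : Exec c s s₁ t₁)
    (h₂ : Exec c s s₂ t₂) : s₁ = s₂ ∧ t₁ = t₂ := by
  induction h₁ generalizing s₂ t₂ with
  | skip s => cases h₂; exact ⟨rfl, rfl⟩
  | assign x e s => cases h₂; exact ⟨rfl, rfl⟩
  | write a i e s => cases h₂; exact ⟨rfl, rfl⟩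
  | seq hc hd ihc ihd =>
    cases h₂ with
    | seq hc' hd' =>
      obtain ⟨rfl, rfl⟩ := ihc hc'
      obtain ⟨rfl, rfl⟩ := ihd hd'
      exact ⟨rfl, rfl⟩
  | iteTrue he hc ih =>
    cases h₂ with
    | iteTrue he' hc' => obtain ⟨rfl, rfl⟩ := ih hc'; exact ⟨rfl, rfl⟩
    | iteFalse he' hd' => exact absurd he' he
  | iteFalse he hd ih =>
    cases h₂ with
    | iteTrue he' hc' => exact absurd he he'
    | iteFalse he' hd' => obtain ⟨rfl, rfl⟩ := ih hd'; exact ⟨rfl, rfl⟩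
  | loopTrue he hc hl ihc ihl =>
    cases h₂ with
    | loopTrue he' hc' hl' =>
      obtain ⟨rfl, rfl⟩ := ihc hc'
      obtain ⟨rfl, rfl⟩ := ihl hl'
      exact ⟨rfl, rfl⟩
    | loopFalse he' => exact absurd he' he
  | loopFalse he =>
    cases h₂ with
    | loopTrue he' hc' hl' => exact absurd he he'
    | loopFalse he' => exact ⟨rfl, rfl⟩

open Classical in
/-- The initial memory for an input graph with vertices `0, …, n - 1`: register `0` holds `n`,
array `0` holds the adjacency matrix row by row, and everything else is `0`. -/
noncomputable def graphInput {n : ℕ} (G : SimpleGraph (Fin n)) : State where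
  reg x := if x = 0 then n else 0
  arr a k := if a = 0 ∧ ∃ i j : Fin n, k = i * n + j ∧ G.Adj i j then 1 else 0

/-- The relation on `0, …, n - 1` whose matrix is stored row by row in array `a`. -/
def State.rel (s : State) (n a : ℕ) : Fin n → Fin n → Prop :=
  fun i j => s.arr a (i * n + j) = 1

end RAM

/-!
A graph is a Burling graph if and only if it carries a Burling set: Burling sets pass from `B_k` to
`B_{k+1}` and to induced subgraphs, and conversely a Burling set is embedded into the sequence by
induction on its size, the distinguished sets being used to attach one vertex at a time.

Burling sets are found by dynamic programming over the components of `G - N[x]`, for all vertices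
`x`. In a connected graph with a Burling set, the maximal elements of `≺` induce a tree whose edges
can be directed towards a root, and the elements below a maximal element `x` form whole components
of `G - N[x]`, each of which is attached to children of `x`. Conversely, a root `r` and the
knowledge which of these components carry Burling sets determine this tree: starting from `r`, a
neighbour of a child of `x` is again maximal unless its component in `G - N[x]` can be placed below
`x`. It remains to check that the components below `x` can be nested in each other, which is a
condition on pairs of them. As the components are smaller than the graph, `n` rounds of updating the
tables of all components give the answer.

The random access machine evaluates formulas about `G` over its vertices, with quantifiers and
polynomially iterated definitions of relations, in polynomial time, and all of the above can be
expressed in this way.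
-/

namespace RAM

namespace State

@[simp]
theorem reg_setReg (s : State) (x v y : ℕ) :
    (s.setReg x v).reg y = if y = x then v else s.reg y :=
  Function.update_apply ..

@[simp]
theorem arr_setReg (s : State) (x v : ℕ) : (s.setReg x v).arr = s.arr := rfl

theorem arr_setArr_self (s : State) (a i v j : ℕ) :
    (s.setArr a i v).arr a j = if j = i then v else s.arr a j := by
  simp [setArr, Function.update_apply]

theorem arr_setArr_of_ne (s : State) {a b : ℕ} (h : b ≠ a) (i v : ℕ) :
    (s.setArr a i v).arr b = s.arr b := by
  simp [setArr, h]

/-- The memories `s` and `s'` agree on the registers in `R` and on the arrays in `A`. -/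
def EqOn (R A : Set ℕ) (s s' : State) : Prop :=
  Set.EqOn s'.reg s.reg R ∧ Set.EqOn s'.arr s.arr A

variable {R R' A A' : Set ℕ} {s s' s'' : State}

theorem EqOn.refl (R A : Set ℕ) (s : State) : EqOn R A s s :=
  ⟨fun _ _ => rfl, fun _ _ => rfl⟩

theorem EqOn.trans (h : EqOn R A s s') (h' : EqOn R A s' s'') : EqOn R A s s'' :=
  ⟨h'.1.trans h.1, h'.2.trans h.2⟩

theorem EqOn.mono (h : EqOn R A s s') (hR : R' ⊆ R) (hA : A' ⊆ A) : EqOn R' A' s s' :=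
  ⟨h.1.mono hR, h.2.mono hA⟩

theorem EqOn.setReg (h : EqOn R A s s') {x : ℕ} (hx : x ∉ R) (v : ℕ) :
    EqOn R A s (s'.setReg x v) := by
  refine ⟨fun y hy => ?_, h.2⟩
  rw [reg_setReg, if_neg (ne_of_mem_of_not_mem hy hx)]
  exact h.1 hy

theorem EqOn.setArr (h : EqOn R A s s') {a : ℕ} (ha : a ∉ A) (i v : ℕ) :
    EqOn R A s (s'.setArr a i v) := by
  refine ⟨h.1, fun b hb => ?_⟩
  rw [arr_setArr_of_ne _ (ne_of_mem_of_not_mem hb ha)]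
  exact h.2 hb

end State

/-- A timed Hoare triple: `c`, started with memory `s`, halts within time `T` with a memory
satisfying `Q`. -/
def Runs (c : Cmd) (s : State) (T : ℕ) (Q : State → Prop) : Prop :=
  ∃ s' t, Exec c s s' t ∧ t ≤ T ∧ Q s'

namespace Runs

variable {c d : Cmd} {e : Expr} {s : State} {T U : ℕ} {P Q : State → Prop}

theorem mono (h : Runs c s T P) (hT : T ≤ U) (hQ : ∀ s', P s' → Q s') : Runs c s U Q :=
  let ⟨s', t, hexec, ht, hP⟩ := h
  ⟨s', t, hexec, ht.trans hT, hQ s' hP⟩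

theorem skip (h : Q s) : Runs .skip s 1 Q :=
  ⟨s, 1, .skip s, le_rfl, h⟩

theorem assign {x : ℕ} (h : Q (s.setReg x (e.eval s))) : Runs (.assign x e) s (e.cost + 1) Q :=
  ⟨_, _, .assign x e s, le_rfl, h⟩

theorem write {a : ℕ} {i : Expr} (h : Q (s.setArr a (i.eval s) (e.eval s))) :
    Runs (.write a i e) s (i.cost + e.cost + 1) Q :=
  ⟨_, _, .write a i e s, le_rfl, h⟩

theorem seq (h : Runs c s T fun s' => Runs d s' U Q) : Runs (.seq c d) s (T + U) Q :=
  let ⟨_, _, hc, ht, _, _, hd, hu, hQ⟩ := h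
  ⟨_, _, .seq hc hd, add_le_add ht hu, hQ⟩

theorem ite (hc : e.eval s ≠ 0 → Runs c s T Q) (hd : e.eval s = 0 → Runs d s T Q) :
    Runs (.ite e c d) s (e.cost + 1 + T) Q := by
  by_cases he : e.eval s = 0
  · obtain ⟨s', t, hexec, ht, hQ⟩ := hd he
    exact ⟨s', _, .iteFalse he hexec, by omega, hQ⟩
  · obtain ⟨s', t, hexec, ht, hQ⟩ := hc he
    exact ⟨s', _, .iteTrue he hexec, by omega, hQ⟩

theorem loop (I : ℕ → State → Prop) (m : ℕ)
    (hc : ∀ i < m, ∀ s, I i s → e.eval s ≠ 0 ∧ Runs c s T (I (i + 1)))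
    (hm : ∀ s, I m s → e.eval s = 0) (h0 : I 0 s) :
    Runs (.loop e c) s (m * (e.cost + 1 + T) + (e.cost + 1)) (I m) := by
  induction m generalizing I s with
  | zero => exact ⟨s, _, .loopFalse (hm s h0), by simp, h0⟩
  | succ m ih =>
    obtain ⟨he, s', t, hexec, ht, hI⟩ := hc 0 m.succ_pos s h0
    obtain ⟨s'', u, hloop, hu, hI'⟩ :=
      ih (fun i => I (i + 1)) (fun i hi => hc (i + 1) (by omega)) hm hI
    refine ⟨s'', _, .loopTrue he hexec hloop, ?_, hI'⟩
    rw [Nat.succ_mul]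
    omega

end Runs

/-- Run `c` for the values `0, …, n - 1` of register `r`, where `n` is the content of
register `0`. -/
def forReg (r : ℕ) (c : Cmd) : Cmd :=
  .seq (.assign r (.const 0))
    (.loop (.sub (.var 0) (.var r)) (.seq c (.assign r (.add (.var r) (.const 1)))))

theorem Runs.forReg {n r T : ℕ} {c : Cmd} {s : State} (I : ℕ → State → Prop)
    (hn : ∀ i s, I i s → s.reg 0 = n) (hreg : ∀ i s v, I i s → I i (s.setReg r v))
    (hc : ∀ i < n, ∀ s, I i s → s.reg r = i →
      Runs c s T fun s' => I (i + 1) s' ∧ s'.reg r = i) (h0 : I 0 s) :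
    Runs (forReg r c) s (n * (T + 8) + 6) (I n) := by
  have hloop : Runs _ (s.setReg r 0) _ fun s' => I n s' ∧ s'.reg r = n :=
    Runs.loop (e := .sub (.var 0) (.var r)) (c := .seq c (.assign r (.add (.var r) (.const 1))))
      (T := T + 4) (fun i s => I i s ∧ s.reg r = i) n
      (fun i hi s hs => ⟨by simp only [Expr.eval, hn i s hs.1, hs.2]; omega,
        .seq <| (hc i hi s hs.1 hs.2).mono le_rfl fun s' hs' =>
          .assign ⟨hreg _ _ _ hs'.1, by simp [Expr.eval, hs'.2]⟩⟩)
      (fun s hs => by simp [Expr.eval, hn n s hs.1, hs.2]) ⟨hreg _ _ _ h0, by simp⟩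
  refine (Runs.seq (.assign (hloop.mono le_rfl fun s' hs' => hs'.1))).mono ?_ fun _ h => h
  simp only [Expr.cost]
  linarith

/-- The position of the entry `v` in a table indexed by `Fin k → Fin n`: the number with digits
`v 0, …, v (k - 1)` in base `n`, least significant digit first. -/
def position {n k : ℕ} (v : Fin k → Fin n) : ℕ := finFunctionFinEquiv v

theorem position_injective {n k : ℕ} : Function.Injective (position : (Fin k → Fin n) → ℕ) :=
  Fin.val_injective.comp finFunctionFinEquiv.injective

theorem position_lt {n k : ℕ} (v : Fin k → Fin n) : position v < n ^ k :=
  (finFunctionFinEquiv v).isLt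

theorem position_eq_tail {n k : ℕ} (v : Fin (k + 1) → Fin n) :
    position v = position (Fin.tail v) * n + v 0 := by
  simp only [position, finFunctionFinEquiv_apply, Fin.sum_univ_succ, Finset.sum_mul, Fin.tail,
    Fin.val_succ, Fin.val_zero, pow_succ, pow_zero, mul_one, mul_assoc]
  exact add_comm _ _

theorem position_snoc {n k : ℕ} (v : Fin k → Fin n) (i : Fin n) :
    position (Fin.snoc v i : Fin (k + 1) → Fin n) = i * n ^ k + position v := by
  simp [position, Fin.sum_univ_castSucc, add_comm]

/-- Nested loops: run `c` for all values below `n` of the registers `r, …, r + k - 1`, where `n` is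
the content of register `0`; the loop over register `r` is the innermost one. -/
def forVec (r : ℕ) : ℕ → Cmd → Cmd
  | 0, c => c
  | k + 1, c => forReg (r + k) (forVec r k c)

/-- The running time of `forVec` for a body with running time `T`. -/
def forVecTime (n k T : ℕ) : ℕ := (fun T => n * (T + 8) + 6)^[k] T

theorem Runs.forVec {n k r T : ℕ} {c : Cmd} {s : State} (I : ℕ → State → Prop)
    (hn : ∀ i s, I i s → s.reg 0 = n)
    (hreg : ∀ i s x v, r ≤ x → x < r + k → I i s → I i (s.setReg x v))
    (hc : ∀ (v : Fin k → Fin n) (s), I (position v) s → (∀ i : Fin k, s.reg (r + i) = v i) →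
      Runs c s T fun s' => I (position v + 1) s' ∧ ∀ i : Fin k, s'.reg (r + i) = v i)
    (h0 : I 0 s) : Runs (forVec r k c) s (forVecTime n k T) (I (n ^ k)) := by
  induction k generalizing I s with
  | zero =>
    have hpos : position (Fin.elim0 : Fin 0 → Fin n) = 0 := by simp [position]
    refine (hc Fin.elim0 s (by rwa [hpos]) (fun i => i.elim0)).mono le_rfl fun s' hs' => ?_
    simpa [hpos] using hs'.1
  | succ k ih =>
    rw [forVecTime, Function.iterate_succ_apply', pow_succ']
    refine Runs.forReg (fun i => I (i * n ^ k)) (fun i => hn _)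
      (fun i s v => hreg _ _ _ _ (by omega) (by omega)) (fun i hi s hI hs => ?_) (by simpa using h0)
    simp only [Nat.succ_mul]
    refine ih (fun j s => I (i * n ^ k + j) s ∧ s.reg (r + k) = i) (fun j s h => hn _ _ h.1)
      (fun j s x v hx hxk h => ⟨hreg _ _ _ _ hx (by omega) h.1, ?_⟩) (fun v s' hI' hs' => ?_)
      ⟨hI, hs⟩
    · rw [State.reg_setReg, if_neg (by omega)]
      exact h.2
    · have hpos := position_snoc v ⟨i, hi⟩
      have := hc (Fin.snoc v ⟨i, hi⟩) s' (hpos ▸ hI'.1)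
        (Fin.lastCases (by simpa using hI'.2) (by simpa using hs'))
      refine this.mono le_rfl fun s'' hs'' => ⟨⟨?_, ?_⟩, fun j => ?_⟩
      · simpa [hpos, add_assoc] using hs''.1
      · simpa using hs''.2 (Fin.last k)
      · simpa using hs''.2 j.castSucc

/-- `x ↦ x * n + y` on registers, where `n` is the content of register `0`; the registers `x + 1`
and `x + 2` are overwritten. -/
def mulAdd (x y : ℕ) : Cmd :=
  .seq (.assign (x + 1) (.var y))
    (.seq (forReg (x + 2) (.assign (x + 1) (.add (.var (x + 1)) (.var x))))
      (.assign x (.var (x + 1))))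

theorem Runs.mulAdd {n x y : ℕ} {s : State} (hn : s.reg 0 = n) :
    Runs (mulAdd x y) s (n * 12 + 10) fun s' =>
      State.EqOn (Set.Iio x) Set.univ s s' ∧ s'.reg x = s.reg x * n + s.reg y := by
  let I i s' := State.EqOn (Set.Iio (x + 1)) Set.univ s s' ∧
    s'.reg (x + 1) = s.reg x * i + s.reg y
  have hloop : Runs (RAM.forReg (x + 2) (.assign (x + 1) (.add (.var (x + 1)) (.var x))))
      (s.setReg (x + 1) (s.reg y)) (n * (4 + 8) + 6) (I n) := by
    refine Runs.forReg I (fun i s' h => (h.1.1 (by simp)).trans hn)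
      (fun i s' v h => ⟨h.1.setReg (by simp) v, by simpa using h.2⟩)
      (fun i _ s' h hi => .assign ⟨⟨h.1.setReg (by simp) _, ?_⟩, by simpa using hi⟩)
      ⟨(State.EqOn.refl _ _ s).setReg (by simp) _, by simp⟩
    have hreg : s'.reg x = s.reg x := h.1.1 (by simp)
    simp only [Expr.eval, State.reg_setReg, if_true, h.2, hreg]
    ring
  have hassign (s') (h : I n s') : Runs (.assign x (.var (x + 1))) s' 2 fun s' =>
      State.EqOn (Set.Iio x) Set.univ s s' ∧ s'.reg x = s.reg x * n + s.reg y :=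
    .assign ⟨(h.1.mono (Set.Iio_subset_Iio (by omega)) le_rfl).setReg (by simp) _,
      by simpa [Expr.eval] using h.2⟩
  refine (Runs.seq (.assign (.seq (hloop.mono le_rfl hassign)))).mono ?_ fun _ h => h
  simp only [Expr.cost]
  omega

/-- Put into register `d` the position of the table entry whose coordinates are in the registers
`f 0, …, f (k - 1)`; the registers `d + 1` and `d + 2` are overwritten. -/
def loadPosition (d : ℕ) : (k : ℕ) → (Fin k → ℕ) → Cmd
  | 0, _ => .assign d (.const 0)
  | k + 1, f => .seq (loadPosition d k (Fin.tail f)) (mulAdd d (f 0))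

theorem Runs.loadPosition {n d k : ℕ} {s : State} {f : Fin k → ℕ} {v : Fin k → Fin n} (hd : d ≠ 0)
    (hf : ∀ i, f i < d) (hn : s.reg 0 = n) (hv : ∀ i, s.reg (f i) = v i) :
    Runs (loadPosition d k f) s (k * (n * 12 + 10) + 2) fun s' =>
      State.EqOn (Set.Iio d) Set.univ s s' ∧ s'.reg d = position v := by
  induction k with
  | zero =>
    exact (Runs.assign ⟨(State.EqOn.refl _ _ s).setReg (by simp) _,
      by simp [Expr.eval, position]⟩).mono (by simp [Expr.cost]) fun _ h => h
  | succ k ih =>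
    have hload := ih (f := Fin.tail f) (v := Fin.tail v) (fun i => hf _) (fun i => hv _)
    have htime : (k + 1) * (n * 12 + 10) + 2 = k * (n * 12 + 10) + 2 + (n * 12 + 10) := by ring
    rw [htime]
    refine Runs.seq (hload.mono le_rfl fun s' hs' => ?_)
    have hn' : s'.reg 0 = n := (hs'.1.1 (Nat.pos_of_ne_zero hd)).trans hn
    refine (Runs.mulAdd hn').mono le_rfl fun s'' hs'' => ⟨hs'.1.trans hs''.1, ?_⟩
    rw [hs''.2, hs'.2, hs'.1.1 (hf 0), hv, position_eq_tail]

/-- Run the programs `c 0, …, c (m - 1)` one after the other. -/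
def seqAll : (m : ℕ) → (Fin m → Cmd) → Cmd
  | 0, _ => .skip
  | m + 1, c => .seq (seqAll m fun i => c i.castSucc) (c (Fin.last m))

theorem Runs.seqAll {m T : ℕ} {c : Fin m → Cmd} {s : State} (I : ℕ → State → Prop)
    (hc : ∀ (i : Fin m) (s), I i s → Runs (c i) s T (I (i + 1))) (h0 : I 0 s) :
    Runs (seqAll m c) s (m * T + 1) (I m) := by
  induction m with
  | zero => exact (Runs.skip h0).mono (by simp) fun _ h => h
  | succ m ih =>
    have hinit := ih fun i s => hc i.castSucc s
    exact (Runs.seq (hinit.mono le_rfl (hc (Fin.last m)))).mono (by linarith) fun _ h => h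

/-- Put the value that `c` leaves in register `D + k` into array `a`, at the position of the entry
whose coordinates are in the registers `D, …, D + k - 1`. -/
def fillEntry (a D k : ℕ) (c : Cmd) : Cmd :=
  .seq c (.seq (loadPosition (D + k + 1) k fun i => D + i)
    (.write a (.var (D + k + 1)) (.var (D + k))))

theorem Runs.fillEntry {n a D k T x : ℕ} {c : Cmd} {s : State} {v : Fin k → Fin n}
    (hn : s.reg 0 = n) (hv : ∀ i : Fin k, s.reg (D + i) = v i) (hD : 0 < D)
    (hc : Runs c s T fun s' => s.EqOn (Set.Iio (D + k)) (Set.Iio (D + k)) s' ∧ s'.reg (D + k) = x) :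
    Runs (fillEntry a D k c) s (T + (k * (n * 12 + 10) + 2 + 3)) fun s' =>
      ∃ s₁, s.EqOn (Set.Iio (D + k)) (Set.Iio (D + k)) s₁ ∧ s' = s₁.setArr a (position v) x := by
  refine .seq (hc.mono le_rfl fun s₁ h₁ => ?_)
  have hload := Runs.loadPosition (s := s₁) (d := D + k + 1) (f := fun i : Fin k => D + i) (v := v)
    (by omega) (by omega) ((h₁.1.1 (by simp; omega)).trans hn)
    (fun i => (h₁.1.1 (by simp)).trans (hv i))
  refine Runs.seq (hload.mono le_rfl fun s₂ h₂ => ?_)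
  have hframe : s.EqOn (Set.Iio (D + k)) (Set.Iio (D + k)) s₂ :=
    h₁.1.trans (h₂.1.mono (Set.Iio_subset_Iio (by omega)) (Set.subset_univ _))
  have hx : s₂.reg (D + k) = x := (h₂.1.1 (by simp)).trans h₁.2
  exact (Runs.write ⟨s₂, hframe, by simp only [Expr.eval, h₂.2, hx]⟩).mono
    le_rfl fun _ h => h

/-- The running time of `forVec` with the body `fillEntry`, for a program with running time `T`. -/
def fillTime (n k T : ℕ) : ℕ := forVecTime n k (T + (k * (n * 12 + 10) + 2 + 3))

theorem Runs.forVec_fillEntry {n a D k T : ℕ} {c : Cmd} {s₀ : State} (hD : 0 < D)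
    (hn : s₀.reg 0 = n) (g : (Fin k → Fin n) → ℕ)
    (hc : ∀ v s, s₀.EqOn (Set.Iio D) (Set.Iio D \ {a}) s → (∀ i : Fin k, s.reg (D + i) = v i) →
      Runs c s T fun s' => s.EqOn (Set.Iio (D + k)) (Set.Iio (D + k)) s' ∧ s'.reg (D + k) = g v)
    (ha : a < D) :
    Runs (RAM.forVec D k (RAM.fillEntry a D k c)) s₀ (fillTime n k T) fun s =>
      s₀.EqOn (Set.Iio D) (Set.Iio D \ {a}) s ∧ ∀ v, s.arr a (position v) = g v := by
  let I i s := s₀.EqOn (Set.Iio D) (Set.Iio D \ {a}) s ∧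
    ∀ v, position v < i → s.arr a (position v) = g v
  have hentry (v : Fin k → Fin n) (s) (hs : I (position v) s)
      (hv : ∀ i : Fin k, s.reg (D + i) = v i) :
      Runs (RAM.fillEntry a D k c) s (T + (k * (n * 12 + 10) + 2 + 3)) fun s' =>
        I (position v + 1) s' ∧ ∀ i : Fin k, s'.reg (D + i) = v i := by
    refine (Runs.fillEntry ((hs.1.1 hD).trans hn) hv hD (hc v s hs.1 hv)).mono le_rfl ?_
    rintro _ ⟨s₁, h₁, rfl⟩
    have hframe : s.EqOn (Set.Iio D) (Set.Iio D) s₁ :=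
      h₁.mono (Set.Iio_subset_Iio (by omega)) (Set.Iio_subset_Iio (by omega))
    refine ⟨⟨(hs.1.trans (hframe.mono le_rfl Set.sdiff_subset)).setArr (by simp) _ _,
      fun w hw => ?_⟩, fun i => (h₁.1 (by simp)).trans (hv i)⟩
    rw [State.arr_setArr_self]
    split_ifs with hwv
    · rw [position_injective hwv]
    · rw [hframe.2 ha]
      exact hs.2 w (by omega)
  exact (Runs.forVec I (fun i s h => (h.1.1 hD).trans hn)
    (fun i s x v hx _ h => ⟨h.1.setReg (by simpa using hx) v, h.2⟩) hentry
    ⟨.refl _ _ _, by simp⟩).mono le_rfl fun s hs => ⟨hs.1, fun v => hs.2 v (position_lt v)⟩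

/-- Fill the tables in the arrays `A, …, A + m - 1`: the entry `v` of the `j`-th table is the number
that `c j` puts into register `D + k` when the registers `D, …, D + k - 1` hold `v`. -/
def tabulate (A D k m : ℕ) (c : Fin m → Cmd) : Cmd :=
  seqAll m fun j => forVec D k (fillEntry (A + j) D k (c j))

theorem Runs.tabulate {n A D k m T : ℕ} {c : Fin m → Cmd} {s₀ : State} (hD : 0 < D)
    (hAD : A + m ≤ D) (hn : s₀.reg 0 = n) (g : Fin m → (Fin k → Fin n) → ℕ)
    (hc : ∀ j v s, s₀.EqOn (Set.Iio D) (Set.Iio D \ Set.Ico A (A + m)) s →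
      (∀ i : Fin k, s.reg (D + i) = v i) →
      Runs (c j) s T fun s' => s.EqOn (Set.Iio (D + k)) (Set.Iio (D + k)) s' ∧
        s'.reg (D + k) = g j v) :
    Runs (tabulate A D k m c) s₀ (m * fillTime n k T + 1) fun s =>
      s₀.EqOn (Set.Iio D) (Set.Iio D \ Set.Ico A (A + m)) s ∧
        ∀ (j : Fin m) v, s.arr (A + j) (position v) = g j v := by
  let I i s := s₀.EqOn (Set.Iio D) (Set.Iio D \ Set.Ico A (A + m)) s ∧
    ∀ (j : Fin m) v, j.val < i → s.arr (A + j) (position v) = g j v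
  have hsub (j : Fin m) : Set.Iio D \ Set.Ico A (A + m) ⊆ Set.Iio D \ {A + j.val} :=
    Set.sdiff_subset_sdiff_right (by simp)
  refine (Runs.seqAll I (fun j s hs => ?_) ⟨.refl _ _ _, by simp⟩).mono le_rfl
    fun s hs => ⟨hs.1, fun j v => hs.2 j v j.2⟩
  refine (Runs.forVec_fillEntry hD ((hs.1.1 hD).trans hn) (g j)
    (fun v s' hs' hv => hc j v s' (hs.1.trans (hs'.mono le_rfl (hsub j))) hv) (by omega)).mono
    le_rfl fun s' hs' => ⟨hs.1.trans (hs'.1.mono le_rfl (hsub j)), fun i v hi => ?_⟩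
  obtain hij | rfl := (Nat.lt_succ_iff.1 hi).lt_or_eq.imp_right Fin.ext
  · rw [hs'.1.2 (by simp; omega)]
    exact hs.2 i v hij
  · exact hs'.2 v

end RAM

namespace RAM

open Classical in
/-- The number that represents a truth value in memory. -/
noncomputable def boolVal (p : Prop) : ℕ := if p then 1 else 0

theorem boolVal_eq_one {p : Prop} : boolVal p = 1 ↔ p := by
  simp [boolVal]

theorem boolVal_eq_zero {p : Prop} : boolVal p = 0 ↔ ¬ p := by
  simp [boolVal]

@[simp]
theorem boolVal_of_pos {p : Prop} (h : p) : boolVal p = 1 := boolVal_eq_one.2 h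

@[simp]
theorem boolVal_of_neg {p : Prop} (h : ¬ p) : boolVal p = 0 := boolVal_eq_zero.2 h

/-- A way to keep data of size `n` in memory; only the registers and arrays below `base` matter. -/
structure Layout where
  Data : ℕ → Type
  Stored : ∀ {n}, Data n → State → Prop
  base : ℕ
  stored_congr : ∀ {n} {x : Data n} {s s' : State}, Stored x s →
    s.EqOn (Set.Iio base) (Set.Iio base) s' → Stored x s'

namespace Layout

/-- A vertex in register `r`. -/
def elem (r : ℕ) : Layout where
  Data := Fin
  Stored v s := s.reg r = v
  base := r + 1
  stored_congr h hs := (hs.1 (by simp)).trans h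

/-- A vector of vertices in the registers `r, …, r + k - 1`. -/
def vec (r k : ℕ) : Layout where
  Data n := Fin k → Fin n
  Stored {_} v s := ∀ i : Fin k, s.reg (r + i) = v i
  base := r + k
  stored_congr h hs i := (hs.1 (by simp)).trans (h i)

/-- A family of `m` relations of arity `k`, in the arrays `a, …, a + m - 1`. -/
def tables (a m k : ℕ) : Layout where
  Data n := Fin m → (Fin k → Fin n) → Prop
  Stored R s := ∀ (j : Fin m) v, s.arr (a + j) (position v) = boolVal (R j v)
  base := a + m
  stored_congr h hs j v := by
    rw [hs.2 (by simp)]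
    exact h j v

end Layout

/-- A layout that includes a graph in the format of `graphInput`. -/
structure Context extends Layout where
  graph : ∀ {n}, Data n → SimpleGraph (Fin n)
  base_pos : 0 < base
  reg_zero : ∀ {n} {x : Data n} {s}, Stored x s → s.reg 0 = n
  arr_zero : ∀ {n} {x : Data n} {s}, Stored x s → ∀ u v : Fin n,
    s.arr 0 (u * n + v) = boolVal ((graph x).Adj u v)

namespace Context

/-- The context that consists of nothing but a graph. -/
def graphOnly : Context where
  Data n := SimpleGraph (Fin n)
  Stored {n} G s := s.reg 0 = n ∧ ∀ u v : Fin n, s.arr 0 (u * n + v) = boolVal (G.Adj u v)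
  base := 1
  stored_congr h hs := ⟨(hs.1 (by simp)).trans h.1, fun u v => by
    rw [hs.2 (by simp)]
    exact h.2 u v⟩
  graph G := G
  base_pos := one_pos
  reg_zero h := h.1
  arr_zero h := h.2

/-- The context `Γ` together with further data. -/
def prod (Γ : Context) (Y : Layout) : Context where
  Data n := Γ.Data n × Y.Data n
  Stored p s := Γ.Stored p.1 s ∧ Y.Stored p.2 s
  base := max Γ.base Y.base
  stored_congr h hs :=
    ⟨Γ.stored_congr h.1 (hs.mono (Set.Iio_subset_Iio (le_max_left _ _))
      (Set.Iio_subset_Iio (le_max_left _ _))),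
    Y.stored_congr h.2 (hs.mono (Set.Iio_subset_Iio (le_max_right _ _))
      (Set.Iio_subset_Iio (le_max_right _ _)))⟩
  graph p := Γ.graph p.1
  base_pos := lt_max_of_lt_left Γ.base_pos
  reg_zero h := Γ.reg_zero h.1
  arr_zero h := Γ.arr_zero h.1

/-- `Γ` together with a vertex in register `r`. -/
abbrev elem (Γ : Context) (r : ℕ) : Context := Γ.prod (.elem r)

/-- `Γ` together with a vector of vertices in the registers `r, …, r + k - 1`. -/
abbrev vec (Γ : Context) (r k : ℕ) : Context := Γ.prod (.vec r k)

/-- `Γ` together with a family of `m` relations of arity `k` in the arrays `a, …, a + m - 1`. -/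
abbrev tables (Γ : Context) (a m k : ℕ) : Context := Γ.prod (.tables a m k)

theorem stored_of_eqOn (Γ : Context) {n b b' : ℕ} {x : Γ.Data n} {s s' : State}
    (hx : Γ.Stored x s) (hb : Γ.base ≤ b) (hb' : Γ.base ≤ b')
    (hs : s.EqOn (Set.Iio b) (Set.Iio b') s') : Γ.Stored x s' :=
  Γ.stored_congr hx (hs.mono (Set.Iio_subset_Iio hb) (Set.Iio_subset_Iio hb'))

end Context

variable {Γ : Context}

/-- A property of the data of a context is polynomial-time decidable: a program puts its truth value
into any given register that does not hold the data, and leaves the memory below unchanged. -/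
def PolyDec (Γ : Context) (P : ∀ n, Γ.Data n → Prop) : Prop :=
  ∀ b ≥ Γ.base, ∃ (c : Cmd) (p : Polynomial ℕ), ∀ n (x : Γ.Data n) s, Γ.Stored x s →
    Runs c s (p.eval n) fun s' =>
      s.EqOn (Set.Iio b) (Set.Iio b) s' ∧ s'.reg b = boolVal (P n x)

/-- A vertex that depends on the data of a context and is always found in the same register. -/
def IsElem (Γ : Context) (f : ∀ n, Γ.Data n → Fin n) : Prop :=
  ∃ r < Γ.base, ∀ n (x : Γ.Data n) s, Γ.Stored x s → s.reg r = f n x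

/-- A relation of arity `k` that depends on the data of a context and is always found in the same
array. -/
def IsTable (Γ : Context) (k : ℕ) (R : ∀ n, Γ.Data n → (Fin k → Fin n) → Prop) : Prop :=
  ∃ a, ∀ n (x : Γ.Data n) s, Γ.Stored x s → ∀ v, s.arr a (position v) = boolVal (R n x v)

section Basic

variable {Y : Layout} {r k m a : ℕ}

theorem IsElem.fst {f : ∀ n, Γ.Data n → Fin n} (h : IsElem Γ f) :
    IsElem (Γ.prod Y) fun n p => f n p.1 :=
  let ⟨r, hr, h⟩ := h
  ⟨r, lt_max_of_lt_left hr, fun n p s hs => h n p.1 s hs.1⟩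

theorem isElem_snd : IsElem (Γ.elem r) fun _ p => p.2 :=
  ⟨r, lt_max_of_lt_right r.lt_succ_self, fun _ _ _ hs => hs.2⟩

theorem isElem_snd_apply (i : Fin k) : IsElem (Γ.vec r k) fun _ p => p.2 i :=
  ⟨r + i, lt_max_of_lt_right (by simp [Layout.vec]), fun _ _ _ hs => hs.2 i⟩

theorem IsTable.fst {R : ∀ n, Γ.Data n → (Fin k → Fin n) → Prop} (h : IsTable Γ k R) :
    IsTable (Γ.prod Y) k fun n p => R n p.1 :=
  let ⟨a, h⟩ := h
  ⟨a, fun n p s hs => h n p.1 s hs.1⟩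

theorem isTable_snd (j : Fin m) : IsTable (Γ.tables a m k) k fun _ p => p.2 j :=
  ⟨a + j, fun _ _ _ hs => hs.2 j⟩

theorem isTable_adj : IsTable Γ 2 fun _ x v => (Γ.graph x).Adj (v 1) (v 0) := by
  refine ⟨0, fun n x s hs v => ?_⟩
  rw [← Γ.arr_zero hs]
  simp [position, add_comm]

end Basic

namespace PolyDec

variable {P Q : ∀ n, Γ.Data n → Prop} {u v : ∀ n, Γ.Data n → Fin n}

theorem of_iff (h : PolyDec Γ P) (hPQ : ∀ n x, P n x ↔ Q n x) : PolyDec Γ Q :=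
  (funext₂ fun n x => propext (hPQ n x) : P = Q) ▸ h

theorem comap {Γ' : Context} (h : PolyDec Γ P) (π : ∀ n, Γ'.Data n → Γ.Data n)
    (hbase : Γ.base ≤ Γ'.base)
    (hstored : ∀ {n} {x : Γ'.Data n} {s}, Γ'.Stored x s → Γ.Stored (π n x) s) :
    PolyDec Γ' fun n x => P n (π n x) := fun b hb =>
  let ⟨c, p, h⟩ := h b (hbase.trans hb)
  ⟨c, p, fun n x s hs => h n (π n x) s (hstored hs)⟩

theorem of_elem {P : ∀ n, Γ.Data n → Fin n → Prop}
    (h : ∀ r, PolyDec (Γ.elem r) fun n p => P n p.1 p.2) (hu : IsElem Γ u) :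
    PolyDec Γ fun n x => P n x (u n x) := by
  obtain ⟨r, hr, hu⟩ := hu
  intro b hb
  obtain ⟨c, p, h⟩ := h r b (max_le hb (hr.trans_le hb))
  exact ⟨c, p, fun n x s hs => h n (x, u n x) s ⟨hs, hu n x s hs⟩⟩

theorem const (p : Prop) : PolyDec Γ fun _ _ => p :=
  fun b _ => ⟨.assign b (.const (boolVal p)), 2, fun _ _ s _ =>
    (Runs.assign ⟨(State.EqOn.refl _ _ s).setReg (by simp) _, by simp [Expr.eval]⟩).mono
      (by simp [Expr.cost]) fun _ h => h⟩

protected theorem not (h : PolyDec Γ P) : PolyDec Γ fun n x => ¬ P n x := by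
  intro b hb
  obtain ⟨c, p, h⟩ := h b hb
  refine ⟨.seq c (.assign b (.sub (.const 1) (.var b))), p + 4, fun n x s hs => ?_⟩
  refine (Runs.seq ((h n x s hs).mono le_rfl fun s' hs' =>
    .assign ⟨hs'.1.setReg (by simp) _, ?_⟩)).mono (by simp [Expr.cost]) fun _ h => h
  by_cases hP : P n x <;> simp [Expr.eval, hs'.2, hP]

protected theorem and (hP : PolyDec Γ P) (hQ : PolyDec Γ Q) :
    PolyDec Γ fun n x => P n x ∧ Q n x := by
  intro b hb
  obtain ⟨c, p, hc⟩ := hP b hb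
  obtain ⟨d, q, hd⟩ := hQ b hb
  refine ⟨.seq c (.ite (.var b) d .skip), p + (q + 3), fun n x s hs => ?_⟩
  refine (Runs.seq ((hc n x s hs).mono le_rfl fun s' hs' => .ite (T := q.eval n + 1) (fun hb' => ?_)
    fun hb' => ?_)).mono (by simp [Expr.cost]; omega) fun _ h => h
  · have hPx : P n x := by simpa [Expr.eval, hs'.2, boolVal_eq_zero] using hb'
    exact (hd n x s' (Γ.stored_of_eqOn hs hb hb hs'.1)).mono (by omega) fun s'' hs'' =>
      ⟨hs'.1.trans hs''.1, by simpa [hPx] using hs''.2⟩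
  · have hPx : ¬ P n x := by simpa [Expr.eval, hs'.2, boolVal_eq_zero] using hb'
    exact (Runs.skip ⟨hs'.1, by simp [hs'.2, hPx]⟩).mono (by omega) fun _ h => h

protected theorem imp (hP : PolyDec Γ P) (hQ : PolyDec Γ Q) :
    PolyDec Γ fun n x => P n x → Q n x :=
  (hP.and hQ.not).not.of_iff fun n x => by tauto

protected theorem or (hP : PolyDec Γ P) (hQ : PolyDec Γ Q) :
    PolyDec Γ fun n x => P n x ∨ Q n x :=
  (hP.not.imp hQ).of_iff fun n x => by tauto

protected theorem ex {P : ∀ n, Γ.Data n → Fin n → Prop}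
    (h : ∀ r, PolyDec (Γ.elem r) fun n p => P n p.1 p.2) :
    PolyDec Γ fun n x => ∃ w, P n x w := by
  intro b hb
  obtain ⟨c, p, hc⟩ := h (b + 1) (b + 2) (max_le (by omega) le_rfl)
  refine ⟨.seq (.assign b (.const 0))
    (forReg (b + 1) (.seq c (.ite (.var (b + 2)) (.assign b (.const 1)) .skip))),
    2 + (.X * (p + 4 + 8) + 6), fun n x s hs => ?_⟩
  let I (i : ℕ) s' := s.EqOn (Set.Iio b) (Set.Iio b) s' ∧
    s'.reg b = boolVal (∃ w : Fin n, w < i ∧ P n x w)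
  have hbody (i) (hi : i < n) (s') (hs' : I i s') (hreg : s'.reg (b + 1) = i) :
      Runs (.seq c (.ite (.var (b + 2)) (.assign b (.const 1)) .skip)) s' (p.eval n + 4)
        fun s'' => I (i + 1) s'' ∧ s''.reg (b + 1) = i := by
    have hsucc : (∃ w : Fin n, w < i + 1 ∧ P n x w) ↔
        (∃ w : Fin n, w < i ∧ P n x w) ∨ P n x ⟨i, hi⟩ := by
      simp only [Nat.lt_succ_iff_lt_or_eq, or_and_right, exists_or]
      exact or_congr_right
        ⟨fun ⟨w, hw, hP⟩ => (Fin.ext hw : w = ⟨i, hi⟩) ▸ hP, fun h => ⟨_, rfl, h⟩⟩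
    refine .seq ((hc n (x, ⟨i, hi⟩) s' ⟨Γ.stored_of_eqOn hs hb hb hs'.1, hreg⟩).mono le_rfl
      fun s₁ ⟨heq, hval⟩ => .ite (T := 2) (fun h₁ => ?_) fun h₁ => ?_)
    all_goals
      have hframe : s.EqOn (Set.Iio b) (Set.Iio b) s₁ := hs'.1.trans
        (heq.mono (Set.Iio_subset_Iio (by omega)) (Set.Iio_subset_Iio (by omega)))
      have hreg₁ : s₁.reg (b + 1) = i := (heq.1 (by simp)).trans hreg
      simp only [Expr.eval, hval, ne_eq, boolVal_eq_zero, not_not] at h₁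
    · refine .assign ⟨⟨hframe.setReg (by simp) _, ?_⟩, by simpa using hreg₁⟩
      rw [hsucc]
      simp [Expr.eval, h₁]
    · have hreg₂ : s₁.reg b = s'.reg b := heq.1 (by simp)
      refine (Runs.skip ⟨⟨hframe, ?_⟩, hreg₁⟩).mono (by omega) fun _ h => h
      rw [hsucc, hreg₂, hs'.2]
      simp [h₁]
  have hloop := Runs.forReg (r := b + 1) I
    (fun i s' h => Γ.reg_zero (Γ.stored_of_eqOn hs hb hb h.1))
    (fun i s' v h => ⟨h.1.setReg (by simp) v, by simpa using h.2⟩) hbody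
    (s := s.setReg b 0) ⟨(State.EqOn.refl _ _ s).setReg (by simp) _, by simp⟩
  exact (Runs.seq (.assign (hloop.mono le_rfl fun s' h => ⟨h.1, by simpa using h.2⟩))).mono
    (by simp [Expr.cost]) fun _ h => h

protected theorem all {P : ∀ n, Γ.Data n → Fin n → Prop}
    (h : ∀ r, PolyDec (Γ.elem r) fun n p => P n p.1 p.2) :
    PolyDec Γ fun n x => ∀ w, P n x w :=
  (PolyDec.ex (P := fun n x w => ¬ P n x w) fun r => (h r).not).not.of_iff fun n x => by simp

protected theorem lt (hu : IsElem Γ u) (hv : IsElem Γ v) : PolyDec Γ fun n x => u n x < v n x := by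
  obtain ⟨r, _, hu⟩ := hu
  obtain ⟨r', _, hv⟩ := hv
  refine fun b _ => ⟨.ite (.sub (.var r') (.var r)) (.assign b (.const 1)) (.assign b (.const 0)),
    6, fun n x s hs => ?_⟩
  refine (Runs.ite (T := 2) (fun h => .assign ⟨(State.EqOn.refl _ _ s).setReg (by simp) _, ?_⟩)
    fun h => .assign ⟨(State.EqOn.refl _ _ s).setReg (by simp) _, ?_⟩).mono
    (by simp [Expr.cost]) fun _ h => h
  all_goals
    simp only [Expr.eval, hu n x s hs, hv n x s hs] at h
    simp only [Expr.eval, boolVal, State.reg_setReg, if_true, Fin.lt_def]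
    split_ifs <;> omega

protected theorem eq (hu : IsElem Γ u) (hv : IsElem Γ v) : PolyDec Γ fun n x => u n x = v n x :=
  ((PolyDec.lt hu hv).or (PolyDec.lt hv hu)).not.of_iff fun n x => by
    rw [← ne_iff_lt_or_gt, not_not]

theorem table {k : ℕ} {R : ∀ n, Γ.Data n → (Fin k → Fin n) → Prop}
    {w : ∀ n, Γ.Data n → Fin k → Fin n} (hR : IsTable Γ k R)
    (hw : ∀ i, IsElem Γ fun n x => w n x i) : PolyDec Γ fun n x => R n x (w n x) := by
  obtain ⟨a, hR⟩ := hR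
  choose r hr hw using hw
  refine fun b hb => ⟨.seq (loadPosition (b + 1) k r) (.assign b (.read a (.var (b + 1)))),
    k * (.X * 12 + 10) + 2 + 3, fun n x s hs => ?_⟩
  have hload := Runs.loadPosition (s := s) (d := b + 1) (f := r) (v := w n x) (by omega)
    (fun i => ((hr i).trans_le hb).trans b.lt_succ_self) (Γ.reg_zero hs) fun i => hw i n x s hs
  refine (Runs.seq (hload.mono le_rfl fun s' hs' => .assign ⟨?_, ?_⟩)).mono (by simp [Expr.cost])
    fun _ h => h
  · exact (hs'.1.mono (Set.Iio_subset_Iio (by omega)) (Set.subset_univ _)).setReg (by simp) _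
  · simp [Expr.eval, hs'.2, hs'.1.2 (Set.mem_univ a), hR n x s hs]

theorem adj (hu : IsElem Γ u) (hv : IsElem Γ v) :
    PolyDec Γ fun n x => (Γ.graph x).Adj (u n x) (v n x) :=
  table (w := fun n x => ![v n x, u n x]) isTable_adj (Fin.forall_fin_two.2 ⟨hv, hu⟩)

theorem exists_eval_eq_forVecTime (k : ℕ) (p : Polynomial ℕ) :
    ∃ q : Polynomial ℕ, ∀ n, q.eval n = forVecTime n k (p.eval n) := by
  induction k with
  | zero => exact ⟨p, fun n => rfl⟩
  | succ k ih =>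
    obtain ⟨q, hq⟩ := ih
    exact ⟨.X * (q + 8) + 6, fun n => by
      simp [forVecTime, Function.iterate_succ_apply', hq]⟩

theorem exists_tabulate {m k A D : ℕ} {R : ∀ n, Γ.Data n → Fin m → (Fin k → Fin n) → Prop}
    (hR : ∀ j, PolyDec (Γ.vec D k) fun n p => R n p.1 j p.2) (hΓ : Γ.base ≤ D) (hAD : A + m ≤ D)
    (hstored : ∀ n (x : Γ.Data n) s s', Γ.Stored x s →
      s.EqOn (Set.Iio D) (Set.Iio D \ Set.Ico A (A + m)) s' → Γ.Stored x s') :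
    ∃ (c : Cmd) (p : Polynomial ℕ), ∀ n (x : Γ.Data n) s, Γ.Stored x s →
      Runs c s (p.eval n) fun s' => s.EqOn (Set.Iio D) (Set.Iio D \ Set.Ico A (A + m)) s' ∧
        (Layout.tables A m k).Stored (R n x) s' := by
  choose c p hc using fun j => hR j (D + k) (max_le (by omega) le_rfl)
  obtain ⟨q, hq⟩ := exists_eval_eq_forVecTime k (∑ j, p j + (k * (.X * 12 + 10) + 2 + 3))
  refine ⟨tabulate A D k m c, m * q + 1, fun n x s hs => ?_⟩
  have hfill : (m * q + 1).eval n = m * fillTime n k ((∑ j, p j).eval n) + 1 := by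
    simp [hq, fillTime]
  rw [hfill]
  refine Runs.tabulate (Γ.base_pos.trans_le hΓ) hAD (Γ.reg_zero hs) _ fun j v s' hs' hv => ?_
  refine (hc j n (x, v) s' ⟨hstored n x s s' hs hs', hv⟩).mono ?_ fun _ h => h
  rw [Polynomial.eval_finsetSum]
  exact Finset.single_le_sum (f := fun j => (p j).eval n) (fun _ _ => Nat.zero_le _)
    (Finset.mem_univ j)

theorem Iio_subset_Iio_sdiff_Ico {i A B D : ℕ} (hA : i ≤ A) (hD : i ≤ D) :
    Set.Iio i ⊆ Set.Iio D \ Set.Ico A B := by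
  intro x hx
  simp only [Set.mem_Iio, Set.mem_sdiff, Set.mem_Ico] at hx ⊢
  omega

section Iterate

variable {m k : ℕ}
  {F : ∀ n, Γ.Data n → (Fin m → (Fin k → Fin n) → Prop) → Fin m → (Fin k → Fin n) → Prop}

theorem exists_clear_tables (m k : ℕ) {b D : ℕ} (hb : Γ.base ≤ b) (hD : b + m ≤ D) :
    ∃ (c : Cmd) (p : Polynomial ℕ), ∀ n x s, Γ.Stored (n := n) x s →
      Runs c s (p.eval n) fun s' => s.EqOn (Set.Iio D) (Set.Iio b) s' ∧
        (Γ.tables b m k).Stored (x, fun _ _ => False) s' := by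
  obtain ⟨c, p, hc⟩ := exists_tabulate (Γ := Γ) (m := m) (k := k) (A := b) (D := D)
    (R := fun n _ _ _ => False) (fun _ => const False) (by omega) hD
    fun n x s s' hs h => Γ.stored_congr hs (h.mono (Set.Iio_subset_Iio (by omega))
      (Iio_subset_Iio_sdiff_Ico hb (by omega)))
  refine ⟨c, p, fun n x s hs => (hc n x s hs).mono le_rfl fun s' hs' => ?_⟩
  have hframe := hs'.1.mono le_rfl (Iio_subset_Iio_sdiff_Ico le_rfl (by omega))
  exact ⟨hframe, Γ.stored_of_eqOn hs (by omega) hb hframe, hs'.2⟩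

theorem exists_copy_tables (m k : ℕ) {b D : ℕ} (hb : Γ.base ≤ b) (hD : b + 2 * m ≤ D) :
    ∃ (c : Cmd) (p : Polynomial ℕ), ∀ n x T s, (Γ.tables (b + m) m k).Stored (n := n) (x, T) s →
      Runs c s (p.eval n) fun s' => s.EqOn (Set.Iio D) (Set.Iio b) s' ∧
        (Γ.tables b m k).Stored (x, T) s' := by
  have hbase : (Γ.tables (b + m) m k).base ≤ D := max_le (by omega) (by simp [Layout.tables]; omega)
  obtain ⟨c, p, hc⟩ := exists_tabulate (Γ := Γ.tables (b + m) m k) (A := b) (D := D)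
    (R := fun n p => p.2) (fun j => table (isTable_snd j).fst isElem_snd_apply)
    hbase (by omega) fun n x s s' hs h => ⟨Γ.stored_congr hs.1 (h.mono
      (Set.Iio_subset_Iio (by omega)) (Iio_subset_Iio_sdiff_Ico hb (by omega))), fun j v => by
        rw [h.2 (by simp; omega)]
        exact hs.2 j v⟩
  refine ⟨c, p, fun n x T s hs => (hc n (x, T) s hs).mono le_rfl fun s' hs' => ?_⟩
  have hframe := hs'.1.mono le_rfl (Iio_subset_Iio_sdiff_Ico le_rfl (by omega))
  exact ⟨hframe, Γ.stored_of_eqOn hs.1 (by omega) hb hframe, hs'.2⟩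

theorem exists_update_tables
    (hF : ∀ a r j, PolyDec ((Γ.tables a m k).vec r k) fun n p => F n p.1.1 p.1.2 j p.2)
    {b D : ℕ} (hb : Γ.base ≤ b) (hD : b + 2 * m ≤ D) :
    ∃ (c : Cmd) (p : Polynomial ℕ), ∀ n x T s, (Γ.tables b m k).Stored (n := n) (x, T) s →
      Runs c s (p.eval n) fun s' => s.EqOn (Set.Iio D) (Set.Iio b) s' ∧
        (Γ.tables b m k).Stored (x, F n x T) s' := by
  have hbase : (Γ.tables b m k).base ≤ b + m := max_le (by omega) le_rfl
  obtain ⟨c, p, hc⟩ := exists_tabulate (Γ := Γ.tables b m k) (A := b + m) (D := D)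
    (R := fun n p => F n p.1 p.2) (hF b D) (by omega) (by omega)
    fun n x s s' hs h => (Γ.tables b m k).stored_congr hs
      (h.mono (Set.Iio_subset_Iio (by omega)) (Iio_subset_Iio_sdiff_Ico hbase (by omega)))
  obtain ⟨d, q, hd⟩ := exists_copy_tables m k hb hD
  refine ⟨.seq c d, p + q, fun n x T s hs => ?_⟩
  rw [Polynomial.eval_add]
  refine .seq ((hc n (x, T) s hs).mono le_rfl fun s₁ hs₁ => ?_)
  have hframe := hs₁.1.mono le_rfl (Iio_subset_Iio_sdiff_Ico (i := b) (by omega) (by omega))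
  exact (hd n x (F n x T) s₁ ⟨Γ.stored_of_eqOn hs.1 (by omega) hb hframe, hs₁.2⟩).mono le_rfl
    fun s₂ hs₂ => ⟨hframe.trans hs₂.1, hs₂.2⟩

theorem exists_iterate_tables (e : ℕ)
    (hF : ∀ a r j, PolyDec ((Γ.tables a m k).vec r k) fun n p => F n p.1.1 p.1.2 j p.2)
    {b : ℕ} (hb : Γ.base ≤ b) :
    ∃ (c : Cmd) (p : Polynomial ℕ), ∀ n x s, Γ.Stored (n := n) x s →
      Runs c s (p.eval n) fun s' => s.EqOn (Set.Iio b) (Set.Iio b) s' ∧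
        (Γ.tables b m k).Stored (x, (F n x)^[n ^ e] fun _ _ => False) s' := by
  obtain ⟨c₀, p₀, hc₀⟩ := exists_clear_tables (Γ := Γ) m k hb (le_refl (b + m))
  obtain ⟨c, p, hc⟩ := exists_update_tables hF hb (D := b + 2 * m + e) (by omega)
  obtain ⟨q, hq⟩ := exists_eval_eq_forVecTime e p
  refine ⟨.seq c₀ (forVec (b + 2 * m) e c), p₀ + q, fun n x s hs => ?_⟩
  let I i s' := s.EqOn (Set.Iio b) (Set.Iio b) s' ∧
    (Γ.tables b m k).Stored (x, (F n x)^[i] fun _ _ => False) s'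
  rw [Polynomial.eval_add, hq]
  refine .seq ((hc₀ n x s hs).mono le_rfl fun s₀ h₀ => ?_)
  refine Runs.forVec I (fun i s' h => Γ.reg_zero h.2.1) (fun i s' y w hy _ h => ?_)
    (fun v s' h hv => ?_) ⟨h₀.1.mono (Set.Iio_subset_Iio (by omega)) le_rfl, h₀.2⟩
  · have hy' : (Γ.tables b m k).base ≤ y := max_le (by omega) (by simp [Layout.tables]; omega)
    exact ⟨h.1.setReg (by simp; omega) w, (Γ.tables b m k).stored_of_eqOn h.2 hy' hy'
      ((State.EqOn.refl _ _ s').setReg Set.self_notMem_Iio w)⟩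
  · refine (hc n x _ s' h.2).mono le_rfl fun s'' h'' => ⟨⟨h.1.trans (h''.1.mono ?_ le_rfl), ?_⟩,
      fun i => (h''.1.1 (by simp)).trans (hv i)⟩
    · exact Set.Iio_subset_Iio (by omega)
    · rw [Function.iterate_succ_apply']
      exact h''.2

theorem iterate (e : ℕ) {Q : ∀ n, Γ.Data n → (Fin m → (Fin k → Fin n) → Prop) → Prop}
    (hF : ∀ a r j, PolyDec ((Γ.tables a m k).vec r k) fun n p => F n p.1.1 p.1.2 j p.2)
    (hQ : ∀ a, PolyDec (Γ.tables a m k) fun n p => Q n p.1 p.2) :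
    PolyDec Γ fun n x => Q n x ((F n x)^[n ^ e] fun _ _ => False) := by
  intro b hb
  obtain ⟨c, p, hc⟩ := exists_iterate_tables e hF hb
  obtain ⟨d, q, hd⟩ := hQ b (b + m) (max_le (by omega) le_rfl)
  refine ⟨.seq c (.seq d (.assign b (.var (b + m)))), p + (q + 2), fun n x s hs => ?_⟩
  refine (Runs.seq ((hc n x s hs).mono le_rfl fun s₁ h₁ => .seq ((hd n _ s₁ h₁.2).mono le_rfl
    fun s₂ h₂ => .assign ⟨?_, by simpa [Expr.eval] using h₂.2⟩))).mono (by simp [Expr.cost])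
    fun _ h => h
  exact (h₁.1.trans (h₂.1.mono (Set.Iio_subset_Iio (by omega))
    (Set.Iio_subset_Iio (by omega)))).setReg (by simp) _

end Iterate

end PolyDec

end RAM

theorem IsBurlingSet.fromRel_adj {V : Type*} {prec adj : V → V → Prop} (h : IsBurlingSet prec adj)
    {x y : V} : (SimpleGraph.fromRel adj).Adj x y ↔ adj x y ∨ adj y x := by
  rw [SimpleGraph.fromRel_adj, and_iff_right_iff_imp]
  rintro hxy rfl
  exact h.adj_acyclic x (.single (or_self_iff.1 hxy))

theorem exists_eq_transGen {α β : Type*} {r : α → α → Prop} {s : β → β → Prop} {f : α → β}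
    (hf : ∀ a b, s (f a) b → ∃ a', b = f a' ∧ r a a') {a : α} {b : β}
    (hb : Relation.TransGen s (f a) b) : ∃ a', b = f a' ∧ Relation.TransGen r a a' := by
  induction hb with
  | single hb => exact (hf _ _ hb).imp fun _ h => h.imp_right .single
  | tail _ hbc ih =>
    obtain ⟨a', rfl, ha'⟩ := ih
    exact (hf _ _ hbc).imp fun _ h => h.imp_right ha'.tail

namespace ProbedGraph

/-- A Burling set on the vertices of `P` that represents the graph of `P` and for which all
distinguished sets of `P` are upward closed chains. -/
structure IsOrientation (P : ProbedGraph) (prec adj : P.V → P.V → Prop) : Prop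
    extends IsBurlingSet prec adj where
  graph_eq : P.graph = SimpleGraph.fromRel adj
  probe_chain : ∀ S ∈ P.probes, ∀ x ∈ S, ∀ y ∈ S, x ≠ y → prec x y ∨ prec y x
  probe_up : ∀ S ∈ P.probes, ∀ x ∈ S, ∀ y, prec x y → y ∈ S

variable {P : ProbedGraph}

/-- The order on the next graph that puts everything attached to `S` below `S`. -/
inductive NextPrec (prec : P.V → P.V → Prop) : P.NextV → P.NextV → Prop
  | inMain {u v : P.V} (h : prec u v) : NextPrec prec (P.mainV u) (P.mainV v)
  | inCopy (S : P.probes) {u v : P.V} (h : prec u v) : NextPrec prec (P.copyV S u) (P.copyV S v)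
  | below (S : P.probes) (x : P.V ⊕ P.probes) {v : P.V} (h : v ∈ S.1) :
      NextPrec prec (.inr ⟨S, x⟩) (P.mainV v)

/-- The orientation of the next graph in which all edges at new vertices point away from them. -/
inductive NextAdj (adj : P.V → P.V → Prop) : P.NextV → P.NextV → Prop
  | inMain {u v : P.V} (h : adj u v) : NextAdj adj (P.mainV u) (P.mainV v)
  | inCopy (S : P.probes) {u v : P.V} (h : adj u v) : NextAdj adj (P.copyV S u) (P.copyV S v)
  | attach (S Q : P.probes) {u : P.V} (h : u ∈ Q.1) : NextAdj adj (P.newV S Q) (P.copyV S u)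

namespace IsOrientation

variable {prec adj : P.V → P.V → Prop}

theorem adj_iff (h : P.IsOrientation prec adj) {u v : P.V} :
    P.graph.Adj u v ↔ adj u v ∨ adj v u := by
  rw [h.graph_eq, h.fromRel_adj]

theorem nextPrec_irrefl (h : P.IsOrientation prec adj) (x : P.NextV) : ¬ NextPrec prec x x := by
  rintro (hx | ⟨S, hx⟩)
  exacts [h.prec_irrefl _ hx, h.prec_irrefl _ hx]

theorem nextPrec_trans (h : P.IsOrientation prec adj) {x y z : P.NextV} :
    NextPrec prec x y → NextPrec prec y z → NextPrec prec x z := by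
  rintro (hxy | ⟨S, hxy⟩ | ⟨S, x, hxy⟩) (hyz | ⟨_, hyz⟩ | ⟨_, _, hyz⟩)
  · exact .inMain (h.prec_trans _ _ _ hxy hyz)
  · exact .inCopy S (h.prec_trans _ _ _ hxy hyz)
  · exact .below S _ hyz
  · exact .below S x (h.probe_up _ S.2 _ hxy _ hyz)

theorem nextAdj_acyclic (h : P.IsOrientation prec adj) (x : P.NextV) :
    ¬ Relation.TransGen (NextAdj adj) x x := by
  have hmain (u y) (hy : NextAdj adj (P.mainV u) y) : ∃ v, y = P.mainV v ∧ adj u v := by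
    obtain hy := hy
    cases hy
    exact ⟨_, rfl, ‹_›⟩
  have hcopy (S u y) (hy : NextAdj adj (P.copyV S u) y) : ∃ v, y = P.copyV S v ∧ adj u v := by
    obtain hy := hy
    cases hy
    exact ⟨_, rfl, ‹_›⟩
  rcases x with x | ⟨S, x | Q⟩ <;> intro hx
  · obtain ⟨_, ⟨⟩, hx⟩ := exists_eq_transGen hmain hx
    exact h.adj_acyclic x hx
  · obtain ⟨_, ⟨⟩, hx⟩ := exists_eq_transGen (hcopy S) hx
    exact h.adj_acyclic x hx
  · obtain ⟨y, -, hy⟩ := Relation.TransGen.tail'_iff.1 hx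
    cases hy

theorem next_axiom1 (h : P.IsOrientation prec adj) {x y z : P.NextV} :
    NextPrec prec x y → NextPrec prec x z → y ≠ z → NextPrec prec y z ∨ NextPrec prec z y := by
  rintro (hxy | ⟨S, hxy⟩ | ⟨S, x, hxy⟩) (hxz | ⟨_, hxz⟩ | ⟨_, _, hxz⟩) hyz
  · exact (h.axiom1 _ _ _ hxy hxz (mt (congrArg _) hyz)).imp .inMain .inMain
  · exact (h.axiom1 _ _ _ hxy hxz (mt (congrArg _) hyz)).imp (.inCopy S) (.inCopy S)
  · exact .inl (.below S _ hxz)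
  · exact .inr (.below S _ hxy)
  · exact (h.probe_chain _ S.2 _ hxy _ hxz (mt (congrArg _) hyz)).imp .inMain .inMain

theorem next_axiom2 (h : P.IsOrientation prec adj) {x y z : P.NextV} :
    NextAdj adj x y → NextAdj adj x z → y ≠ z → NextPrec prec y z ∨ NextPrec prec z y := by
  rintro (hxy | ⟨S, hxy⟩ | ⟨S, Q, hxy⟩) (hxz | ⟨_, hxz⟩ | ⟨_, _, hxz⟩) hyz
  · exact (h.axiom2 _ _ _ hxy hxz (mt (congrArg _) hyz)).imp .inMain .inMain
  · exact (h.axiom2 _ _ _ hxy hxz (mt (congrArg _) hyz)).imp (.inCopy S) (.inCopy S)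
  · exact (h.probe_chain _ Q.2 _ hxy _ hxz (mt (congrArg _) hyz)).imp (.inCopy S) (.inCopy S)

theorem next_axiom3 (h : P.IsOrientation prec adj) {x y z : P.NextV} :
    NextAdj adj x y → NextPrec prec x z → NextPrec prec y z := by
  rintro (hxy | ⟨S, hxy⟩ | ⟨S, Q, hxy⟩) (hxz | ⟨_, hxz⟩ | ⟨_, _, hxz⟩)
  · exact .inMain (h.axiom3 _ _ _ hxy hxz)
  · exact .inCopy S (h.axiom3 _ _ _ hxy hxz)
  · exact .below S _ hxz
  · exact .below S _ hxz

theorem next_axiom4 (h : P.IsOrientation prec adj) {x y z : P.NextV} :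
    NextAdj adj x y → NextPrec prec y z → NextAdj adj x z ∨ NextPrec prec x z := by
  rintro (hxy | ⟨S, hxy⟩ | ⟨S, Q, hxy⟩) (hyz | ⟨_, hyz⟩ | ⟨_, _, hyz⟩)
  · exact (h.axiom4 _ _ _ hxy hyz).imp .inMain .inMain
  · exact (h.axiom4 _ _ _ hxy hyz).imp (.inCopy S) (.inCopy S)
  · exact .inr (.below S _ hyz)
  · exact .inl (.attach S Q (h.probe_up _ Q.2 _ hxy _ hyz))
  · exact .inr (.below S _ hyz)

theorem next_graph_eq (h : P.IsOrientation prec adj) :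
    P.next.graph = SimpleGraph.fromRel (NextAdj adj) := by
  have hrel (x y : P.NextV) :
      P.NextRel x y ∨ P.NextRel y x ↔ NextAdj adj x y ∨ NextAdj adj y x := by
    constructor
    · rintro ((hxy | ⟨S, hxy⟩ | ⟨S, Q, hxy⟩) | (hxy | ⟨S, hxy⟩ | ⟨S, Q, hxy⟩))
      · exact (h.adj_iff.1 hxy).imp .inMain .inMain
      · exact (h.adj_iff.1 hxy).imp (.inCopy S) (.inCopy S)
      · exact .inl (.attach S Q hxy)
      · exact (h.adj_iff.1 hxy).symm.imp .inMain .inMain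
      · exact (h.adj_iff.1 hxy).symm.imp (.inCopy S) (.inCopy S)
      · exact .inr (.attach S Q hxy)
    · refine Or.imp ?_ ?_ <;> rintro (hxy | ⟨S, hxy⟩ | ⟨S, Q, hxy⟩)
      exacts [.inMain (h.adj_iff.2 (.inl hxy)), .inCopy S (h.adj_iff.2 (.inl hxy)),
        .attach S Q hxy, .inMain (h.adj_iff.2 (.inl hxy)), .inCopy S (h.adj_iff.2 (.inl hxy)),
        .attach S Q hxy]
  ext x y
  exact and_congr_right fun _ => hrel x y

theorem next_probe_chain (h : P.IsOrientation prec adj) (S : Set P.NextV) (hS : S ∈ P.next.probes)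
    (x : P.NextV) (hx : x ∈ S) (y : P.NextV) (hy : y ∈ S) (hxy : x ≠ y) :
    NextPrec prec x y ∨ NextPrec prec y x := by
  obtain ⟨S, Q, rfl | rfl⟩ := hS
  · obtain ⟨x, hx, rfl⟩ | ⟨x, hx, rfl⟩ := hx <;> obtain ⟨y, hy, rfl⟩ | ⟨y, hy, rfl⟩ := hy
    · exact (h.probe_chain _ S.2 _ hx _ hy (mt (congrArg _) hxy)).imp .inMain .inMain
    · exact .inr (.below S _ hx)
    · exact .inl (.below S _ hy)
    · exact (h.probe_chain _ Q.2 _ hx _ hy (mt (congrArg _) hxy)).imp (.inCopy S) (.inCopy S)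
  · obtain ⟨x, hx, rfl⟩ | rfl := hx <;> obtain ⟨y, hy, rfl⟩ | rfl := hy
    · exact (h.probe_chain _ S.2 _ hx _ hy (mt (congrArg _) hxy)).imp .inMain .inMain
    · exact .inr (.below S _ hx)
    · exact .inl (.below S _ hy)
    · exact absurd rfl hxy

theorem next_probe_up (h : P.IsOrientation prec adj) (S : Set P.NextV) (hS : S ∈ P.next.probes)
    (x : P.NextV) (hx : x ∈ S) (y : P.NextV) (hxy : NextPrec prec x y) : y ∈ S := by
  obtain ⟨S, Q, rfl | rfl⟩ := hS
  · obtain ⟨x, hx, rfl⟩ | ⟨x, hx, rfl⟩ := hx <;> obtain hxy | ⟨_, hxy⟩ | ⟨_, _, hxy⟩ := hxy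
    · exact .inl ⟨_, h.probe_up _ S.2 _ hx _ hxy, rfl⟩
    · exact .inr ⟨_, h.probe_up _ Q.2 _ hx _ hxy, rfl⟩
    · exact .inl ⟨_, hxy, rfl⟩
  · obtain ⟨x, hx, rfl⟩ | rfl := hx <;> obtain hxy | ⟨_, hxy⟩ | ⟨_, _, hxy⟩ := hxy
    · exact .inl ⟨_, h.probe_up _ S.2 _ hx _ hxy, rfl⟩
    · exact .inl ⟨_, hxy, rfl⟩

theorem next (h : P.IsOrientation prec adj) :
    P.next.IsOrientation (NextPrec prec) (NextAdj adj) where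
  finite := have := h.finite; inferInstanceAs (Finite P.NextV)
  nonempty := h.nonempty.map P.mainV
  prec_irrefl := h.nextPrec_irrefl
  prec_trans _ _ _ := h.nextPrec_trans
  adj_acyclic := h.nextAdj_acyclic
  axiom1 _ _ _ := h.next_axiom1
  axiom2 _ _ _ := h.next_axiom2
  axiom3 _ _ _ := h.next_axiom3
  axiom4 _ _ _ := h.next_axiom4
  graph_eq := h.next_graph_eq
  probe_chain := h.next_probe_chain
  probe_up := h.next_probe_up

end IsOrientation

theorem exists_isOrientation_burlingSeq (k : ℕ) :
    ∃ prec adj, (burlingSeq k).IsOrientation prec adj := by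
  induction k with
  | zero =>
    have hacyclic (x : Unit) : ¬ Relation.TransGen (fun _ _ : Unit => False) x x := fun h => by
      obtain ⟨_, _, ⟨⟩⟩ := Relation.TransGen.tail'_iff.1 h
    have hset : IsBurlingSet (fun _ _ : Unit => False) fun _ _ => False := by
      constructor <;> first | infer_instance | simp [hacyclic]
    have hgraph : ⊥ = SimpleGraph.fromRel fun _ _ : Unit => False := by ext; simp
    exact ⟨_, _, hset, hgraph, by simp [burlingSeq], by simp [burlingSeq]⟩
  | succ k ih =>
    obtain ⟨prec, adj, h⟩ := ih
    exact ⟨_, _, h.next⟩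

end ProbedGraph

theorem IsBurlingSet.comap {V W : Type*} [Finite V] [Nonempty V] {prec adj : W → W → Prop}
    (h : IsBurlingSet prec adj) {f : V → W} (hf : Function.Injective f) :
    IsBurlingSet (prec.onFun f) (adj.onFun f) where
  finite := ‹_›
  nonempty := ‹_›
  prec_irrefl _ := h.prec_irrefl _
  prec_trans _ _ _ := h.prec_trans _ _ _
  adj_acyclic x hx := h.adj_acyclic (f x) (hx.lift f fun _ _ => id)
  axiom1 _ _ _ hxy hxz hyz := h.axiom1 _ _ _ hxy hxz (hf.ne hyz)
  axiom2 _ _ _ hxy hxz hyz := h.axiom2 _ _ _ hxy hxz (hf.ne hyz)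
  axiom3 _ _ _ := h.axiom3 _ _ _
  axiom4 _ _ _ := h.axiom4 _ _ _

theorem IsBurlingGraph.exists_isBurlingSet {V : Type*} [Finite V] [Nonempty V] {G : SimpleGraph V}
    (hG : IsBurlingGraph G) :
    ∃ prec adj : V → V → Prop, IsBurlingSet prec adj ∧ G = SimpleGraph.fromRel adj := by
  obtain ⟨k, ⟨f⟩⟩ := hG
  obtain ⟨prec, adj, h⟩ := ProbedGraph.exists_isOrientation_burlingSeq k
  have hcomap := h.comap f.injective
  refine ⟨_, _, hcomap, ?_⟩
  ext u v
  rw [← f.map_adj_iff, h.adj_iff, hcomap.fromRel_adj]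

section Embedding

variable {U V W : Type*} {A B : Set U} {G : SimpleGraph U} {H : SimpleGraph V} {f g : U → V}

/-- `f` restricts to an isomorphism between the subgraph of `G` induced by `A` and an induced
subgraph of `H`. -/
def EmbedsOn (G : SimpleGraph U) (H : SimpleGraph V) (A : Set U) (f : U → V) : Prop :=
  Set.InjOn f A ∧ ∀ a ∈ A, ∀ b ∈ A, H.Adj (f a) (f b) ↔ G.Adj a b

theorem EmbedsOn.congr (hf : EmbedsOn G H A f) (hfg : Set.EqOn f g A) : EmbedsOn G H A g :=
  ⟨hf.1.congr hfg, fun a ha b hb => by rw [← hfg ha, ← hfg hb, hf.2 a ha b hb]⟩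

theorem EmbedsOn.comp {K : SimpleGraph W} (φ : H ↪g K) (hf : EmbedsOn G H A f) :
    EmbedsOn G K A (φ ∘ f) :=
  ⟨φ.injective.comp_injOn hf.1, fun a ha b hb => φ.map_adj_iff.trans (hf.2 a ha b hb)⟩

theorem EmbedsOn.union (hA : EmbedsOn G H A f) (hB : EmbedsOn G H B f)
    (hAB : ∀ a ∈ A, ∀ b ∈ B, f a ≠ f b ∧ (H.Adj (f a) (f b) ↔ G.Adj a b)) :
    EmbedsOn G H (A ∪ B) f := by
  refine ⟨?_, ?_⟩
  · rintro a (ha | ha) b (hb | hb) hab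
    exacts [hA.1 ha hb hab, absurd hab (hAB a ha b hb).1, absurd hab.symm (hAB b hb a ha).1,
      hB.1 ha hb hab]
  · rintro a (ha | ha) b (hb | hb)
    · exact hA.2 a ha b hb
    · exact (hAB a ha b hb).2
    · rw [H.adj_comm, G.adj_comm]
      exact (hAB b hb a ha).2
    · exact hB.2 a ha b hb

end Embedding

namespace ProbedGraph

variable {P : ProbedGraph} {S Q : P.probes} {u v : P.V}

theorem next_adj_mainV : P.next.graph.Adj (P.mainV u) (P.mainV v) ↔ P.graph.Adj u v := by
  constructor
  · rintro ⟨-, h | h⟩ <;> obtain h := h <;> cases h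
    exacts [‹_›, ‹P.graph.Adj v u›.symm]
  · exact fun h => ⟨Sum.inl_injective.ne h.ne, .inl (.inMain h)⟩

theorem next_adj_copyV : P.next.graph.Adj (P.copyV S u) (P.copyV S v) ↔ P.graph.Adj u v := by
  constructor
  · rintro ⟨-, h | h⟩ <;> obtain h := h <;> cases h
    exacts [‹_›, ‹P.graph.Adj v u›.symm]
  · refine fun h => ⟨fun huv => ?_, .inl (.inCopy S h)⟩
    obtain ⟨⟩ := huv
    exact h.ne rfl

theorem next_adj_newV_copyV : P.next.graph.Adj (P.newV S Q) (P.copyV S u) ↔ u ∈ Q.1 := by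
  constructor
  · rintro ⟨-, h | h⟩ <;> obtain h := h <;> cases h
    assumption
  · exact fun h => ⟨nofun, .inl (.attach S Q h)⟩

theorem not_next_adj_copyV_mainV : ¬ P.next.graph.Adj (P.copyV S u) (P.mainV v) := by
  rintro ⟨-, h | h⟩ <;> obtain h := h <;> cases h

variable (P) in
/-- The embedding of `P` as the main copy. -/
def mainEmbedding : P.graph ↪g P.next.graph where
  toFun := P.mainV
  inj' := Sum.inl_injective
  map_rel_iff' := next_adj_mainV

/-- The embedding of `P` as the copy that belongs to `S`. -/
def copyEmbedding (S : P.probes) : P.graph ↪g P.next.graph where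
  toFun := P.copyV S
  inj' := fun _ _ h => by cases h; rfl
  map_rel_iff' := next_adj_copyV

end ProbedGraph

namespace ProbedGraph

variable {P : ProbedGraph} (S Q : P.probes) {u : P.V}

/-- The distinguished set `S ∪ Q` of the next graph. -/
def copyProbe : Set P.NextV := P.mainV '' S.1 ∪ P.copyV S '' Q.1

/-- The distinguished set `S ∪ {v_{S,Q}}` of the next graph. -/
def newProbe : Set P.NextV := P.mainV '' S.1 ∪ {P.newV S Q}

variable {S Q}

theorem copyProbe_mem : copyProbe S Q ∈ P.next.probes := ⟨S, Q, .inl rfl⟩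

theorem newProbe_mem : newProbe S Q ∈ P.next.probes := ⟨S, Q, .inr rfl⟩

theorem mainV_mem_copyProbe : P.mainV u ∈ copyProbe S Q ↔ u ∈ S.1 := by simp [copyProbe]

theorem copyV_mem_copyProbe : P.copyV S u ∈ copyProbe S Q ↔ u ∈ Q.1 := by simp [copyProbe]

theorem newV_notMem_copyProbe {Q' : P.probes} : P.newV S Q' ∉ copyProbe S Q := by simp [copyProbe]

theorem mainV_mem_newProbe : P.mainV u ∈ newProbe S Q ↔ u ∈ S.1 := by simp [newProbe]

theorem copyV_notMem_newProbe {S' : P.probes} : P.copyV S' u ∉ newProbe S Q := by simp [newProbe]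

theorem newV_mem_newProbe : P.newV S Q ∈ newProbe S Q := by simp [newProbe]

end ProbedGraph

open ProbedGraph

theorem burlingSeq_probes_nonempty (k : ℕ) : (burlingSeq k).probes.Nonempty := by
  induction k with
  | zero => exact ⟨Set.univ, rfl⟩
  | succ k ih =>
    obtain ⟨S, hS⟩ := ih
    exact ⟨_, ⟨S, hS⟩, ⟨S, hS⟩, .inl rfl⟩

section ProbedEmbedding

variable {V : Type*} {prec adj : V → V → Prop} {A B X : Set V}

/-- `X` is a chain in `A` that contains every element of `A` above one of its elements. -/
structure IsUpChain (prec : V → V → Prop) (A X : Set V) : Prop where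
  subset : X ⊆ A
  chain : IsChain prec X
  up : ∀ a ∈ X, ∀ b ∈ A, prec a b → b ∈ X

theorem IsUpChain.inter (hX : IsUpChain prec A X) (hBA : B ⊆ A) : IsUpChain prec B (X ∩ B) where
  subset := Set.inter_subset_right
  chain := hX.chain.mono Set.inter_subset_left
  up a ha b hb hab := ⟨hX.up a ha.1 b (hBA hb) hab, hb⟩

/-- `f` represents the part `A` of a Burling set in `P`: it embeds the graph on `A`, and the
upward closed chains of `A` are traces of distinguished sets. -/
structure ProbedEmbedding (prec adj : V → V → Prop) (A : Set V) (P : ProbedGraph)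
    (f : V → P.V) : Prop where
  embedsOn : EmbedsOn (SimpleGraph.fromRel adj) P.graph A f
  probe : ∀ X, IsUpChain prec A X → ∃ T ∈ P.probes, ∀ a ∈ A, f a ∈ T ↔ a ∈ X

namespace ProbedEmbedding

variable {P : ProbedGraph} {f g : V → P.V} {x : V}

theorem next (hf : ProbedEmbedding prec adj A P f) :
    ProbedEmbedding prec adj A P.next (P.mainV ∘ f) where
  embedsOn := hf.embedsOn.comp P.mainEmbedding
  probe X hX := by
    obtain ⟨T, hT, hTX⟩ := hf.probe X hX
    lift T to P.probes using hT
    exact ⟨_, newProbe_mem (Q := T), fun a ha => mainV_mem_newProbe.trans (hTX a ha)⟩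

theorem exists_of_le {k m : ℕ} (hkm : k ≤ m)
    (h : ∃ f, ProbedEmbedding prec adj A (burlingSeq k) f) :
    ∃ f, ProbedEmbedding prec adj A (burlingSeq m) f := by
  induction m, hkm using Nat.le_induction with
  | base => exact h
  | succ m _ ih =>
    obtain ⟨f, hf⟩ := ih
    exact ⟨_, hf.next⟩

section insert

open Classical in
/-- Extends an embedding `f` into `P` to `x`, which becomes the new vertex attached to the set `Q`
of the copy of `P` that belongs to `S`. -/
noncomputable def attach (f : V → P.V) (x : V) (S Q : P.probes) : V → P.NextV :=
  Function.update (P.copyV S ∘ f) x (P.newV S Q)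

variable {S Q : P.probes}

theorem attach_self : attach f x S Q x = P.newV S Q := by simp [attach]

theorem attach_of_mem {a : V} (hx : x ∉ A) (ha : a ∈ A) : attach f x S Q a = P.copyV S (f a) := by
  simp [attach, ne_of_mem_of_not_mem ha hx]

theorem embedsOn_attach (hs : IsBurlingSet prec adj)
    (hf : EmbedsOn (SimpleGraph.fromRel adj) P.graph A f) (hx : x ∉ A)
    (hsource : ∀ a ∈ A, ¬ adj a x) (hQ : ∀ a ∈ A, f a ∈ Q.1 ↔ adj x a) :
    EmbedsOn (SimpleGraph.fromRel adj) P.next.graph (insert x A) (attach f x S Q) := by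
  have hA : EmbedsOn (SimpleGraph.fromRel adj) P.next.graph A (attach f x S Q) :=
    (hf.comp (ProbedGraph.copyEmbedding S)).congr fun a ha => (attach_of_mem hx ha).symm
  have hx' : EmbedsOn (SimpleGraph.fromRel adj) P.next.graph {x} (attach f x S Q) :=
    by
    refine ⟨Set.injOn_singleton _ _, ?_⟩
    rintro a rfl b rfl
    exact iff_of_false (SimpleGraph.irrefl _) (SimpleGraph.irrefl _)
  refine hx'.union hA ?_
  rintro x rfl a ha
  rw [attach_self, attach_of_mem hx ha, ProbedGraph.next_adj_newV_copyV, hQ a ha, hs.fromRel_adj,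
    or_iff_left (hsource a ha)]
  exact ⟨nofun, Iff.rfl⟩

theorem exists_insert (hs : IsBurlingSet prec adj) (hP : P.probes.Nonempty)
    (hf : ProbedEmbedding prec adj A P f) (hx : x ∉ A) (hmax : ∀ a ∈ A, ¬ prec x a)
    (hmin : ∀ a ∈ A, ¬ prec a x) (hsource : ∀ a ∈ A, ¬ adj a x) :
    ∃ F, ProbedEmbedding prec adj (insert x A) P.next F := by
  have hadj : IsUpChain prec A {a ∈ A | adj x a} :=
    { subset := fun a ha => ha.1
      chain := fun a ha b hb => hs.axiom2 x a b ha.2 hb.2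
      up := fun a ha b hb hab =>
        ⟨hb, (hs.axiom4 x a b ha.2 hab).resolve_right (hmax b hb)⟩ }
  obtain ⟨S, hS⟩ := hP
  obtain ⟨Q, hQ, hQadj⟩ := hf.probe _ hadj
  lift S to P.probes using hS
  lift Q to P.probes using hQ
  refine ⟨attach f x S Q, embedsOn_attach hs hf.embedsOn hx hsource fun a ha =>
    (hQadj a ha).trans (and_iff_right ha), fun X hX => ?_⟩
  by_cases hxX : x ∈ X
  · refine ⟨newProbe S Q, newProbe_mem, ?_⟩
    rintro a (rfl | ha)
    · rw [attach_self]
      exact iff_of_true newV_mem_newProbe hxX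
    · have haX : a ∉ X := fun haX =>
        (hX.chain haX hxX (ne_of_mem_of_not_mem ha hx)).elim (hmin a ha) (hmax a ha)
      rw [attach_of_mem hx ha]
      exact iff_of_false copyV_notMem_newProbe haX
  · obtain ⟨T, hT, hTX⟩ := hf.probe _ (hX.inter (Set.subset_insert x A))
    lift T to P.probes using hT
    refine ⟨copyProbe S T, copyProbe_mem, ?_⟩
    rintro a (rfl | ha)
    · rw [attach_self]
      exact iff_of_false newV_notMem_copyProbe hxX
    · rw [attach_of_mem hx ha]
      exact copyV_mem_copyProbe.trans ((hTX a ha).trans (and_iff_left ha))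

end insert

section below

open Classical in
/-- Combines embeddings into `P`: the elements below `x` are embedded by `g` into the copy of `P`
that belongs to `S`, all others by `f` into the main copy. -/
noncomputable def hang (prec : V → V → Prop) (f g : V → P.V) (x : V) (S : P.probes) (a : V) :
    P.NextV :=
  if prec a x then P.copyV S (g a) else P.mainV (f a)

variable {S : P.probes} {a : V}

theorem hang_of_prec (ha : prec a x) : hang prec f g x S a = P.copyV S (g a) := if_pos ha

theorem hang_of_not_prec (ha : ¬ prec a x) : hang prec f g x S a = P.mainV (f a) := if_neg ha

theorem embedsOn_hang (hs : IsBurlingSet prec adj) (hsource : ∀ a ∈ A, ¬ adj a x)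
    (hf : EmbedsOn (SimpleGraph.fromRel adj) P.graph {a ∈ A | ¬ prec a x} f)
    (hg : EmbedsOn (SimpleGraph.fromRel adj) P.graph {a ∈ A | prec a x} g) :
    EmbedsOn (SimpleGraph.fromRel adj) P.next.graph A (hang prec f g x S) := by
  have hmain := (hf.comp P.mainEmbedding).congr (g := hang prec f g x S)
    fun a ha => (hang_of_not_prec ha.2).symm
  have hcopy := (hg.comp (ProbedGraph.copyEmbedding S)).congr (g := hang prec f g x S)
    fun a ha => (hang_of_prec ha.2).symm
  have hA : {a ∈ A | prec a x} ∪ {a ∈ A | ¬ prec a x} = A := by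
    ext a
    by_cases prec a x <;> simp_all
  rw [← hA]
  refine hcopy.union hmain ?_
  rintro a ⟨-, hax⟩ b ⟨hb, hbx⟩
  have hab : ¬ adj a b := fun hab => hbx (hs.axiom3 a b x hab hax)
  have hba : ¬ adj b a := fun hba => (hs.axiom4 b a x hba hax).elim (hsource b hb) hbx
  rw [hang_of_prec hax, hang_of_not_prec hbx, hs.fromRel_adj]
  exact ⟨nofun, iff_of_false ProbedGraph.not_next_adj_copyV_mainV (by tauto)⟩

theorem exists_hang (hs : IsBurlingSet prec adj) (hx : x ∈ A) (hmax : ∀ a ∈ A, ¬ prec x a)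
    (hsource : ∀ a ∈ A, ¬ adj a x)
    (hf : ProbedEmbedding prec adj {a ∈ A | ¬ prec a x} P f)
    (hg : ProbedEmbedding prec adj {a ∈ A | prec a x} P g) :
    ∃ F, ProbedEmbedding prec adj A P.next F := by
  have hsingle : IsUpChain prec {a ∈ A | ¬ prec a x} {x} :=
    { subset := by simpa using ⟨hx, hs.prec_irrefl x⟩
      chain := Set.subsingleton_singleton.isChain
      up := by
        rintro _ rfl b hb hxb
        exact absurd hxb (hmax b hb.1) }
  obtain ⟨S, hS, hSx⟩ := hf.probe _ hsingle
  lift S to P.probes using hS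
  refine ⟨hang prec f g x S, embedsOn_hang hs hsource hf.embedsOn hg.embedsOn, fun X hX => ?_⟩
  by_cases hxX : x ∈ X
  · obtain ⟨T, hT, hTX⟩ := hg.probe _ (hX.inter (Set.sep_subset A _))
    lift T to P.probes using hT
    refine ⟨copyProbe S T, copyProbe_mem, fun a ha => ?_⟩
    by_cases hax : prec a x
    · rw [hang_of_prec hax]
      exact copyV_mem_copyProbe.trans ((hTX a ⟨ha, hax⟩).trans (and_iff_left ⟨ha, hax⟩))
    · have haX : a = x ↔ a ∈ X := by
        refine ⟨fun h => h ▸ hxX, fun haX => by_contra fun hne => ?_⟩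
        exact (hX.chain haX hxX hne).elim hax (hmax a ha)
      rw [hang_of_not_prec hax]
      exact mainV_mem_copyProbe.trans ((hSx a ⟨ha, hax⟩).trans haX)
  · obtain ⟨T, hT, hTX⟩ := hf.probe _ (hX.inter (Set.sep_subset A _))
    lift T to P.probes using hT
    refine ⟨newProbe T T, newProbe_mem, fun a ha => ?_⟩
    by_cases hax : prec a x
    · rw [hang_of_prec hax]
      exact iff_of_false copyV_notMem_newProbe fun haX => hxX (hX.up a haX x hx hax)
    · rw [hang_of_not_prec hax]
      exact mainV_mem_newProbe.trans ((hTX a ⟨ha, hax⟩).trans (and_iff_left ⟨ha, hax⟩))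

end below

end ProbedEmbedding

namespace IsBurlingSet

theorem exists_maximal_source (hs : IsBurlingSet prec adj) (hA : A.Nonempty) :
    ∃ x ∈ A, (∀ a ∈ A, ¬ prec x a) ∧ ∀ a ∈ A, ¬ adj a x := by
  have := hs.finite
  have hprec : WellFounded (flip prec) := by
    have : IsTrans V (flip prec) := ⟨fun _ _ _ hab hbc => hs.prec_trans _ _ _ hbc hab⟩
    have : Std.Irrefl (flip prec) := ⟨hs.prec_irrefl⟩
    exact Finite.wellFounded_of_trans_of_irrefl _
  have hadj : WellFounded (Relation.TransGen adj) := by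
    have : Std.Irrefl (Relation.TransGen adj) := ⟨hs.adj_acyclic⟩
    exact Finite.wellFounded_of_trans_of_irrefl _
  have hmaximal : {a ∈ A | ∀ b ∈ A, ¬ prec a b}.Nonempty :=
    (hprec.has_min A hA).imp fun _ => id
  obtain ⟨x, hx, hsource⟩ := hadj.has_min _ hmaximal
  refine ⟨x, hx.1, hx.2, fun a ha hax => hsource a ⟨ha, fun b hb hab => ?_⟩ (.single hax)⟩
  exact hx.2 b hb (hs.axiom3 _ _ _ hax hab)

theorem exists_probedEmbedding (hs : IsBurlingSet prec adj) (A : Set V) :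
    ∃ k f, ProbedEmbedding prec adj A (burlingSeq k) f := by
  have := hs.finite
  induction A using WellFoundedLT.induction with | ind A ih
  obtain rfl | hA := A.eq_empty_or_nonempty
  · exact ⟨0, fun _ => (), ⟨Set.injOn_empty _, nofun⟩, fun X _ => ⟨_, rfl, nofun⟩⟩
  obtain ⟨x, hx, hmax, hsource⟩ := hs.exists_maximal_source hA
  have hss {B : Set V} (hB : B ⊆ A \ {x}) : B < A :=
    hB.trans_ssubset (Set.sdiff_singleton_ssubset.2 hx)
  obtain ⟨k, hf⟩ := ih {a ∈ A \ {x} | ¬ prec a x} (hss (Set.sep_subset _ _))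
  obtain ⟨l, hg⟩ := ih {a ∈ A | prec a x} (hss fun a ha => ⟨ha.1, by
    rintro rfl
    exact hs.prec_irrefl _ ha.2⟩)
  obtain ⟨f, hf⟩ := ProbedEmbedding.exists_of_le (le_max_left k l) hf
  obtain ⟨g, hg⟩ := ProbedEmbedding.exists_of_le (le_add_right (le_max_right k l) (c := 1)) hg
  obtain ⟨F, hF⟩ := hf.exists_insert hs (burlingSeq_probes_nonempty _) (x := x) (by simp)
    (fun a ha => hmax a ha.1.1) (fun a ha => ha.2) (fun a ha => hsource a ha.1.1)
  have hinsert : insert x {a ∈ A \ {x} | ¬ prec a x} = {a ∈ A | ¬ prec a x} := by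
    have := hs.prec_irrefl x
    ext a
    by_cases a = x <;> simp_all
  rw [hinsert] at hF
  exact ⟨max k l + 2, ProbedEmbedding.exists_hang hs hx hmax hsource hF hg⟩

theorem isBurlingGraph (hs : IsBurlingSet prec adj) :
    IsBurlingGraph (SimpleGraph.fromRel adj) := by
  obtain ⟨k, f, ⟨hinj, hadj⟩, -⟩ := hs.exists_probedEmbedding Set.univ
  exact ⟨k, ⟨⟨f, Set.injOn_univ.1 hinj⟩, hadj _ trivial _ trivial⟩⟩

end IsBurlingSet

end ProbedEmbedding

/-! ### Representations of parts of a graph -/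

namespace Recognition

section Components

variable {V : Type*} {G : SimpleGraph V} {B : Set V} {u v w : V}

/-- The vertices `u` and `v` lie in the same component of `G - B`. -/
def Linked (G : SimpleGraph V) (B : Set V) (u v : V) : Prop :=
  u ∉ B ∧ Relation.ReflTransGen (fun a b => G.Adj a b ∧ b ∉ B) u v

/-- The vertex set of the component of `u` in `G - B`; it is empty if `u ∈ B`. -/
def component (G : SimpleGraph V) (B : Set V) (u : V) : Set V := {v | Linked G B u v}

namespace Linked

theorem refl (h : u ∉ B) : Linked G B u u := ⟨h, .refl⟩

theorem left (h : Linked G B u v) : u ∉ B := h.1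

theorem right (h : Linked G B u v) : v ∉ B := by
  obtain ⟨hu, huv⟩ := h
  cases huv with
  | refl => exact hu
  | tail _ hav => exact hav.2

theorem trans (h : Linked G B u v) (h' : Linked G B v w) : Linked G B u w :=
  ⟨h.1, h.2.trans h'.2⟩

theorem of_adj (h : G.Adj u v) (hu : u ∉ B) (hv : v ∉ B) : Linked G B u v :=
  ⟨hu, .single ⟨h, hv⟩⟩

theorem tail (h : Linked G B u v) (h' : G.Adj v w) (hw : w ∉ B) : Linked G B u w :=
  h.trans (of_adj h' h.right hw)

theorem symm (h : Linked G B u v) : Linked G B v u := by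
  obtain ⟨hu, h⟩ := h
  induction h with
  | refl => exact refl hu
  | tail _ hab ih => exact (of_adj hab.1.symm hab.2 ih.left).trans ih

theorem induction_on {p : V → Prop} (h : Linked G B u v) (hu : p u)
    (hadj : ∀ a b, Linked G B u a → Linked G B u b → p a → G.Adj a b → p b) : p v := by
  obtain ⟨huB, h⟩ := h
  induction h with
  | refl => exact hu
  | tail hua hab ih => exact hadj _ _ ⟨huB, hua⟩ ⟨huB, hua.tail hab⟩ ih hab.1

theorem component_eq (h : Linked G B u v) : component G B u = component G B v :=
  Set.ext fun _ => ⟨fun h' => h.symm.trans h', fun h' => h.trans h'⟩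

end Linked

end Components

/-- The restriction of a relation to a set. -/
def restrict {V : Type*} (K : Set V) (p : V → V → Prop) (x y : V) : Prop :=
  x ∈ K ∧ y ∈ K ∧ p x y

/-- The relations `prec` and `adj` form a Burling set on `C` with graph `G[C]`, and for every
vertex outside `C` its neighbourhood in `C` is a chain that is closed upwards. The two conditions
on outside vertices are what is needed to glue representations of the parts of a graph. -/
structure IsRepOn {V : Type*} (G : SimpleGraph V) (C : Set V) (prec adj : V → V → Prop) :
    Prop where
  prec_mem : ∀ {x y}, prec x y → x ∈ C ∧ y ∈ C
  adj_mem : ∀ {x y}, adj x y → x ∈ C ∧ y ∈ C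
  irrefl : ∀ x, ¬ prec x x
  trans : ∀ {x y z}, prec x y → prec y z → prec x z
  wf : WellFounded fun y x => adj x y
  ax1 : ∀ {x y z}, prec x y → prec x z → y ≠ z → prec y z ∨ prec z y
  ax2 : ∀ {x y z}, adj x y → adj x z → y ≠ z → prec y z ∨ prec z y
  ax3 : ∀ {x y z}, adj x y → prec x z → prec y z
  ax4 : ∀ {x y z}, adj x y → prec y z → adj x z ∨ prec x z
  adj_iff : ∀ {x y}, x ∈ C → y ∈ C → (G.Adj x y ↔ adj x y ∨ adj y x)
  outer_chain : ∀ {w x y}, w ∉ C → x ∈ C → y ∈ C → G.Adj w x → G.Adj w y → x ≠ y →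
    prec x y ∨ prec y x
  outer_up : ∀ {w x y}, w ∉ C → G.Adj w x → prec x y → G.Adj w y

/-! ### Nesting the components of a subgraph -/

section Nest

variable {V : Type*} {G : SimpleGraph V}

variable (G) in
/-- A contact of the component of `u` in `G - B`: a vertex of `B` with a neighbour in that
component. -/
def IsContact (B : Set V) (u w : V) : Prop := w ∈ B ∧ ∃ k, Linked G B u k ∧ G.Adj w k

variable (G) in
/-- All contacts of the component of `u` have the same neighbours in the component of `v`. -/
def IsUniform (B : Set V) (u v : V) : Prop :=
  ∀ w w' k, IsContact G B u w → IsContact G B u w' → Linked G B v k → G.Adj w k → G.Adj w' k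

variable (G) in
/-- The smallest vertex of the component of `u` is smaller than the component of `v`. This breaks
the tie between components that could be nested either way. -/
def MinLT [LT V] (B : Set V) (u v : V) : Prop :=
  ∃ m, Linked G B u m ∧ ∀ m', Linked G B v m' → m < m'

variable (G) in
/-- When the components of `G - B` are nested, the component of `u` is put below the vertex `v`
of another component. -/
def Below [LT V] (B : Set V) (u v : V) : Prop :=
  IsUniform G B u v ∧ (¬ IsUniform G B v u ∨ MinLT G B u v) ∧ (∃ w, IsContact G B u w) ∧
    ∀ w, IsContact G B u w → G.Adj w v

/-- The order on a union of components of `G - B` that is obtained from orders of the components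
by nesting. -/
def nestPrec [LT V] (G : SimpleGraph V) (B : Set V) (p : V → V → Prop) (u v : V) : Prop :=
  Linked G B u v ∧ p u v ∨ Below G B u v

/-- The orientation on a union of components of `G - B` that is obtained from orientations of the
components. -/
def nestAdj (G : SimpleGraph V) (B : Set V) (a : V → V → Prop) (u v : V) : Prop :=
  Linked G B u v ∧ a u v

/-- The hypotheses for nesting: `H` is a union of components of `G - B`, each of them represented
by `p` and `a`, and of any two of them one is uniform with respect to the other. -/
structure Nestable (G : SimpleGraph V) (B H : Set V) (p a : V → V → Prop) : Prop where
  disjoint : ∀ {u}, u ∈ H → u ∉ B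
  closed : ∀ {u v}, u ∈ H → Linked G B u v → v ∈ H
  isRepOn : ∀ {u}, u ∈ H →
    IsRepOn G (component G B u) (restrict (component G B u) p) (restrict (component G B u) a)
  uniform : ∀ {u v}, u ∈ H → v ∈ H → ¬ Linked G B u v → IsUniform G B u v ∨ IsUniform G B v u

variable {B : Set V} {u v u' v' w : V}

theorem IsContact.congr (h : Linked G B u u') (hw : IsContact G B u w) : IsContact G B u' w :=
  ⟨hw.1, hw.2.imp fun _ hk => ⟨h.symm.trans hk.1, hk.2⟩⟩

theorem IsUniform.congr (hu : Linked G B u u') (hv : Linked G B v v') (h : IsUniform G B u v) :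
    IsUniform G B u' v' :=
  fun w w' k hw hw' hk => h w w' k (hw.congr hu.symm) (hw'.congr hu.symm) (hv.trans hk)

theorem MinLT.congr [LT V] (hu : Linked G B u u') (hv : Linked G B v v') (h : MinLT G B u v) :
    MinLT G B u' v' := by
  obtain ⟨m, hum, hm⟩ := h
  exact ⟨m, hu.symm.trans hum, fun m' hm' => hm m' (hv.trans hm')⟩

theorem MinLT.trans [Preorder V] {q : V} (h : MinLT G B u v) (h' : MinLT G B v q) :
    MinLT G B u q := by
  obtain ⟨m, hum, hm⟩ := h
  obtain ⟨m', hvm, hm'⟩ := h'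
  exact ⟨m, hum, fun k hk => (hm m' hvm).trans (hm' k hk)⟩

theorem MinLT.asymm [Preorder V] (h : MinLT G B u v) (h' : MinLT G B v u) : False := by
  obtain ⟨m, hum, hm⟩ := h
  obtain ⟨m', hvm, hm'⟩ := h'
  exact lt_asymm (hm m' hvm) (hm' m hum)

theorem exists_least_linked [LinearOrder V] [Finite V] (hu : u ∉ B) :
    ∃ m, Linked G B u m ∧ ∀ m', Linked G B u m' → m ≤ m' :=
  Set.exists_min_image (component G B u) id (Set.toFinite _) ⟨u, .refl hu⟩

theorem minLT_total [LinearOrder V] [Finite V] (hu : u ∉ B) (hv : v ∉ B)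
    (huv : ¬ Linked G B u v) : MinLT G B u v ∨ MinLT G B v u := by
  obtain ⟨m, hum, hm⟩ := exists_least_linked (G := G) hu
  obtain ⟨m', hvm, hm'⟩ := exists_least_linked (G := G) hv
  rcases lt_trichotomy m m' with h | h | h
  · exact Or.inl ⟨m, hum, fun k hk => h.trans_le (hm' k hk)⟩
  · exact absurd (hum.trans (h ▸ hvm.symm)) huv
  · exact Or.inr ⟨m', hvm, fun k hk => h.trans_le (hm k hk)⟩

theorem Below.congr_left [LT V] (h : Linked G B u u') (hv : v ∉ B) (hb : Below G B u v) :
    Below G B u' v := by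
  obtain ⟨huv, htie, ⟨w, hw⟩, hup⟩ := hb
  exact ⟨huv.congr h (.refl hv), htie.imp (mt fun hvu => hvu.congr (.refl hv) h.symm)
    (fun hlt => hlt.congr h (.refl hv)), ⟨w, hw.congr h⟩, fun w hw => hup w (hw.congr h.symm)⟩

theorem Below.congr_right [LT V] (hu : u ∉ B) (h : Linked G B v v')
    (hadj : ∀ w ∈ B, G.Adj w v → G.Adj w v') (hb : Below G B u v) : Below G B u v' := by
  obtain ⟨huv, htie, hex, hup⟩ := hb
  exact ⟨huv.congr (.refl hu) h, htie.imp (mt fun hvu => hvu.congr h.symm (.refl hu))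
    (fun hlt => hlt.congr (.refl hu) h), hex, fun w hw => hadj w hw.1 (hup w hw)⟩

theorem Below.not_linked [Preorder V] (h : Below G B u v) : ¬ Linked G B u v := fun huv =>
  have hlt := h.2.1.resolve_left (not_not.2 (h.1.congr huv huv.symm))
  hlt.asymm (hlt.congr huv huv.symm)

theorem Below.isContact [LT V] (h : Below G B u v) (hv : v ∉ B) (hw : IsContact G B u w) :
    IsContact G B v w :=
  ⟨hw.1, v, .refl hv, h.2.2.2 w hw⟩

theorem Below.trans [Preorder V] {q : V} (hv : v ∉ B) (hq : q ∉ B) (h : Below G B u v)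
    (h' : Below G B v q) : Below G B u q := by
  have huv : ∀ w, IsContact G B u w → IsContact G B v w := fun w => h.isContact hv
  have hvq : ∀ w, IsContact G B v w → IsContact G B q w := fun w => h'.isContact hq
  obtain ⟨huni, htie, ⟨w, hw⟩, -⟩ := h
  obtain ⟨huni', htie', -, hup'⟩ := h'
  refine ⟨fun w w' k hw hw' => huni' w w' k (huv w hw) (huv w' hw'), ?_, ⟨w, hw⟩,
    fun w hw => hup' w (huv w hw)⟩
  by_cases hqu : IsUniform G B q u
  · have hback : ∀ w', IsContact G B q w' → IsContact G B u w' := fun w' hw' =>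
      have ⟨k, hk, hwk⟩ := hw.2
      ⟨hw'.1, k, hk, hqu w w' k (hvq w (huv w hw)) hw' hk hwk⟩
    have hvu : IsUniform G B v u := fun w w' k hw hw' => hqu w w' k (hvq w hw) (hvq w' hw')
    have hqv : IsUniform G B q v := fun w w' k hw hw' =>
      huni w w' k (hback w hw) (hback w' hw')
    exact Or.inr ((htie.resolve_left (not_not.2 hvu)).trans
      (htie'.resolve_left (not_not.2 hqv)))
  · exact Or.inl hqu

theorem below_or_below [LinearOrder V] [Finite V] (hu : u ∉ B) (hv : v ∉ B)
    (huv : ¬ Linked G B u v) (huni : IsUniform G B u v ∨ IsUniform G B v u) (hw : w ∈ B)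
    (hwu : G.Adj w u) (hwv : G.Adj w v) : Below G B u v ∨ Below G B v u := by
  have hnu : IsContact G B u w := ⟨hw, u, .refl hu, hwu⟩
  have hnv : IsContact G B v w := ⟨hw, v, .refl hv, hwv⟩
  have below_uv (h : IsUniform G B u v) (h' : ¬ IsUniform G B v u ∨ MinLT G B u v) :
      Below G B u v := ⟨h, h', ⟨w, hnu⟩, fun w' hw' => h w w' v hnu hw' (.refl hv) hwv⟩
  have below_vu (h : IsUniform G B v u) (h' : ¬ IsUniform G B u v ∨ MinLT G B v u) :
      Below G B v u := ⟨h, h', ⟨w, hnv⟩, fun w' hw' => h w w' u hnv hw' (.refl hu) hwu⟩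
  have hmin := minLT_total hu hv huv
  tauto

namespace Nestable

variable {H : Set V} {p a : V → V → Prop} (h : Nestable G B H p a)

include h

theorem self_mem (hu : u ∈ H) : u ∈ component G B u := .refl (h.disjoint hu)

theorem mem_of_adj (hu : u ∈ H) (hw : w ∉ H) (hwu : G.Adj w u) : w ∈ B := by
  by_contra hwB
  exact hw (h.closed hu (.of_adj hwu.symm (h.disjoint hu) hwB))

theorem adj_of_prec (hu : u ∈ H) (huv : Linked G B u v) (hp : p u v) (hw : w ∈ B)
    (hwu : G.Adj w u) : G.Adj w v :=
  (h.isRepOn hu).outer_up (fun hw' => hw'.right hw) hwu ⟨h.self_mem hu, huv, hp⟩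

theorem adj_of_nestPrec [LT V] (hu : u ∈ H) (huv : nestPrec G B p u v) (hw : w ∈ B)
    (hwu : G.Adj w u) : G.Adj w v := by
  rcases huv with ⟨huv, hp⟩ | hb
  · exact h.adj_of_prec hu huv hp hw hwu
  · exact hb.2.2.2 w ⟨hw, u, h.self_mem hu, hwu⟩

theorem nestPrec_irrefl [Preorder V] (hu : u ∈ H) : ¬ nestPrec G B p u u := by
  have hu' := h.self_mem hu
  rintro (⟨-, hp⟩ | hb)
  · exact (h.isRepOn hu).irrefl u ⟨hu', hu', hp⟩
  · exact hb.not_linked hu'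

theorem nestPrec_trans [Preorder V] {q : V} (hu : u ∈ H) (hv : v ∈ H) (hq : q ∈ H)
    (huv : nestPrec G B p u v) (hvq : nestPrec G B p v q) : nestPrec G B p u q := by
  rcases huv with ⟨huv, hp⟩ | hb <;> rcases hvq with ⟨hvq, hp'⟩ | hb'
  · have huq := huv.trans hvq
    exact Or.inl ⟨huq, ((h.isRepOn hu).trans ⟨h.self_mem hu, huv, hp⟩ ⟨huv, huq, hp'⟩).2.2⟩
  · exact Or.inr (hb'.congr_left huv.symm (h.disjoint hq))
  · exact Or.inr (hb.congr_right (h.disjoint hu) hvq fun w => h.adj_of_prec hv hvq hp')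
  · exact Or.inr (hb.trans (h.disjoint hv) (h.disjoint hq) hb')

theorem nestPrec_or_nestPrec [LinearOrder V] [Finite V] (hu : u ∈ H) (hv : v ∈ H) (hw : w ∈ B)
    (hwu : G.Adj w u) (hwv : G.Adj w v) (hne : u ≠ v) :
    nestPrec G B p u v ∨ nestPrec G B p v u := by
  by_cases huv : Linked G B u v
  · exact ((h.isRepOn hu).outer_chain (fun hw' => hw'.right hw) (h.self_mem hu) huv hwu hwv
      hne).imp (fun hp => Or.inl ⟨huv, hp.2.2⟩) (fun hp => Or.inl ⟨huv.symm, hp.2.2⟩)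
  · exact (below_or_below (h.disjoint hu) (h.disjoint hv) huv (h.uniform hu hv huv) hw hwu
      hwv).imp Or.inr Or.inr

theorem nest_ax1 [LinearOrder V] [Finite V] {q : V} (hu : u ∈ H) (hv : v ∈ H) (hq : q ∈ H)
    (huv : nestPrec G B p u v) (huq : nestPrec G B p u q) (hne : v ≠ q) :
    nestPrec G B p v q ∨ nestPrec G B p q v := by
  rcases huv with ⟨huv, hp⟩ | hb <;> rcases huq with ⟨huq, hp'⟩ | hb'
  · exact ((h.isRepOn hu).ax1 ⟨h.self_mem hu, huv, hp⟩ ⟨h.self_mem hu, huq, hp'⟩ hne).imp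
      (fun hvq => Or.inl ⟨huv.symm.trans huq, hvq.2.2⟩)
      (fun hqv => Or.inl ⟨huq.symm.trans huv, hqv.2.2⟩)
  · exact Or.inl (Or.inr (hb'.congr_left huv (h.disjoint hq)))
  · exact Or.inr (Or.inr (hb.congr_left huq (h.disjoint hv)))
  · obtain ⟨w, hw⟩ := hb.2.2.1
    exact h.nestPrec_or_nestPrec hv hq hw.1 (hb.2.2.2 w hw) (hb'.2.2.2 w hw) hne

theorem nest_ax2 [LT V] {q : V} (hu : u ∈ H) (huv : nestAdj G B a u v)
    (huq : nestAdj G B a u q) (hne : v ≠ q) : nestPrec G B p v q ∨ nestPrec G B p q v :=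
  ((h.isRepOn hu).ax2 ⟨h.self_mem hu, huv⟩ ⟨h.self_mem hu, huq⟩ hne).imp
    (fun hvq => Or.inl ⟨huv.1.symm.trans huq.1, hvq.2.2⟩)
    (fun hqv => Or.inl ⟨huq.1.symm.trans huv.1, hqv.2.2⟩)

theorem nest_ax3 [LT V] {q : V} (hu : u ∈ H) (hq : q ∈ H) (huv : nestAdj G B a u v)
    (huq : nestPrec G B p u q) : nestPrec G B p v q := by
  rcases huq with ⟨huq, hp⟩ | hb
  · exact Or.inl ⟨huv.1.symm.trans huq,
      ((h.isRepOn hu).ax3 ⟨h.self_mem hu, huv⟩ ⟨h.self_mem hu, huq, hp⟩).2.2⟩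
  · exact Or.inr (hb.congr_left huv.1 (h.disjoint hq))

theorem nest_ax4 [LT V] {q : V} (hu : u ∈ H) (hq : q ∈ H) (huv : nestAdj G B a u v)
    (hvq : nestPrec G B p v q) : nestAdj G B a u q ∨ nestPrec G B p u q := by
  rcases hvq with ⟨hvq, hp⟩ | hb
  · have huq := huv.1.trans hvq
    exact ((h.isRepOn hu).ax4 ⟨h.self_mem hu, huv⟩ ⟨huv.1, huq, hp⟩).imp
      (fun ha => ⟨huq, ha.2.2⟩) (fun hp => Or.inl ⟨huq, hp.2.2⟩)
  · exact Or.inr (Or.inr (hb.congr_left huv.1.symm (h.disjoint hq)))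

theorem nest_wellFounded : WellFounded fun v u => restrict H (nestAdj G B a) u v := by
  refine ⟨fun u => ?_⟩
  by_cases hu : u ∈ H
  · have hacc := (h.isRepOn hu).wf.apply u
    suffices ∀ v, Acc (fun y x => restrict (component G B u) a x y) v → Linked G B u v →
        Acc (fun y x => restrict H (nestAdj G B a) x y) v from this u hacc (h.self_mem hu)
    intro v hv
    induction hv with
    | intro v _ ih =>
      refine fun huv => ⟨v, fun q hq => ?_⟩
      have huq := huv.trans hq.2.2.1
      exact ih q ⟨huv, huq, hq.2.2.2⟩ huq
  · exact ⟨u, fun q hq => absurd hq.1 hu⟩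

theorem adj_iff_nestAdj (hu : u ∈ H) (hv : v ∈ H) :
    G.Adj u v ↔ nestAdj G B a u v ∨ nestAdj G B a v u := by
  constructor
  · intro huv
    have hlink : Linked G B u v := .of_adj huv (h.disjoint hu) (h.disjoint hv)
    exact (((h.isRepOn hu).adj_iff (h.self_mem hu) hlink).1 huv).imp
      (fun ha => ⟨hlink, ha.2.2⟩) (fun ha => ⟨hlink.symm, ha.2.2⟩)
  · rintro (ha | ha)
    · exact ((h.isRepOn hu).adj_iff (h.self_mem hu) ha.1).2 (Or.inl ⟨h.self_mem hu, ha⟩)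
    · exact (((h.isRepOn hv).adj_iff (h.self_mem hv) ha.1).2 (Or.inl ⟨h.self_mem hv, ha⟩)).symm

theorem isRepOn_nest [LinearOrder V] [Finite V] :
    IsRepOn G H (restrict H (nestPrec G B p)) (restrict H (nestAdj G B a)) where
  prec_mem huv := ⟨huv.1, huv.2.1⟩
  adj_mem huv := ⟨huv.1, huv.2.1⟩
  irrefl _ hu := h.nestPrec_irrefl hu.1 hu.2.2
  trans huv hvq :=
    ⟨huv.1, hvq.2.1, h.nestPrec_trans huv.1 hvq.1 hvq.2.1 huv.2.2 hvq.2.2⟩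
  wf := h.nest_wellFounded
  ax1 huv huq hne := (h.nest_ax1 huv.1 huv.2.1 huq.2.1 huv.2.2 huq.2.2 hne).imp
    (fun hvq => ⟨huv.2.1, huq.2.1, hvq⟩) (fun hqv => ⟨huq.2.1, huv.2.1, hqv⟩)
  ax2 huv huq hne := (h.nest_ax2 huv.1 huv.2.2 huq.2.2 hne).imp
    (fun hvq => ⟨huv.2.1, huq.2.1, hvq⟩) (fun hqv => ⟨huq.2.1, huv.2.1, hqv⟩)
  ax3 huv huq := ⟨huv.2.1, huq.2.1, h.nest_ax3 huv.1 huq.2.1 huv.2.2 huq.2.2⟩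
  ax4 huv hvq := (h.nest_ax4 huv.1 hvq.2.1 huv.2.2 hvq.2.2).imp
    (fun ha => ⟨huv.1, hvq.2.1, ha⟩) (fun hp => ⟨huv.1, hvq.2.1, hp⟩)
  adj_iff hu hv := (h.adj_iff_nestAdj hu hv).trans
    (or_congr ⟨fun ha => ⟨hu, hv, ha⟩, fun ha => ha.2.2⟩
      ⟨fun ha => ⟨hv, hu, ha⟩, fun ha => ha.2.2⟩)
  outer_chain hw hu hv hwu hwv hne :=
    (h.nestPrec_or_nestPrec hu hv (h.mem_of_adj hu hw hwu) hwu hwv hne).imp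
      (fun huv => ⟨hu, hv, huv⟩) (fun hvu => ⟨hv, hu, hvu⟩)
  outer_up hw hwu huv := h.adj_of_nestPrec huv.1 huv.2.2 (h.mem_of_adj huv.1 hw hwu) hwu

end Nestable

end Nest

end Recognition

/-! ### Trees of maximal elements -/

namespace Recognition

section Tree

variable {V : Type*} (G : SimpleGraph V)

/-- The closed neighbourhood of `x`. -/
def closedNbhd (x : V) : Set V := insert x (G.neighborSet x)

/-- The pairs (parent, child) of the tree of maximal elements that is grown from `r` in `C`: a
neighbour in `C` of a child becomes a new child unless it is the parent of that child or `T` allows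
to put it below that parent. -/
inductive TreeEdge (C : Set V) (r : V) (T : V → V → Prop) : V → V → Prop
  | root {z : V} (hz : z ∈ C) (h : G.Adj r z) : TreeEdge C r T r z
  | step {x y z : V} (hxy : TreeEdge C r T x y) (hz : z ∈ C) (h : G.Adj y z) (hzx : z ≠ x)
      (hT : ¬ T x z) : TreeEdge C r T y z

/-- The vertices of the tree grown from `r`. -/
def InTree (C : Set V) (r : V) (T : V → V → Prop) (y : V) : Prop :=
  y = r ∨ ∃ x, TreeEdge G C r T x y

/-- The vertex `u` is put below the tree vertex `x`: this is allowed by `T`, and the component of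
`u` in `G - N[x]` is attached to a child of `x`. -/
def Hangs (C : Set V) (r : V) (T : V → V → Prop) (x u : V) : Prop :=
  T x u ∧ ∃ y k, TreeEdge G C r T x y ∧ Linked G (closedNbhd G x) u k ∧ G.Adj y k

/-- The relation `T` can serve as "`T x u`: it is allowed to put `u` below `x`". -/
structure IsPlacement (C : Set V) (T : V → V → Prop) : Prop where
  congr : ∀ {x u v}, T x u → Linked G (closedNbhd G x) u v → T x v
  component_subset : ∀ {x u}, T x u → component G (closedNbhd G x) u ⊆ C
  notMem : ∀ {x u}, T x u → u ∉ closedNbhd G x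

/-- The checkable conditions under which the tree grown from `r` gives a representation of `C`. -/
structure IsValidTree (C : Set V) (r : V) (T : V → V → Prop) : Prop where
  parent_unique : ∀ x x' y, TreeEdge G C r T x y → TreeEdge G C r T x' y → x = x'
  no_parent : ∀ x, ¬ TreeEdge G C r T x r
  edge : ∀ y y', InTree G C r T y → InTree G C r T y' → G.Adj y y' →
    TreeEdge G C r T y y' ∨ TreeEdge G C r T y' y
  not_inTree : ∀ x u, Hangs G C r T x u → ¬ InTree G C r T u
  attach : ∀ x u y, Hangs G C r T x u → InTree G C r T y → G.Adj y u → TreeEdge G C r T x y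
  closed : ∀ x u w, Hangs G C r T x u → w ∈ C → ¬ InTree G C r T w → G.Adj w u →
    w ∉ closedNbhd G x
  outer : ∀ w x x', w ∉ C → InTree G C r T x → InTree G C r T x' → G.Adj w x → G.Adj w x' →
    x = x'
  uniform : ∀ x u v, Hangs G C r T x u → Hangs G C r T x v →
    ¬ Linked G (closedNbhd G x) u v →
    IsUniform G (closedNbhd G x) u v ∨ IsUniform G (closedNbhd G x) v u

/-- The order obtained from a tree and from orders `p x` of the components of `G - N[x]` that are
put below its vertices `x`. -/
def treePrec [LT V] (C : Set V) (r : V) (T : V → V → Prop) (p : V → V → V → Prop) (u v : V) :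
    Prop :=
  Hangs G C r T v u ∨
    ∃ x, restrict {z | Hangs G C r T x z} (nestPrec G (closedNbhd G x) (p x)) u v

/-- The orientation obtained from a tree and from orientations `a x` of the components of
`G - N[x]` that are put below its vertices `x`. -/
def treeAdj (C : Set V) (r : V) (T : V → V → Prop) (a : V → V → V → Prop) (u v : V) : Prop :=
  G.Adj u v ∧ (TreeEdge G C r T v u ∨ (InTree G C r T u ∧ v ∈ C ∧ ¬ InTree G C r T v) ∨
    ∃ x, restrict {z | Hangs G C r T x z} (nestAdj G (closedNbhd G x) (a x)) u v)

/-- The hypotheses for assembling a representation of `C`: a valid tree in the connected set `C`,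
together with representations of the components that may be put below its vertices. -/
structure TreeAssembly (C : Set V) (r : V) (T : V → V → Prop) (p a : V → V → V → Prop) :
    Prop where
  valid : IsValidTree G C r T
  placement : IsPlacement G C T
  connected : ∀ {u}, u ∈ C → Linked G Cᶜ r u
  root_mem : r ∈ C
  isRepOn : ∀ {x u}, T x u → IsRepOn G (component G (closedNbhd G x) u)
    (restrict (component G (closedNbhd G x) u) (p x))
    (restrict (component G (closedNbhd G x) u) (a x))

variable {G} {C : Set V} {r : V} {T : V → V → Prop} {x x' y u v w : V}

theorem adj_of_mem_closedNbhd (hw : w ∈ closedNbhd G x) (hu : u ∉ closedNbhd G x)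
    (h : G.Adj w u) : G.Adj w x := by
  rcases hw with rfl | hw
  · exact absurd (Or.inr h) hu
  · exact hw.symm

theorem TreeEdge.left (h : TreeEdge G C r T x y) : InTree G C r T x := by
  cases h with
  | root _ _ => exact Or.inl rfl
  | step h _ _ _ _ => exact Or.inr ⟨_, h⟩

theorem TreeEdge.right (h : TreeEdge G C r T x y) : InTree G C r T y := Or.inr ⟨_, h⟩

theorem TreeEdge.mem (h : TreeEdge G C r T x y) : y ∈ C := by
  cases h <;> assumption

theorem TreeEdge.adj (h : TreeEdge G C r T x y) : G.Adj x y := by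
  cases h <;> assumption

theorem InTree.mem (h : InTree G C r T y) (hr : r ∈ C) : y ∈ C := by
  rcases h with rfl | ⟨x, h⟩
  · exact hr
  · exact h.mem

theorem Hangs.inTree (h : Hangs G C r T x u) : InTree G C r T x := by
  obtain ⟨-, y, k, hxy, -⟩ := h
  exact hxy.left

theorem Hangs.congr (h : Hangs G C r T x u) (hT : IsPlacement G C T)
    (huv : Linked G (closedNbhd G x) u v) : Hangs G C r T x v := by
  obtain ⟨hxu, y, k, hxy, huk, hyk⟩ := h
  exact ⟨hT.congr hxu huv, y, k, hxy, huv.symm.trans huk, hyk⟩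

theorem Hangs.adj_of_not_hangs (h : Hangs G C r T x u) (hT : IsPlacement G C T)
    (hwu : G.Adj w u) (hw : ¬ Hangs G C r T x w) : G.Adj w x := by
  have hu := hT.notMem h.1
  by_cases hwx : w ∈ closedNbhd G x
  · exact adj_of_mem_closedNbhd hwx hu hwu
  · exact absurd (h.congr hT (.of_adj hwu.symm hu hwx)) hw

theorem InTree.inTree_or_hangs (hy : InTree G C r T y) (hT : IsPlacement G C T) (hv : v ∈ C)
    (hyv : G.Adj y v) : InTree G C r T v ∨ ∃ x, Hangs G C r T x v := by
  rcases hy with rfl | ⟨x, hxy⟩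
  · exact Or.inl (TreeEdge.root hv hyv).right
  · by_cases hvx : v = x
    · exact Or.inl (hvx ▸ hxy.left)
    · by_cases hTv : T x v
      · exact Or.inr ⟨x, hTv, y, v, hxy, .refl (hT.notMem hTv), hyv⟩
      · exact Or.inl (TreeEdge.step hxy hv hyv hvx hTv).right

theorem inTree_or_hangs (hT : IsPlacement G C T) (hu : Linked G Cᶜ r u) :
    InTree G C r T u ∨ ∃ x, Hangs G C r T x u := by
  refine hu.induction_on (p := fun u => InTree G C r T u ∨ ∃ x, Hangs G C r T x u)
    (Or.inl (Or.inl rfl)) ?_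
  rintro a b - hb (ha | ⟨x, ha⟩) hab
  · exact ha.inTree_or_hangs hT (not_not.1 hb.right) hab
  · by_cases hbx : Hangs G C r T x b
    · exact Or.inr ⟨x, hbx⟩
    · exact ha.inTree.inTree_or_hangs hT (not_not.1 hb.right)
        (ha.adj_of_not_hangs hT hab.symm hbx).symm

theorem IsValidTree.hangs_unique (hV : IsValidTree G C r T) (hT : IsPlacement G C T)
    (h : Hangs G C r T x u) (h' : Hangs G C r T x' u) : x = x' := by
  obtain ⟨hxu, y, k, hxy, huk, hyk⟩ := id h
  have hk : Linked G (closedNbhd G x') u k := by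
    refine huk.induction_on (p := Linked G (closedNbhd G x') u) (.refl (hT.notMem h'.1)) ?_
    intro a b _ hb ha' hab
    exact ha'.tail hab (hV.closed x' a b (h'.congr hT ha') (hT.component_subset hxu hb)
      (hV.not_inTree x b (h.congr hT hb)) hab.symm)
  exact hV.parent_unique x x' y hxy (hV.attach x' k y (h'.congr hT hk) hxy.right hyk)

theorem exists_hangs_of_treePrec [LT V] {p : V → V → V → Prop}
    (huv : treePrec G C r T p u v) :
    ∃ x, Hangs G C r T x u ∧ (v = x ∨ Hangs G C r T x v ∧
      restrict {z | Hangs G C r T x z} (nestPrec G (closedNbhd G x) (p x)) u v) := by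
  rcases huv with huv | ⟨x, huv⟩
  · exact ⟨v, huv, Or.inl rfl⟩
  · exact ⟨x, huv.1, Or.inr ⟨huv.2.1, huv⟩⟩

namespace TreeAssembly

variable {p a : V → V → V → Prop} (h : TreeAssembly G C r T p a)

include h

theorem nestable (x : V) :
    Nestable G (closedNbhd G x) {z | Hangs G C r T x z} (p x) (a x) where
  disjoint hu := h.placement.notMem hu.1
  closed hu huv := hu.congr h.placement huv
  isRepOn hu := h.isRepOn hu.1
  uniform hu hv := h.valid.uniform x _ _ hu hv

theorem mem_of_hangs (hu : Hangs G C r T x u) : u ∈ C :=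
  h.placement.component_subset hu.1 (.refl (h.placement.notMem hu.1))

theorem not_inTree_of_hangs (hu : Hangs G C r T x u) : ¬ InTree G C r T u :=
  h.valid.not_inTree x u hu

theorem hangs_unique (hu : Hangs G C r T x u) (hu' : Hangs G C r T x' u) : x = x' :=
  h.valid.hangs_unique h.placement hu hu'

theorem inTree_or_hangs (hu : u ∈ C) : InTree G C r T u ∨ ∃ x, Hangs G C r T x u :=
  Recognition.inTree_or_hangs h.placement (h.connected hu)

theorem adj_of_hangs (hu : Hangs G C r T x u) (hw : w ∉ C) (hwu : G.Adj w u) : G.Adj w x :=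
  hu.adj_of_not_hangs h.placement hwu fun hw' => hw (h.mem_of_hangs hw')

theorem treeAdj_cases (huv : treeAdj G C r T a u v) : TreeEdge G C r T v u ∨
    (InTree G C r T u ∧ ∃ x, Hangs G C r T x v ∧ TreeEdge G C r T x u ∧ G.Adj u v) ∨
    ∃ x, Hangs G C r T x u ∧ Hangs G C r T x v ∧
      restrict {z | Hangs G C r T x z} (nestAdj G (closedNbhd G x) (a x)) u v := by
  obtain ⟨hadj, hvu | ⟨hu, hv, hv'⟩ | ⟨x, hx⟩⟩ := huv
  · exact Or.inl hvu
  · obtain ⟨x, hx⟩ := (h.inTree_or_hangs hv).resolve_left hv'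
    exact Or.inr (Or.inl ⟨hu, x, hx, h.valid.attach x v u hx hu hadj, hadj⟩)
  · exact Or.inr (Or.inr ⟨x, hx.1, hx.2.1, hx⟩)

theorem exists_hangs_of_adj (hu : u ∈ C) (hv : v ∈ C) (hu' : ¬ InTree G C r T u)
    (hv' : ¬ InTree G C r T v) (huv : G.Adj u v) :
    ∃ x, Hangs G C r T x u ∧ Hangs G C r T x v := by
  obtain ⟨x, hx⟩ := (h.inTree_or_hangs hu).resolve_left hu'
  exact ⟨x, hx, hx.congr h.placement (.of_adj huv (h.placement.notMem hx.1)
    (h.valid.closed x u v hx hv hv' huv.symm))⟩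

theorem treeAdj_mem (huv : treeAdj G C r T a u v) : u ∈ C ∧ v ∈ C := by
  rcases h.treeAdj_cases huv with hvu | ⟨-, x, hv, hxu, -⟩ | ⟨x, hu, hv, -⟩
  · exact ⟨hvu.mem, hvu.left.mem h.root_mem⟩
  · exact ⟨hxu.mem, h.mem_of_hangs hv⟩
  · exact ⟨h.mem_of_hangs hu, h.mem_of_hangs hv⟩

theorem acc_of_not_inTree (hv : ¬ InTree G C r T v) :
    Acc (fun y x => treeAdj G C r T a x y) v := by
  by_cases hvx : ∃ x, Hangs G C r T x v
  · obtain ⟨x, hx⟩ := hvx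
    induction (h.nestable x).nest_wellFounded.apply v with
    | intro v _ ih =>
      refine ⟨v, fun q hq => ?_⟩
      rcases h.treeAdj_cases hq with hqv | ⟨hv', -⟩ | ⟨x', hv', hq', hvq⟩
      · exact absurd hqv.right hv
      · exact absurd hv' hv
      · obtain rfl := h.hangs_unique hx hv'
        exact ih q hvq (h.not_inTree_of_hangs hq') hq'
  · refine ⟨v, fun q hq => ?_⟩
    rcases h.treeAdj_cases hq with hqv | ⟨hv', -⟩ | ⟨x', hv', -⟩
    · exact absurd hqv.right hv
    · exact absurd hv' hv
    · exact absurd ⟨x', hv'⟩ hvx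

theorem acc_of_acc_parent
    (hpar : ∀ x, TreeEdge G C r T x v → Acc (fun y x => treeAdj G C r T a x y) x) :
    Acc (fun y x => treeAdj G C r T a x y) v := by
  refine ⟨v, fun q hq => ?_⟩
  rcases h.treeAdj_cases hq with hqv | ⟨-, x', hx', -⟩ | ⟨x', -, hx', -⟩
  · exact hpar q hqv
  · exact h.acc_of_not_inTree (h.not_inTree_of_hangs hx')
  · exact h.acc_of_not_inTree (h.not_inTree_of_hangs hx')

theorem treeAdj_wellFounded : WellFounded fun y x => treeAdj G C r T a x y := by
  have hroot : Acc (fun y x => treeAdj G C r T a x y) r :=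
    h.acc_of_acc_parent fun x hx => absurd hx (h.valid.no_parent x)
  refine ⟨fun v => ?_⟩
  by_cases hv : InTree G C r T v
  · rcases hv with rfl | ⟨x, hxv⟩
    · exact hroot
    · induction hxv with
      | root hz hrz =>
        refine h.acc_of_acc_parent fun x hx => ?_
        rwa [h.valid.parent_unique _ _ _ hx (.root hz hrz)]
      | step hxy hz hyz hzx hTz ih =>
        refine h.acc_of_acc_parent fun x hx => ?_
        rwa [h.valid.parent_unique _ _ _ hx (.step hxy hz hyz hzx hTz)]
  · exact h.acc_of_not_inTree hv

variable {q : V}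

theorem tree_ax3 [LT V] (huv : treeAdj G C r T a u v) (huq : treePrec G C r T p u q) :
    treePrec G C r T p v q := by
  obtain ⟨x', hu', hq⟩ := exists_hangs_of_treePrec huq
  rcases h.treeAdj_cases huv with hvu | ⟨hu, -⟩ | ⟨x, hu, hv, huv⟩
  · exact absurd hvu.right (h.not_inTree_of_hangs hu')
  · exact absurd hu (h.not_inTree_of_hangs hu')
  · obtain rfl := h.hangs_unique hu hu'
    rcases hq with rfl | ⟨-, huq⟩
    · exact Or.inl hv
    · exact Or.inr ⟨x, hv, huq.2.1, (h.nestable x).nest_ax3 hu huq.2.1 huv.2.2 huq.2.2⟩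

section LinearOrder

variable [LinearOrder V] [Finite V]

theorem isRepOn_nest (x : V) : IsRepOn G {z | Hangs G C r T x z}
    (restrict {z | Hangs G C r T x z} (nestPrec G (closedNbhd G x) (p x)))
    (restrict {z | Hangs G C r T x z} (nestAdj G (closedNbhd G x) (a x))) :=
  (h.nestable x).isRepOn_nest

theorem treePrec_irrefl : ¬ treePrec G C r T p u u := fun huu => by
  obtain ⟨x, hu, rfl | ⟨-, huu⟩⟩ := exists_hangs_of_treePrec huu
  · exact h.not_inTree_of_hangs hu hu.inTree
  · exact (h.isRepOn_nest x).irrefl u huu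

theorem treePrec_trans (huv : treePrec G C r T p u v) (hvq : treePrec G C r T p v q) :
    treePrec G C r T p u q := by
  obtain ⟨x, hu, huv⟩ := exists_hangs_of_treePrec huv
  obtain ⟨x', hv', hvq⟩ := exists_hangs_of_treePrec hvq
  rcases huv with rfl | ⟨hv, huv⟩
  · exact absurd hu.inTree (h.not_inTree_of_hangs hv')
  · obtain rfl := h.hangs_unique hv hv'
    rcases hvq with rfl | ⟨-, hvq⟩
    · exact Or.inl hu
    · exact Or.inr ⟨x, (h.isRepOn_nest x).trans huv hvq⟩

theorem tree_ax1 (huv : treePrec G C r T p u v) (huq : treePrec G C r T p u q) (hne : v ≠ q) :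
    treePrec G C r T p v q ∨ treePrec G C r T p q v := by
  obtain ⟨x, hu, huv⟩ := exists_hangs_of_treePrec huv
  obtain ⟨x', hu', huq⟩ := exists_hangs_of_treePrec huq
  obtain rfl := h.hangs_unique hu hu'
  rcases huv with rfl | ⟨hv, huv⟩ <;> rcases huq with rfl | ⟨hq, huq⟩
  · exact absurd rfl hne
  · exact Or.inr (Or.inl hq)
  · exact Or.inl (Or.inl hv)
  · exact ((h.isRepOn_nest x).ax1 huv huq hne).imp (fun hvq => Or.inr ⟨x, hvq⟩)
      (fun hqv => Or.inr ⟨x, hqv⟩)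

theorem tree_ax2 (huv : treeAdj G C r T a u v) (huq : treeAdj G C r T a u q) (hne : v ≠ q) :
    treePrec G C r T p v q ∨ treePrec G C r T p q v := by
  rcases h.treeAdj_cases huv with hvu | ⟨hu, x, hv, hxu, hadj⟩ | ⟨x, hu, -, huv⟩ <;>
    rcases h.treeAdj_cases huq with hqu | ⟨hu', x', hq, hxu', hadj'⟩ | ⟨x', hu', -, huq⟩
  · exact absurd (h.valid.parent_unique _ _ _ hvu hqu) hne
  · obtain rfl := h.valid.parent_unique _ _ _ hvu hxu'
    exact Or.inr (Or.inl hq)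
  · exact absurd hvu.right (h.not_inTree_of_hangs hu')
  · obtain rfl := h.valid.parent_unique _ _ _ hxu hqu
    exact Or.inl (Or.inl hv)
  · obtain rfl := h.valid.parent_unique _ _ _ hxu hxu'
    exact ((h.isRepOn_nest x).outer_chain (fun hu' => h.not_inTree_of_hangs hu' hu) hv hq hadj
      hadj' hne).imp (fun hvq => Or.inr ⟨x, hvq⟩) (fun hqv => Or.inr ⟨x, hqv⟩)
  · exact absurd hu (h.not_inTree_of_hangs hu')
  · exact absurd hqu.right (h.not_inTree_of_hangs hu)
  · exact absurd hu' (h.not_inTree_of_hangs hu)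
  · obtain rfl := h.hangs_unique hu hu'
    exact ((h.isRepOn_nest x).ax2 huv huq hne).imp (fun hvq => Or.inr ⟨x, hvq⟩)
      (fun hqv => Or.inr ⟨x, hqv⟩)

theorem tree_ax4 (huv : treeAdj G C r T a u v) (hvq : treePrec G C r T p v q) :
    treeAdj G C r T a u q ∨ treePrec G C r T p u q := by
  obtain ⟨x', hv', hq⟩ := exists_hangs_of_treePrec hvq
  rcases h.treeAdj_cases huv with hvu | ⟨hu, x, hv, hxu, hadj⟩ | ⟨x, hu, hv, huv⟩
  · exact absurd hvu.left (h.not_inTree_of_hangs hv')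
  · obtain rfl := h.hangs_unique hv hv'
    rcases hq with rfl | ⟨hq, hvq⟩
    · exact Or.inl ⟨hxu.adj.symm, Or.inl hxu⟩
    · exact Or.inl ⟨(h.isRepOn_nest x).outer_up (fun hu' => h.not_inTree_of_hangs hu' hu) hadj
        hvq, Or.inr (Or.inl ⟨hu, h.mem_of_hangs hq, h.not_inTree_of_hangs hq⟩)⟩
  · obtain rfl := h.hangs_unique hv hv'
    rcases hq with rfl | ⟨-, hvq⟩
    · exact Or.inr (Or.inl hu)
    · exact ((h.isRepOn_nest x).ax4 huv hvq).imp
        (fun huq => ⟨((h.isRepOn_nest x).adj_iff huq.1 huq.2.1).2 (Or.inl huq),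
          Or.inr (Or.inr ⟨x, huq⟩)⟩) (fun huq => Or.inr ⟨x, huq⟩)

theorem adj_iff_treeAdj (hu : u ∈ C) (hv : v ∈ C) :
    G.Adj u v ↔ treeAdj G C r T a u v ∨ treeAdj G C r T a v u := by
  refine ⟨fun huv => ?_, fun huv => huv.elim (fun huv => huv.1) (fun hvu => hvu.1.symm)⟩
  by_cases hu' : InTree G C r T u <;> by_cases hv' : InTree G C r T v
  · exact (h.valid.edge u v hu' hv' huv).symm.imp (fun hvu => ⟨huv, Or.inl hvu⟩)
      (fun huv' => ⟨huv.symm, Or.inl huv'⟩)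
  · exact Or.inl ⟨huv, Or.inr (Or.inl ⟨hu', hv, hv'⟩)⟩
  · exact Or.inr ⟨huv.symm, Or.inr (Or.inl ⟨hv', hu, hu'⟩)⟩
  · obtain ⟨x, hxu, hxv⟩ := h.exists_hangs_of_adj hu hv hu' hv' huv
    exact (((h.isRepOn_nest x).adj_iff hxu hxv).1 huv).imp
      (fun ha => ⟨huv, Or.inr (Or.inr ⟨x, ha⟩)⟩)
      (fun ha => ⟨huv.symm, Or.inr (Or.inr ⟨x, ha⟩)⟩)

theorem outer_treePrec (hw : w ∉ C) (hu : u ∈ C) (hv : v ∈ C) (hwu : G.Adj w u)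
    (hwv : G.Adj w v) (hne : u ≠ v) : treePrec G C r T p u v ∨ treePrec G C r T p v u := by
  rcases h.inTree_or_hangs hu with hu' | ⟨x, hx⟩ <;>
    rcases h.inTree_or_hangs hv with hv' | ⟨x', hx'⟩
  · exact absurd (h.valid.outer w u v hw hu' hv' hwu hwv) hne
  · obtain rfl := h.valid.outer w u x' hw hu' hx'.inTree hwu (h.adj_of_hangs hx' hw hwv)
    exact Or.inr (Or.inl hx')
  · obtain rfl := h.valid.outer w x v hw hx.inTree hv' (h.adj_of_hangs hx hw hwu) hwv
    exact Or.inl (Or.inl hx)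
  · obtain rfl := h.valid.outer w x x' hw hx.inTree hx'.inTree (h.adj_of_hangs hx hw hwu)
      (h.adj_of_hangs hx' hw hwv)
    exact ((h.isRepOn_nest x).outer_chain (fun hw' => hw (h.mem_of_hangs hw')) hx hx' hwu hwv
      hne).imp (fun huv => Or.inr ⟨x, huv⟩) (fun hvu => Or.inr ⟨x, hvu⟩)

theorem isRepOn_tree : IsRepOn G C (treePrec G C r T p) (treeAdj G C r T a) where
  prec_mem := by
    rintro u v (hu | ⟨x, huv⟩)
    · exact ⟨h.mem_of_hangs hu, hu.inTree.mem h.root_mem⟩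
    · exact ⟨h.mem_of_hangs huv.1, h.mem_of_hangs huv.2.1⟩
  adj_mem := h.treeAdj_mem
  irrefl _ := h.treePrec_irrefl
  trans := h.treePrec_trans
  wf := h.treeAdj_wellFounded
  ax1 := h.tree_ax1
  ax2 := h.tree_ax2
  ax3 := h.tree_ax3
  ax4 := h.tree_ax4
  adj_iff := h.adj_iff_treeAdj
  outer_chain := h.outer_treePrec
  outer_up := by
    intro w u v hw hwu huv
    obtain ⟨x, hu, rfl | ⟨-, huv⟩⟩ := exists_hangs_of_treePrec huv
    · exact h.adj_of_hangs hu hw hwu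
    · exact (h.isRepOn_nest x).outer_up (fun hw' => hw (h.mem_of_hangs hw')) hwu huv

end LinearOrder

end TreeAssembly

end Tree

end Recognition

/-! ### The maximal elements of a representation -/

namespace Recognition

variable {V : Type*} {G : SimpleGraph V} {C : Set V} {prec adj : V → V → Prop}
  {x y z u v w r : V}

/-- A maximal element of `C`. -/
def IsTop (C : Set V) (prec : V → V → Prop) (u : V) : Prop := u ∈ C ∧ ∀ v, ¬ prec u v

/-- The vertex `u` is or lies below a maximal element from which `y` can be reached along `adj`
through maximal elements. -/
def Upstream (C : Set V) (prec adj : V → V → Prop) (y u : V) : Prop :=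
  ∃ q, IsTop C prec q ∧ (u = q ∨ prec u q) ∧
    Relation.ReflTransGen (fun a b => IsTop C prec b ∧ adj a b) q y

namespace IsRepOn

variable (h : IsRepOn G C prec adj)

include h

theorem restrict {K : Set V} (hK : K ⊆ C)
    (hchain : ∀ w x y, w ∉ K → x ∈ K → y ∈ K → G.Adj w x → G.Adj w y → x ≠ y →
      prec x y ∨ prec y x)
    (hup : ∀ w x y, w ∉ K → x ∈ K → y ∈ K → G.Adj w x → prec x y → G.Adj w y) :
    IsRepOn G K (restrict K prec) (restrict K adj) where
  prec_mem hxy := ⟨hxy.1, hxy.2.1⟩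
  adj_mem hxy := ⟨hxy.1, hxy.2.1⟩
  irrefl _ hxx := h.irrefl _ hxx.2.2
  trans hxy hyz := ⟨hxy.1, hyz.2.1, h.trans hxy.2.2 hyz.2.2⟩
  wf := Subrelation.wf (fun hxy => hxy.2.2) h.wf
  ax1 hxy hxz hne := (h.ax1 hxy.2.2 hxz.2.2 hne).imp (fun hyz => ⟨hxy.2.1, hxz.2.1, hyz⟩)
    (fun hzy => ⟨hxz.2.1, hxy.2.1, hzy⟩)
  ax2 hxy hxz hne := (h.ax2 hxy.2.2 hxz.2.2 hne).imp (fun hyz => ⟨hxy.2.1, hxz.2.1, hyz⟩)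
    (fun hzy => ⟨hxz.2.1, hxy.2.1, hzy⟩)
  ax3 hxy hxz := ⟨hxy.2.1, hxz.2.1, h.ax3 hxy.2.2 hxz.2.2⟩
  ax4 hxy hyz := (h.ax4 hxy.2.2 hyz.2.2).imp (fun hxz => ⟨hxy.1, hyz.2.1, hxz⟩)
    (fun hxz => ⟨hxy.1, hyz.2.1, hxz⟩)
  adj_iff hx hy := (h.adj_iff (hK hx) (hK hy)).trans
    (or_congr ⟨fun hxy => ⟨hx, hy, hxy⟩, fun hxy => hxy.2.2⟩
      ⟨fun hyx => ⟨hy, hx, hyx⟩, fun hyx => hyx.2.2⟩)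
  outer_chain hw hx hy hwx hwy hne := (hchain _ _ _ hw hx hy hwx hwy hne).imp
    (fun hxy => ⟨hx, hy, hxy⟩) (fun hyx => ⟨hy, hx, hyx⟩)
  outer_up hw hwx hxy := hup _ _ _ hw hxy.1 hxy.2.1 hwx hxy.2.2

theorem not_transGen (x : V) : ¬ Relation.TransGen adj x x := fun hx =>
  h.wf.transGen.irrefl.irrefl x (Relation.transGen_swap.2 hx)

theorem adj_irrefl (x : V) : ¬ adj x x := fun hx => h.not_transGen x (.single hx)

theorem adj_asymm (hxy : adj x y) (hyx : adj y x) : False :=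
  h.not_transGen x (.tail (.single hxy) hyx)

theorem graph_adj (hxy : adj x y) : G.Adj x y :=
  (h.adj_iff (h.adj_mem hxy).1 (h.adj_mem hxy).2).2 (Or.inl hxy)

theorem not_adj_of_prec (hxy : prec x y) : ¬ G.Adj x y := by
  rw [h.adj_iff (h.prec_mem hxy).1 (h.prec_mem hxy).2]
  rintro (ha | ha)
  · exact h.irrefl _ (h.ax3 ha hxy)
  · exact (h.ax4 ha hxy).elim (h.adj_irrefl _) (h.irrefl _)

theorem notMem_closedNbhd (hzx : prec z x) : z ∉ closedNbhd G x := by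
  rintro (rfl | ha)
  · exact h.irrefl _ hzx
  · exact h.not_adj_of_prec hzx ha.symm

theorem prec_of_adj (hux : prec u x) (huv : G.Adj u v) (hv : v ∉ closedNbhd G x) : prec v x := by
  by_cases hvC : v ∈ C
  · rcases (h.adj_iff (h.prec_mem hux).1 hvC).1 huv with ha | ha
    · exact h.ax3 ha hux
    · exact (h.ax4 ha hux).resolve_left fun hvx => hv (Or.inr (h.graph_adj hvx).symm)
  · exact absurd (Or.inr (h.outer_up hvC huv.symm hux).symm) hv

theorem prec_of_linked (hux : prec u x) (huv : Linked G (closedNbhd G x) u v) : prec v x :=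
  huv.induction_on (p := fun a => prec a x) hux fun _ _ _ hb ha hab =>
    h.prec_of_adj ha hab hb.right

theorem adj_of_mem_closedNbhd_of_prec (hw : w ∈ closedNbhd G x) (hux : prec u x)
    (hwu : G.Adj w u) (hwC : w ∈ C) : adj w u :=
  ((h.adj_iff hwC (h.prec_mem hux).1).1 hwu).resolve_right fun ha =>
    h.notMem_closedNbhd (h.ax3 ha hux) hw

theorem prec_or_prec_of_mem_closedNbhd (hw : w ∈ closedNbhd G x) (hux : prec u x)
    (hvx : prec v x) (hwu : G.Adj w u) (hwv : G.Adj w v) (hne : u ≠ v) :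
    prec u v ∨ prec v u := by
  by_cases hwC : w ∈ C
  · exact h.ax2 (h.adj_of_mem_closedNbhd_of_prec hw hux hwu hwC)
      (h.adj_of_mem_closedNbhd_of_prec hw hvx hwv hwC) hne
  · exact h.outer_chain hwC (h.prec_mem hux).1 (h.prec_mem hvx).1 hwu hwv hne

theorem graph_adj_of_mem_closedNbhd (hw : w ∈ closedNbhd G x) (hux : prec u x)
    (hvx : prec v x) (hwu : G.Adj w u) (huv : prec u v) : G.Adj w v := by
  by_cases hwC : w ∈ C
  · exact h.graph_adj ((h.ax4 (h.adj_of_mem_closedNbhd_of_prec hw hux hwu hwC) huv).resolve_right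
      fun hwv => h.notMem_closedNbhd (h.trans hwv hvx) hw)
  · exact h.outer_up hwC hwu huv

theorem isRepOn_component (hzx : prec z x) : IsRepOn G (component G (closedNbhd G x) z)
    (Recognition.restrict (component G (closedNbhd G x) z) prec)
    (Recognition.restrict (component G (closedNbhd G x) z) adj) := by
  have hlow : ∀ v ∈ component G (closedNbhd G x) z, prec v x := fun v hv =>
    h.prec_of_linked hzx hv
  have hnb : ∀ w v, w ∉ component G (closedNbhd G x) z → v ∈ component G (closedNbhd G x) z →
      G.Adj w v → w ∈ closedNbhd G x := by
    intro w v hw hv hwv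
    by_contra hwx
    exact hw (hv.tail hwv.symm hwx)
  refine h.restrict (fun v hv => (h.prec_mem (hlow v hv)).1) ?_ ?_
  · intro w u v hw hu hv hwu hwv hne
    exact h.prec_or_prec_of_mem_closedNbhd (hnb w u hw hu hwu) (hlow u hu) (hlow v hv) hwu hwv hne
  · intro w u v hw hu hv hwu huv
    exact h.graph_adj_of_mem_closedNbhd (hnb w u hw hu hwu) (hlow u hu) (hlow v hv) hwu huv

theorem isTop_of_adj (hzy : adj z y) (hy : IsTop C prec y) : IsTop C prec z :=
  ⟨(h.adj_mem hzy).1, fun q hq => hy.2 q (h.ax3 hzy hq)⟩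

theorem isTop_unique (hv : IsTop C prec v) (hw : IsTop C prec w) (huv : u = v ∨ prec u v)
    (huw : u = w ∨ prec u w) : v = w := by
  rcases huv with rfl | huv <;> rcases huw with rfl | huw
  · rfl
  · exact absurd huw (hv.2 _)
  · exact absurd huv (hw.2 _)
  · by_contra hne
    exact (h.ax1 huv huw hne).elim (hv.2 _) (hw.2 _)

theorem isTop_unique_of_adj (hv : IsTop C prec v) (hw : IsTop C prec w) (huv : adj u v)
    (huw : adj u w) : v = w := by
  by_contra hne
  exact (h.ax2 huv huw hne).elim (hv.2 _) (hw.2 _)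

theorem exists_isTop [Finite V] (hu : u ∈ C) : ∃ v, IsTop C prec v ∧ (u = v ∨ prec u v) := by
  have : IsTrans V fun a b => prec b a := ⟨fun a b c hba hcb => h.trans hcb hba⟩
  have : Std.Irrefl fun a b => prec b a := ⟨h.irrefl⟩
  have hwf : WellFounded fun a b => prec b a := Finite.wellFounded_of_trans_of_irrefl _
  obtain ⟨v, hv, hmax⟩ := hwf.has_min {v | v ∈ C ∧ (u = v ∨ prec u v)} ⟨u, hu, Or.inl rfl⟩
  refine ⟨v, ⟨hv.1, fun q hq => hmax q ⟨(h.prec_mem hq).2, Or.inr ?_⟩ hq⟩, hv.2⟩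
  rcases hv.2 with rfl | huv
  · exact hq
  · exact h.trans huv hq

theorem exists_isTop_sink [Finite V] (hC : C.Nonempty) :
    ∃ r, IsTop C prec r ∧ ∀ v, ¬ adj r v := by
  obtain ⟨u, hu⟩ := hC
  obtain ⟨v, hv, -⟩ := h.exists_isTop hu
  obtain ⟨r, hr, hmin⟩ := h.wf.has_min {v | IsTop C prec v} ⟨v, hv⟩
  refine ⟨r, hr, fun v hrv => ?_⟩
  obtain ⟨q, hq, rfl | hvq⟩ := h.exists_isTop (h.adj_mem hrv).2
  · exact hmin v hq hrv
  · exact (h.ax4 hrv hvq).elim (hmin q hq) (hr.2 q)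

theorem upstream_of_adj (hu : Upstream C prec adj y u) (huy : u ≠ y) (hv : v ∈ C)
    (huv : G.Adj u v) : Upstream C prec adj y v := by
  obtain ⟨q, hq, rfl | huq, hqy⟩ := hu
  · rcases (h.adj_iff hq.1 hv).1 huv with ha | ha
    · rcases hqy.cases_head with rfl | ⟨q', ⟨hq', hqq'⟩, hq'y⟩
      · exact absurd rfl huy
      · refine ⟨q', hq', ?_, hq'y⟩
        by_contra! hne
        exact (h.ax2 ha hqq' hne.1).elim hne.2 (hq'.2 _)
    · exact ⟨v, h.isTop_of_adj ha hq, Or.inl rfl, hqy.head ⟨hq, ha⟩⟩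
  · rcases (h.adj_iff (h.prec_mem huq).1 hv).1 huv with ha | ha
    · exact ⟨q, hq, Or.inr (h.ax3 ha huq), hqy⟩
    · rcases h.ax4 ha huq with hvq | hvq
      · exact ⟨v, h.isTop_of_adj hvq hq, Or.inl rfl, hqy.head ⟨hq, hvq⟩⟩
      · exact ⟨q, hq, Or.inr hvq, hqy⟩

theorem not_upstream (hx : IsTop C prec x) (hyx : adj y x) (hux : u = x ∨ prec u x) :
    ¬ Upstream C prec adj y u := by
  rintro ⟨q, hq, huq, hqy⟩
  obtain rfl := h.isTop_unique hx hq hux huq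
  exact h.not_transGen x (.tail' (Relation.ReflTransGen.mono (fun _ _ hab => hab.2) _ _ hqy) hyx)

theorem notMem_closedNbhd_of_upstream (hx : IsTop C prec x) (hyx : adj y x)
    (hu : Upstream C prec adj y u) (huy : u ≠ y) : u ∉ closedNbhd G x := by
  rintro (rfl | hux)
  · exact h.not_upstream hx hyx (Or.inl rfl) hu
  · exact h.not_upstream hx hyx (Or.inl rfl) (h.upstream_of_adj hu huy hx.1 hux.symm)

end IsRepOn

/-! ### The tree grown from a sink -/

/-- A tree grown in a represented set from a maximal element `r` without out-neighbours, with
respect to a placement relation `T` that allows everything that occurs in the representation. -/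
structure IsSinkTree (G : SimpleGraph V) (C : Set V) (prec adj : V → V → Prop) (r : V)
    (T : V → V → Prop) : Prop where
  isRepOn : IsRepOn G C prec adj
  isTop : IsTop C prec r
  sink : ∀ v, ¬ adj r v
  placement : IsPlacement G C T
  of_prec : ∀ {x z}, prec z x → T x z

namespace IsSinkTree

variable {T : V → V → Prop} (h : IsSinkTree G C prec adj r T)

include h

theorem isTop_and_adj_of_treeEdge (hxy : TreeEdge G C r T x y) :
    IsTop C prec x ∧ IsTop C prec y ∧ adj y x := by
  induction hxy with
  | @root z hz hrz =>
    have hzr := ((h.isRepOn.adj_iff h.isTop.1 hz).1 hrz).resolve_left (h.sink z)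
    exact ⟨h.isTop, h.isRepOn.isTop_of_adj hzr h.isTop, hzr⟩
  | @step x y z _ hz hyz hzx hTz ih =>
    obtain ⟨hx, hy, hyx⟩ := ih
    rcases (h.isRepOn.adj_iff hy.1 hz).1 hyz with ha | ha
    · exact absurd (h.of_prec ((h.isRepOn.ax2 ha hyx hzx).resolve_right (hx.2 z))) hTz
    · exact ⟨hy, h.isRepOn.isTop_of_adj ha hy, ha⟩

theorem isTop_of_inTree (hy : InTree G C r T y) : IsTop C prec y := by
  rcases hy with rfl | ⟨x, hxy⟩
  · exact h.isTop
  · exact (h.isTop_and_adj_of_treeEdge hxy).2.1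

theorem adj_of_treeEdge (hxy : TreeEdge G C r T x y) : adj y x :=
  (h.isTop_and_adj_of_treeEdge hxy).2.2

theorem parent_unique (hxz : TreeEdge G C r T x z) (hyz : TreeEdge G C r T y z) : x = y :=
  h.isRepOn.isTop_unique_of_adj (h.isTop_of_inTree hxz.left) (h.isTop_of_inTree hyz.left)
    (h.adj_of_treeEdge hxz) (h.adj_of_treeEdge hyz)

theorem treeEdge_of_adj (hy : InTree G C r T y) (hx : InTree G C r T x) (hyx : adj y x) :
    TreeEdge G C r T x y := by
  rcases hy with rfl | ⟨x', hxy⟩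
  · exact absurd hyx (h.sink x)
  · rwa [h.isRepOn.isTop_unique_of_adj (h.isTop_of_inTree hx) (h.isTop_of_inTree hxy.left) hyx
      (h.adj_of_treeEdge hxy)]

theorem treeEdge_or_treeEdge (hx : InTree G C r T x) (hy : InTree G C r T y)
    (hxy : G.Adj x y) : TreeEdge G C r T x y ∨ TreeEdge G C r T y x :=
  ((h.isRepOn.adj_iff (h.isTop_of_inTree hx).1 (h.isTop_of_inTree hy).1).1 hxy).symm.imp
    (h.treeEdge_of_adj hy hx) (h.treeEdge_of_adj hx hy)

theorem eq_of_upstream (hr : Upstream C prec adj y r) : r = y := by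
  obtain ⟨q, hq, hrq, hqy⟩ := hr
  obtain rfl := h.isRepOn.isTop_unique h.isTop hq (Or.inl rfl) hrq
  rcases hqy.cases_head with rfl | ⟨q', ⟨-, hrq'⟩, -⟩
  · rfl
  · exact absurd hrq' (h.sink q')

theorem prec_or_upstream_of_hangs (hu : Hangs G C r T x u) :
    (∀ v, Linked G (closedNbhd G x) u v → prec v x) ∨
      ∃ y, TreeEdge G C r T x y ∧
        ∀ v, Linked G (closedNbhd G x) u v → Upstream C prec adj y v ∧ v ≠ y := by
  obtain ⟨hxu, y, k, hxy, huk, hyk⟩ := hu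
  obtain ⟨hx, hy, hyx⟩ := h.isTop_and_adj_of_treeEdge hxy
  have hkC := h.placement.component_subset hxu huk
  rcases (h.isRepOn.adj_iff hy.1 hkC).1 hyk with ha | ha
  · have hkx : k ≠ x := fun e => huk.right (Or.inl e)
    have hkx' : prec k x := (h.isRepOn.ax2 ha hyx hkx).resolve_right (hx.2 k)
    exact Or.inl fun v hv => h.isRepOn.prec_of_linked hkx' (huk.symm.trans hv)
  · have hne : ∀ v, Linked G (closedNbhd G x) u v → v ≠ y := fun v hv hvy =>
      hv.right (hvy ▸ Or.inr hxy.adj)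
    refine Or.inr ⟨y, hxy, fun v hv => ⟨?_, hne v hv⟩⟩
    refine (huk.symm.trans hv).induction_on (p := Upstream C prec adj y)
      ⟨k, h.isRepOn.isTop_of_adj ha hy, Or.inl rfl, .single ⟨hy, ha⟩⟩ ?_
    intro a b hka hkb ha hab
    exact h.isRepOn.upstream_of_adj ha (hne a (huk.trans hka))
      (h.placement.component_subset hxu (huk.trans hkb)) hab

theorem exists_linked_child_of_parent {p : V} (hxy : TreeEdge G C r T x y)
    (hpu : TreeEdge G C r T p u) (hu : Upstream C prec adj y u) (huy : u ≠ y)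
    (ih : Upstream C prec adj y p → p ≠ y →
      ∃ z, TreeEdge G C r T y z ∧ Linked G (closedNbhd G x) p z) :
    ∃ z, TreeEdge G C r T y z ∧ Linked G (closedNbhd G x) u z := by
  obtain ⟨hp, hu', hup⟩ := h.isTop_and_adj_of_treeEdge hpu
  have hux := h.isRepOn.notMem_closedNbhd_of_upstream (h.isTop_of_inTree hxy.left)
    (h.adj_of_treeEdge hxy) hu huy
  obtain ⟨q, hq, huq, hqy⟩ := hu
  obtain rfl := h.isRepOn.isTop_unique hu' hq (Or.inl rfl) huq
  rcases hqy.cases_head with rfl | ⟨q', ⟨hq', huq'⟩, hq'y⟩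
  · exact absurd rfl huy
  · obtain rfl := h.isRepOn.isTop_unique_of_adj hp hq' hup huq'
    by_cases hpy : p = y
    · subst hpy
      exact ⟨u, hpu, .refl hux⟩
    · obtain ⟨z, hyz, hpz⟩ := ih ⟨p, hp, Or.inl rfl, hq'y⟩ hpy
      exact ⟨z, hyz, (Linked.of_adj hpu.adj.symm hux hpz.left).trans hpz⟩

theorem exists_linked_child (hxy : TreeEdge G C r T x y) (hu : InTree G C r T u)
    (huy : Upstream C prec adj y u) (hne : u ≠ y) :
    ∃ z, TreeEdge G C r T y z ∧ Linked G (closedNbhd G x) u z := by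
  rcases hu with rfl | ⟨p, hpu⟩
  · exact absurd (h.eq_of_upstream huy) hne
  · induction hpu with
    | root hz hrz =>
      exact h.exists_linked_child_of_parent hxy (.root hz hrz) huy hne fun hr hry =>
        absurd (h.eq_of_upstream hr) hry
    | step hpq hz hqz hzp hTz ih =>
      exact h.exists_linked_child_of_parent hxy (.step hpq hz hqz hzp hTz) huy hne ih

theorem not_inTree_of_hangs (hu : Hangs G C r T x u) : ¬ InTree G C r T u := fun hu' => by
  have hxu := h.placement.notMem hu.1
  rcases h.prec_or_upstream_of_hangs hu with hlow | ⟨y, hxy, hup⟩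
  · exact (h.isTop_of_inTree hu').2 _ (hlow u (.refl hxu))
  · obtain ⟨huy, hne⟩ := hup u (.refl hxu)
    obtain ⟨z, hyz, huz⟩ := h.exists_linked_child hxy hu' huy hne
    have hTz := h.placement.congr hu.1 huz
    cases hyz with
    | root _ _ => exact h.sink x (h.adj_of_treeEdge hxy)
    | step hxy' _ _ _ hT' => exact hT' (h.parent_unique hxy' hxy ▸ hTz)

theorem treeEdge_of_hangs (hu : Hangs G C r T x u) (hy : InTree G C r T y) (hyu : G.Adj y u) :
    TreeEdge G C r T x y := by
  have hxu := h.placement.notMem hu.1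
  have hyx : y ∈ closedNbhd G x := by
    by_contra hyx
    exact h.not_inTree_of_hangs (hu.congr h.placement (.of_adj hyu.symm hxu hyx)) hy
  have hy' := h.isTop_of_inTree hy
  have hx := h.isTop_of_inTree hu.inTree
  rcases (h.isRepOn.adj_iff hy'.1 hx.1).1 (adj_of_mem_closedNbhd hyx hxu hyu) with ha | ha
  · exact h.treeEdge_of_adj hy hu.inTree ha
  · exfalso
    rcases h.prec_or_upstream_of_hangs hu with hlow | ⟨q, hxq, hup⟩
    · have hux := hlow u (.refl hxu)
      rcases h.isRepOn.ax4 (h.isRepOn.adj_of_mem_closedNbhd_of_prec hyx hux hyu hy'.1) hux with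
        hyx' | hyx'
      · exact h.isRepOn.adj_asymm ha hyx'
      · exact hy'.2 _ hyx'
    · obtain ⟨huq, hne⟩ := hup u (.refl hxu)
      have hyq := h.isRepOn.upstream_of_adj huq hne hy'.1 hyu.symm
      refine h.isRepOn.notMem_closedNbhd_of_upstream hx (h.adj_of_treeEdge hxq) hyq ?_ hyx
      rintro rfl
      exact h.isRepOn.adj_asymm ha (h.adj_of_treeEdge hxq)

theorem notMem_closedNbhd_of_prec_child (hxy : TreeEdge G C r T x y) (hv : prec v y) :
    v ∉ closedNbhd G x := by
  obtain ⟨hx, -, hyx⟩ := h.isTop_and_adj_of_treeEdge hxy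
  rintro (rfl | hxv)
  · exact hx.2 _ hv
  · rcases (h.isRepOn.adj_iff hx.1 (h.isRepOn.prec_mem hv).1).1 hxv with ha | ha
    · rcases h.isRepOn.ax4 ha hv with hxy' | hxy'
      · exact h.isRepOn.adj_asymm hyx hxy'
      · exact hx.2 _ hxy'
    · exact hx.2 _ (h.isRepOn.ax3 ha hv)

theorem notMem_closedNbhd_grandchild (hxy : TreeEdge G C r T x y) (hyz : TreeEdge G C r T y z) :
    z ∉ closedNbhd G x := by
  obtain ⟨hx, hy, hyx⟩ := h.isTop_and_adj_of_treeEdge hxy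
  obtain ⟨-, hz, hzy⟩ := h.isTop_and_adj_of_treeEdge hyz
  rintro (rfl | hxz)
  · exact h.isRepOn.adj_asymm hyx hzy
  · rcases (h.isRepOn.adj_iff hx.1 hz.1).1 hxz with ha | ha
    · exact h.isRepOn.not_transGen x (.tail (.tail (.single ha) hzy) hyx)
    · obtain rfl := h.isRepOn.isTop_unique_of_adj hy hx hzy ha
      exact h.isRepOn.adj_irrefl _ hyx

theorem inTree_of_adj_of_prec (hu : Hangs G C r T x u)
    (hlow : ∀ v, Linked G (closedNbhd G x) u v → prec v x) (hw : w ∈ C) (hwu : G.Adj w u)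
    (hwx : G.Adj w x) : InTree G C r T w := by
  rcases hu.inTree with rfl | ⟨x₀, hx₀⟩
  · exact (TreeEdge.root hw hwx.symm).right
  · by_contra hwT
    have hne : w ≠ x₀ := by
      rintro rfl
      exact hwT hx₀.left
    by_cases hTw : T x₀ w
    · obtain ⟨hxu, y, k, hxy, huk, hyk⟩ := hu
      have hwn := h.placement.notMem hTw
      have hun := h.notMem_closedNbhd_of_prec_child hx₀ (hlow u (.refl (h.placement.notMem hxu)))
      have huk' : Linked G (closedNbhd G x₀) u k :=
        huk.induction_on (p := Linked G (closedNbhd G x₀) u) (.refl hun) fun a b _ hb ha hab =>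
          ha.tail hab (h.notMem_closedNbhd_of_prec_child hx₀ (hlow b hb))
      have hwy : Linked G (closedNbhd G x₀) w y := ((Linked.of_adj hwu hwn hun).trans huk').tail
        hyk.symm (h.notMem_closedNbhd_grandchild hx₀ hxy)
      have hw' : Hangs G C r T x₀ w := ⟨hTw, x, w, hx₀, .refl hwn, hwx.symm⟩
      exact h.not_inTree_of_hangs (hw'.congr h.placement hwy) hxy.right
    · exact hwT (TreeEdge.step hx₀ hw hwx.symm hne hTw).right

theorem notMem_closedNbhd_of_hangs (hu : Hangs G C r T x u) (hw : w ∈ C)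
    (hwT : ¬ InTree G C r T w) (hwu : G.Adj w u) : w ∉ closedNbhd G x := fun hwx => by
  have hxu := h.placement.notMem hu.1
  rcases h.prec_or_upstream_of_hangs hu with hlow | ⟨y, hxy, hup⟩
  · exact hwT (h.inTree_of_adj_of_prec hu hlow hw hwu (adj_of_mem_closedNbhd hwx hxu hwu))
  · obtain ⟨huy, hne⟩ := hup u (.refl hxu)
    refine h.isRepOn.notMem_closedNbhd_of_upstream (h.isTop_of_inTree hxy.left)
      (h.adj_of_treeEdge hxy) (h.isRepOn.upstream_of_adj huy hne hw hwu.symm) ?_ hwx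
    rintro rfl
    exact hwT hxy.right

theorem eq_of_outer_adj (hw : w ∉ C) (hx : InTree G C r T x) (hy : InTree G C r T y)
    (hwx : G.Adj w x) (hwy : G.Adj w y) : x = y := by
  have hx' := h.isTop_of_inTree hx
  have hy' := h.isTop_of_inTree hy
  by_contra hne
  exact (h.isRepOn.outer_chain hw hx'.1 hy'.1 hwx hwy hne).elim (hx'.2 _) (hy'.2 _)

theorem isUniform_of_upstream (hu : Hangs G C r T x u) (hxy : TreeEdge G C r T x y)
    (hup : ∀ v, Linked G (closedNbhd G x) u v → Upstream C prec adj y v ∧ v ≠ y) :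
    IsUniform G (closedNbhd G x) u v := by
  obtain ⟨hx, -, hyx⟩ := h.isTop_and_adj_of_treeEdge hxy
  have eq_y : ∀ w, IsContact G (closedNbhd G x) u w → w = y := by
    rintro w ⟨hw, k, huk, hwk⟩
    obtain ⟨hky, hne⟩ := hup k huk
    by_cases hwC : w ∈ C
    · by_contra hwy
      exact h.isRepOn.notMem_closedNbhd_of_upstream hx hyx
        (h.isRepOn.upstream_of_adj hky hne hwC hwk.symm) hwy hw
    · have hkx : k ≠ x := fun e => huk.right (Or.inl e)
      have hkx' := (h.isRepOn.outer_chain hwC (h.placement.component_subset hu.1 huk) hx.1 hwk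
        (adj_of_mem_closedNbhd hw huk.right hwk) hkx).resolve_right (hx.2 k)
      exact absurd hky (h.isRepOn.not_upstream hx hyx (Or.inr hkx'))
  intro w w' k hw hw' _ hwk
  rwa [eq_y w' hw', ← eq_y w hw]

end IsSinkTree

namespace IsRepOn

variable (h : IsRepOn G C prec adj)

include h

theorem prec_of_linked_of_prec {a b k : V} (huv : ¬ Linked G (closedNbhd G x) u v)
    (ha : Linked G (closedNbhd G x) u a) (hb : Linked G (closedNbhd G x) v b) (hab : prec a b)
    (hk : Linked G (closedNbhd G x) u k) : prec k b := by
  refine (ha.symm.trans hk).induction_on (p := fun c => prec c b) hab fun c d _ hd hcb hcd =>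
    h.prec_of_adj hcb hcd ?_
  rintro (rfl | hdb)
  · exact huv ((ha.trans hd).trans hb.symm)
  · exact huv (((ha.trans hd).tail hdb.symm hb.right).trans hb.symm)

theorem isUniform_of_prec {a b : V} (huv : ¬ Linked G (closedNbhd G x) u v)
    (hu : ∀ k, Linked G (closedNbhd G x) u k → prec k x)
    (hv : ∀ k, Linked G (closedNbhd G x) v k → prec k x)
    (ha : Linked G (closedNbhd G x) u a) (hb : Linked G (closedNbhd G x) v b)
    (hab : prec a b) : IsUniform G (closedNbhd G x) u v := by
  rintro w w' k ⟨hw, c, hc, hwc⟩ ⟨hw', c', hc', hwc'⟩ hk hwk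
  have hck : c ≠ k := by
    rintro rfl
    exact huv (hc.trans hk.symm)
  rcases h.prec_or_prec_of_mem_closedNbhd hw (hu c hc) (hv k hk) hwc hwk hck with hck' | hkc
  · exact h.graph_adj_of_mem_closedNbhd hw' (hu c' hc') (hv k hk) hwc'
      (h.prec_of_linked_of_prec huv hc hk hck' hc')
  · have hbc := h.prec_of_linked_of_prec (fun hvu => huv hvu.symm) hk hc hkc hb
    exact absurd (h.trans hbc (h.prec_of_linked_of_prec huv ha hb hab hc)) (h.irrefl b)

theorem isUniform_or_isUniform (huv : ¬ Linked G (closedNbhd G x) u v)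
    (hu : ∀ k, Linked G (closedNbhd G x) u k → prec k x)
    (hv : ∀ k, Linked G (closedNbhd G x) v k → prec k x) :
    IsUniform G (closedNbhd G x) u v ∨ IsUniform G (closedNbhd G x) v u := by
  by_cases hcommon : ∃ w c k, w ∈ closedNbhd G x ∧ Linked G (closedNbhd G x) u c ∧
      Linked G (closedNbhd G x) v k ∧ G.Adj w c ∧ G.Adj w k
  · obtain ⟨w, c, k, hw, hc, hk, hwc, hwk⟩ := hcommon
    have hck : c ≠ k := by
      rintro rfl
      exact huv (hc.trans hk.symm)
    exact (h.prec_or_prec_of_mem_closedNbhd hw (hu c hc) (hv k hk) hwc hwk hck).imp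
      (h.isUniform_of_prec huv hu hv hc hk)
      (h.isUniform_of_prec (fun hvu => huv hvu.symm) hv hu hk hc)
  · exact Or.inl fun w _ k ⟨hw, c, hc, hwc⟩ _ hk hwk =>
      absurd ⟨w, c, k, hw, hc, hk, hwc, hwk⟩ hcommon

end IsRepOn

theorem IsSinkTree.isUniform_or_isUniform {T : V → V → Prop}
    (h : IsSinkTree G C prec adj r T) (hu : Hangs G C r T x u) (hv : Hangs G C r T x v)
    (huv : ¬ Linked G (closedNbhd G x) u v) :
    IsUniform G (closedNbhd G x) u v ∨ IsUniform G (closedNbhd G x) v u := by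
  rcases h.prec_or_upstream_of_hangs hu with hlow | ⟨y, hxy, hup⟩
  · rcases h.prec_or_upstream_of_hangs hv with hlow' | ⟨y, hxy, hup⟩
    · exact h.isRepOn.isUniform_or_isUniform huv hlow hlow'
    · exact Or.inr (h.isUniform_of_upstream hv hxy hup)
  · exact Or.inl (h.isUniform_of_upstream hu hxy hup)

theorem IsSinkTree.isValidTree {T : V → V → Prop} (h : IsSinkTree G C prec adj r T) :
    IsValidTree G C r T where
  parent_unique _ _ _ := h.parent_unique
  no_parent x hx := h.sink x (h.adj_of_treeEdge hx)
  edge _ _ := h.treeEdge_or_treeEdge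
  not_inTree _ _ := h.not_inTree_of_hangs
  attach _ _ _ := h.treeEdge_of_hangs
  closed _ _ _ := h.notMem_closedNbhd_of_hangs
  outer _ _ _ := h.eq_of_outer_adj
  uniform _ _ _ := h.isUniform_or_isUniform

end Recognition

/-! ### Recognition by tables -/

namespace Recognition

section Tables

variable {V : Type*} (G : SimpleGraph V)

/-- The placement relation given by a table `P`, where `P x z` says that the component of `z` in
`G - N[x]` is known to have a representation. -/
def Fits (P : V → V → Prop) (C : Set V) (x z : V) : Prop :=
  x ∈ C ∧ z ∉ closedNbhd G x ∧ component G (closedNbhd G x) z ⊆ C ∧ P x z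

/-- The tree grown from `r` in `C` with respect to the table `P` is valid. -/
def IsGoodRoot (P : V → V → Prop) (C : Set V) (r : V) : Prop :=
  r ∈ C ∧ IsValidTree G C r (Fits G P C)

/-- The smallest good root; choosing it makes the relations read off from its tree definite. -/
def IsLeastRoot [LT V] (P : V → V → Prop) (C : Set V) (r : V) : Prop :=
  IsGoodRoot G P C r ∧ ∀ r', IsGoodRoot G P C r' → ¬ r' < r

/-- The component of `u` in `G - B` is recognized as representable by means of the table `P`. -/
def IsRecognized (P : V → V → Prop) (B : Set V) (u : V) : Prop :=
  ∃ r, IsGoodRoot G P (component G B u) r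

/-- The order on the components of `G - B` read off from the trees grown from their least roots,
where the table `p` provides orders `p x` of the components of `G - N[x]`. -/
def compPrec [LT V] (P : V → V → Prop) (p : V → V → V → Prop) (B : Set V) (u v : V) : Prop :=
  ∃ r, IsLeastRoot G P (component G B u) r ∧
    treePrec G (component G B u) r (Fits G P (component G B u)) p u v

/-- The orientation of the components of `G - B` read off from the trees grown from their least
roots, where the table `a` provides orientations `a x` of the components of `G - N[x]`. -/
def compAdj [LT V] (P : V → V → Prop) (a : V → V → V → Prop) (B : Set V) (u v : V) : Prop :=
  ∃ r, IsLeastRoot G P (component G B u) r ∧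
    treeAdj G (component G B u) r (Fits G P (component G B u)) a u v

/-- The tables settle the components of at most `k` vertices of all `G - N[x]`: `P` decides which
of them have representations, and `p` and `a` represent those. -/
structure AreCorrect (k : ℕ) (P : V → V → Prop) (p a : V → V → V → Prop) : Prop where
  isRepOn : ∀ {x u}, u ∉ closedNbhd G x → (component G (closedNbhd G x) u).ncard ≤ k → P x u →
    IsRepOn G (component G (closedNbhd G x) u) (restrict (component G (closedNbhd G x) u) (p x))
      (restrict (component G (closedNbhd G x) u) (a x))
  of_isRepOn : ∀ {x u prec adj}, u ∉ closedNbhd G x →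
    (component G (closedNbhd G x) u).ncard ≤ k →
    IsRepOn G (component G (closedNbhd G x) u) prec adj → P x u

variable {G} {B C : Set V} {P : V → V → Prop} {p a : V → V → V → Prop} {k : ℕ} {r u v x z : V}

theorem linked_compl_component (hu : Linked G B r u) (hv : Linked G B r v) :
    Linked G (component G B r)ᶜ u v := by
  refine (hu.symm.trans hv).induction_on (.refl (not_not.2 hu)) fun x y _ huy ih hxy => ?_
  exact ih.tail hxy (not_not.2 (hu.trans huy))

theorem exists_isLeastRoot [LinearOrder V] [Finite V] (h : ∃ r, IsGoodRoot G P C r) :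
    ∃ r, IsLeastRoot G P C r := by
  obtain ⟨r, hr, hmin⟩ := wellFounded_lt.has_min {r | IsGoodRoot G P C r} h
  exact ⟨r, hr, hmin⟩

theorem IsLeastRoot.unique [LinearOrder V] {r' : V} (hr : IsLeastRoot G P C r)
    (hr' : IsLeastRoot G P C r') : r = r' :=
  le_antisymm (not_lt.1 (hr.2 r' hr'.1)) (not_lt.1 (hr'.2 r hr.1))

theorem restrict_leastRoot [LinearOrder V] {Q : Set V → V → V → V → Prop}
    (hr : IsLeastRoot G P (component G B u) r)
    (hQ : ∀ {v w}, Q (component G B u) r v w → v ∈ component G B u ∧ w ∈ component G B u) :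
    restrict (component G B u)
      (fun v w => ∃ r, IsLeastRoot G P (component G B v) r ∧ Q (component G B v) r v w) =
        Q (component G B u) r := by
  ext v w
  constructor
  · rintro ⟨hv, -, r', hr', hvw⟩
    rw [← hv.component_eq] at hr' hvw
    rwa [hr.unique hr']
  · intro hvw
    obtain ⟨hv, hw⟩ := hQ hvw
    refine ⟨hv, hw, r, ?_⟩
    rw [← hv.component_eq]
    exact ⟨hr, hvw⟩

theorem ncard_component_lt [Finite V] (hx : x ∈ C) (hz : component G (closedNbhd G x) z ⊆ C) :
    (component G (closedNbhd G x) z).ncard < C.ncard :=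
  Set.ncard_lt_ncard ((Set.ssubset_iff_of_subset hz).2
    ⟨x, hx, fun hzx => hzx.right (Set.mem_insert x _)⟩) (Set.toFinite C)

theorem AreCorrect.zero [Finite V] (P : V → V → Prop) (p a : V → V → V → Prop) :
    AreCorrect G 0 P p a := by
  have hpos : ∀ {x u}, u ∉ closedNbhd G x → ¬ (component G (closedNbhd G x) u).ncard ≤ 0 := by
    intro x u hu hk
    rw [Nat.le_zero, Set.ncard_eq_zero] at hk
    exact Set.eq_empty_iff_forall_notMem.1 hk u (.refl hu)
  exact ⟨fun hu hk => absurd hk (hpos hu), fun hu hk => absurd hk (hpos hu)⟩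

namespace AreCorrect

variable [Finite V] (h : AreCorrect G k P p a)

include h

theorem isRepOn_of_fits (hk : C.ncard ≤ k + 1) (hxz : Fits G P C x z) :
    IsRepOn G (component G (closedNbhd G x) z) (restrict (component G (closedNbhd G x) z) (p x))
      (restrict (component G (closedNbhd G x) z) (a x)) :=
  h.isRepOn hxz.2.1
    (Nat.lt_succ_iff.1 ((ncard_component_lt hxz.1 hxz.2.2.1).trans_le hk)) hxz.2.2.2

theorem fits_of_isRepOn {prec adj : V → V → Prop} (hk : C.ncard ≤ k + 1) (hx : x ∈ C)
    (hz : z ∉ closedNbhd G x) (hzC : component G (closedNbhd G x) z ⊆ C)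
    (hrep : IsRepOn G (component G (closedNbhd G x) z) prec adj) : Fits G P C x z :=
  ⟨hx, hz, hzC,
    h.of_isRepOn hz (Nat.lt_succ_iff.1 ((ncard_component_lt hx hzC).trans_le hk)) hrep⟩

theorem isPlacement_fits (hk : C.ncard ≤ k + 1) : IsPlacement G C (Fits G P C) where
  congr {x u v} hxu huv := by
    have hrep := h.isRepOn_of_fits hk hxu
    rw [huv.component_eq] at hrep
    exact h.fits_of_isRepOn hk hxu.1 huv.right (huv.component_eq ▸ hxu.2.2.1) hrep
  component_subset hxu := hxu.2.2.1
  notMem hxu := hxu.2.1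

theorem isRepOn_tree [LinearOrder V] (hk : (component G B u).ncard ≤ k + 1)
    (hr : IsGoodRoot G P (component G B u) r) :
    IsRepOn G (component G B u) (treePrec G (component G B u) r (Fits G P (component G B u)) p)
      (treeAdj G (component G B u) r (Fits G P (component G B u)) a) :=
  TreeAssembly.isRepOn_tree
    { valid := hr.2
      placement := h.isPlacement_fits hk
      connected := linked_compl_component hr.1
      root_mem := hr.1
      isRepOn := h.isRepOn_of_fits hk }

theorem isRepOn_comp [LinearOrder V] (hk : (component G B u).ncard ≤ k + 1)
    (hu : IsRecognized G P B u) :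
    IsRepOn G (component G B u) (restrict (component G B u) (compPrec G P p B))
      (restrict (component G B u) (compAdj G P a B)) := by
  obtain ⟨r, hr⟩ := exists_isLeastRoot hu
  have hrep := h.isRepOn_tree hk hr.1
  have hp := restrict_leastRoot (Q := fun C r => treePrec G C r (Fits G P C) p) hr hrep.prec_mem
  have ha := restrict_leastRoot (Q := fun C r => treeAdj G C r (Fits G P C) a) hr hrep.adj_mem
  rwa [← hp, ← ha] at hrep

theorem isRecognized {prec adj : V → V → Prop} (hu : u ∉ B)
    (hk : (component G B u).ncard ≤ k + 1) (hrep : IsRepOn G (component G B u) prec adj) :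
    IsRecognized G P B u := by
  obtain ⟨r, hr, hsink⟩ := hrep.exists_isTop_sink ⟨u, .refl hu⟩
  have htree : IsSinkTree G (component G B u) prec adj r (Fits G P (component G B u)) :=
    { isRepOn := hrep
      isTop := hr
      sink := hsink
      placement := h.isPlacement_fits hk
      of_prec := fun hzx => h.fits_of_isRepOn hk (hrep.prec_mem hzx).2
        (hrep.notMem_closedNbhd hzx)
        (fun _ hv => (hrep.prec_mem (hrep.prec_of_linked hzx hv)).1)
        (hrep.isRepOn_component hzx) }
  exact ⟨r, hr.1, htree.isValidTree⟩

theorem succ [LinearOrder V] : AreCorrect G (k + 1)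
    (fun x => IsRecognized G P (closedNbhd G x)) (fun x => compPrec G P p (closedNbhd G x))
    (fun x => compAdj G P a (closedNbhd G x)) where
  isRepOn _ hk hxu := h.isRepOn_comp hk hxu
  of_isRepOn hu hk hrep := h.isRecognized hu hk hrep

end AreCorrect

end Tables

/-! ### Representations of the whole graph -/

section Whole

variable {V : Type*} [Finite V] {G : SimpleGraph V} {prec adj : V → V → Prop}

theorem IsRepOn.isBurlingSet [Nonempty V] (h : IsRepOn G Set.univ prec adj) :
    IsBurlingSet prec adj where
  finite := inferInstance
  nonempty := inferInstance
  prec_irrefl := h.irrefl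
  prec_trans _ _ _ := h.trans
  adj_acyclic := h.not_transGen
  axiom1 _ _ _ := h.ax1
  axiom2 _ _ _ := h.ax2
  axiom3 _ _ _ := h.ax3
  axiom4 _ _ _ := h.ax4

omit [Finite V] in
theorem IsRepOn.eq_fromRel (h : IsRepOn G Set.univ prec adj) : G = SimpleGraph.fromRel adj := by
  ext u v
  rw [SimpleGraph.fromRel_adj, ← h.adj_iff (Set.mem_univ u) (Set.mem_univ v)]
  exact ⟨fun huv => ⟨huv.ne, huv⟩, fun huv => huv.2⟩

omit [Finite V] in
theorem _root_.IsBurlingSet.isRepOn (h : IsBurlingSet prec adj) :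
    IsRepOn (SimpleGraph.fromRel adj) Set.univ prec adj where
  prec_mem _ := ⟨Set.mem_univ _, Set.mem_univ _⟩
  adj_mem _ := ⟨Set.mem_univ _, Set.mem_univ _⟩
  irrefl := h.prec_irrefl
  trans := h.prec_trans _ _ _
  wf := by
    have := h.finite
    have : Std.Irrefl (Relation.TransGen fun y x => adj x y) :=
      ⟨fun x hx => h.adj_acyclic x (Relation.transGen_swap.1 hx)⟩
    exact Subrelation.wf (fun hyx => .single hyx)
      (Finite.wellFounded_of_trans_of_irrefl (Relation.TransGen fun y x => adj x y))
  ax1 := h.axiom1 _ _ _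
  ax2 := h.axiom2 _ _ _
  ax3 := h.axiom3 _ _ _
  ax4 := h.axiom4 _ _ _
  adj_iff _ _ := h.fromRel_adj
  outer_chain hw := absurd (Set.mem_univ _) hw
  outer_up hw := absurd (Set.mem_univ _) hw

omit [Finite V] in
theorem IsRepOn.restrict_component_empty (h : IsRepOn G Set.univ prec adj) (v : V) :
    IsRepOn G (component G ∅ v) (Recognition.restrict (component G ∅ v) prec)
      (Recognition.restrict (component G ∅ v) adj) := by
  have hclosed : ∀ w x, w ∉ component G ∅ v → x ∈ component G ∅ v → ¬ G.Adj w x :=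
    fun w x hw hx hwx => hw (hx.tail hwx.symm (Set.notMem_empty w))
  exact h.restrict (Set.subset_univ _)
    (fun w x y hw hx _ hwx => absurd hwx (hclosed w x hw hx))
    (fun w x y hw hx _ hwx => absurd hwx (hclosed w x hw hx))

theorem isRepOn_univ_of_components [LinearOrder V]
    (hprec : ∀ {u v}, prec u v → Linked G ∅ u v) (hadj : ∀ {u v}, adj u v → Linked G ∅ u v)
    (h : ∀ u, IsRepOn G (component G ∅ u) (restrict (component G ∅ u) prec)
      (restrict (component G ∅ u) adj)) : IsRepOn G Set.univ prec adj := by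
  have hcontact : ∀ u w, ¬ IsContact G ∅ u w := fun u w hw => hw.1
  have hrep : IsRepOn G Set.univ (restrict Set.univ (nestPrec G ∅ prec))
      (restrict Set.univ (nestAdj G ∅ adj)) :=
    Nestable.isRepOn_nest
      { disjoint := fun _ => Set.notMem_empty _
        closed := fun _ _ => Set.mem_univ _
        isRepOn := fun _ => h _
        uniform := fun _ _ _ => Or.inl fun w _ _ hw => absurd hw (hcontact _ w) }
  convert hrep using 1
  · ext u v
    refine ⟨fun huv => ⟨Set.mem_univ u, Set.mem_univ v, Or.inl ⟨hprec huv, huv⟩⟩, ?_⟩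
    rintro ⟨-, -, ⟨-, huv⟩ | ⟨-, -, ⟨w, hw⟩, -⟩⟩
    · exact huv
    · exact absurd hw (hcontact u w)
  · ext u v
    exact ⟨fun huv => ⟨Set.mem_univ u, Set.mem_univ v, hadj huv, huv⟩, fun huv => huv.2.2.2⟩

variable {P : V → V → Prop} {p a : V → V → V → Prop}

theorem AreCorrect.isRepOn_univ [LinearOrder V] (h : AreCorrect G (Nat.card V) P p a)
    (hP : ∀ u, IsRecognized G P ∅ u) :
    IsRepOn G Set.univ (compPrec G P p ∅) (compAdj G P a ∅) := by
  have hk : ∀ u, (component G ∅ u).ncard ≤ Nat.card V + 1 := fun u =>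
    (Set.ncard_le_card _).trans (Nat.le_succ _)
  refine isRepOn_univ_of_components ?_ ?_ fun u => h.isRepOn_comp (hk u) (hP u)
  · rintro u v ⟨r, hr, huv⟩
    exact ((h.isRepOn_tree (hk u) hr.1).prec_mem huv).2
  · rintro u v ⟨r, hr, huv⟩
    exact ((h.isRepOn_tree (hk u) hr.1).adj_mem huv).2

theorem AreCorrect.isRecognized_of_isBurlingSet (h : AreCorrect G (Nat.card V) P p a)
    (hs : IsBurlingSet prec adj) (hG : G = SimpleGraph.fromRel adj) (u : V) :
    IsRecognized G P ∅ u := by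
  subst hG
  exact h.isRecognized (Set.notMem_empty u)
    ((Set.ncard_le_card _).trans (Nat.le_succ _)) (hs.isRepOn.restrict_component_empty u)

end Whole

end Recognition

/-! ### The tables of all components -/

namespace Recognition

variable {V : Type*}

theorem isValidTree_iff {G : SimpleGraph V} {C : Set V} {r : V} {T : V → V → Prop} :
    IsValidTree G C r T ↔
    (∀ x x' y, TreeEdge G C r T x y → TreeEdge G C r T x' y → x = x') ∧
    (∀ x, ¬ TreeEdge G C r T x r) ∧
    (∀ y y', InTree G C r T y → InTree G C r T y' → G.Adj y y' →
      TreeEdge G C r T y y' ∨ TreeEdge G C r T y' y) ∧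
    (∀ x u, Hangs G C r T x u → ¬ InTree G C r T u) ∧
    (∀ x u y, Hangs G C r T x u → InTree G C r T y → G.Adj y u → TreeEdge G C r T x y) ∧
    (∀ x u w, Hangs G C r T x u → w ∈ C → ¬ InTree G C r T w → G.Adj w u →
      w ∉ closedNbhd G x) ∧
    (∀ w x x', w ∉ C → InTree G C r T x → InTree G C r T x' → G.Adj w x → G.Adj w x' → x = x') ∧
    (∀ x u v, Hangs G C r T x u → Hangs G C r T x v → ¬ Linked G (closedNbhd G x) u v →
      IsUniform G (closedNbhd G x) u v ∨ IsUniform G (closedNbhd G x) v u) :=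
  ⟨fun ⟨h₁, h₂, h₃, h₄, h₅, h₆, h₇, h₈⟩ => ⟨h₁, h₂, h₃, h₄, h₅, h₆, h₇, h₈⟩,
    fun ⟨h₁, h₂, h₃, h₄, h₅, h₆, h₇, h₈⟩ => ⟨h₁, h₂, h₃, h₄, h₅, h₆, h₇, h₈⟩⟩

/-- One round of the recognition algorithm. A family `R` of three ternary relations holds the
tables of `AreCorrect`: the truth value of `P x u` is kept as `R 0 ![x, u, u]`, that of `p x u v` as
`R 1 ![x, u, v]` and that of `a x u v` as `R 2 ![x, u, v]`. -/
def tableStep [LT V] (G : SimpleGraph V) (R : Fin 3 → (Fin 3 → V) → Prop) (j : Fin 3)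
    (z : Fin 3 → V) : Prop :=
  ![IsRecognized G (fun x u => R 0 ![x, u, u]) (closedNbhd G (z 0)) (z 1),
    compPrec G (fun x u => R 0 ![x, u, u]) (fun x u v => R 1 ![x, u, v]) (closedNbhd G (z 0))
      (z 1) (z 2),
    compAdj G (fun x u => R 0 ![x, u, u]) (fun x u v => R 2 ![x, u, v]) (closedNbhd G (z 0))
      (z 1) (z 2)] j

/-- The tables after as many rounds as there are vertices. -/
def finalTables [LT V] (G : SimpleGraph V) : Fin 3 → (Fin 3 → V) → Prop :=
  (tableStep G)^[Nat.card V] fun _ _ => False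

/-- The recognition algorithm accepts: all components of the graph are recognized. -/
def Accepts [LT V] (G : SimpleGraph V) : Prop :=
  ∀ u, IsRecognized G (fun x u => finalTables G 0 ![x, u, u]) ∅ u

/-- The order that the recognition algorithm computes. -/
def outPrec [LT V] (G : SimpleGraph V) : V → V → Prop :=
  compPrec G (fun x u => finalTables G 0 ![x, u, u]) (fun x u v => finalTables G 1 ![x, u, v]) ∅

/-- The orientation that the recognition algorithm computes. -/
def outAdj [LT V] (G : SimpleGraph V) : V → V → Prop :=
  compAdj G (fun x u => finalTables G 0 ![x, u, u]) (fun x u v => finalTables G 2 ![x, u, v]) ∅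

variable [LinearOrder V] [Finite V] {G : SimpleGraph V} {prec adj : V → V → Prop}

theorem areCorrect_iterate_tableStep (G : SimpleGraph V) (k : ℕ) :
    AreCorrect G k (fun x u => (tableStep G)^[k] (fun _ _ => False) 0 ![x, u, u])
      (fun x u v => (tableStep G)^[k] (fun _ _ => False) 1 ![x, u, v])
      (fun x u v => (tableStep G)^[k] (fun _ _ => False) 2 ![x, u, v]) := by
  induction k with
  | zero => exact .zero _ _ _
  | succ k ih =>
    rw [Function.iterate_succ_apply']
    exact ih.succ

theorem Accepts.isRepOn (h : Accepts G) : IsRepOn G Set.univ (outPrec G) (outAdj G) :=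
  (areCorrect_iterate_tableStep G _).isRepOn_univ h

theorem accepts_of_isBurlingSet (hs : IsBurlingSet prec adj) (hG : G = SimpleGraph.fromRel adj) :
    Accepts G :=
  (areCorrect_iterate_tableStep G _).isRecognized_of_isBurlingSet hs hG

theorem iterate_card_eq_of_isLeast {α : Type*} [Finite α] {F : (α → Prop) → α → Prop}
    (hF : Monotone F) {I : α → Prop} (hI : IsLeast {S | F S ≤ S} I) :
    F^[Nat.card α] (fun _ => False) = I := by
  have hchain : Monotone fun m => F^[m] fun _ => False :=
    hF.monotone_iterate_of_le_map bot_le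
  have hstable {m} (h : {x | F^[m] (fun _ => False) x}.ncard =
      {x | F^[m + 1] (fun _ => False) x}.ncard) :
      F^[m] (fun _ => False) = F^[m + 1] fun _ => False :=
    Set.eq_of_subset_of_ncard_le (hchain m.le_succ) h.ge
  have hfix : F^[Nat.card α + 1] (fun _ => False) = F^[Nat.card α] fun _ => False := by
    refine (hstable (Nat.stabilises_of_monotone
      (f := fun m => {x | F^[m] (fun _ => False) x}.ncard)
      (fun m m' hm => Set.ncard_le_ncard (hchain hm)) (fun m => Set.ncard_le_card _)
      (fun m hm => ?_) (Nat.le_succ _)).symm).symm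
    simp only [Function.iterate_succ_apply' F (m + 1)]
    rw [← hstable hm, ← Function.iterate_succ_apply' F, ← hstable hm]
  rw [Function.iterate_succ_apply'] at hfix
  refine le_antisymm ?_ (hI.2 hfix.le)
  generalize Nat.card α = m
  induction m with
  | zero => exact bot_le
  | succ m ih =>
    rw [Function.iterate_succ_apply']
    exact (hF ih).trans hI.1

end Recognition

namespace RAM

open Recognition

variable {Γ : Context}

/-- A set of vertices that depends on the data of a context is polynomial-time decidable. -/
def PolyDecSet (Γ : Context) (B : ∀ n, Γ.Data n → Set (Fin n)) : Prop :=
  ∀ r, PolyDec (Γ.elem r) fun n p => p.2 ∈ B n p.1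

/-- A binary relation that depends on the data of a context is polynomial-time decidable. -/
def PolyDecRel (Γ : Context) (R : ∀ n, Γ.Data n → Fin n → Fin n → Prop) : Prop :=
  ∀ r r', PolyDec ((Γ.elem r).elem r') fun n p => R n p.1.1 p.1.2 p.2

/-- A ternary relation that depends on the data of a context is polynomial-time decidable. -/
def PolyDecRel₃ (Γ : Context) (R : ∀ n, Γ.Data n → Fin n → Fin n → Fin n → Prop) : Prop :=
  ∀ r, PolyDecRel (Γ.elem r) fun n p => R n p.1 p.2

section Closure

variable {Y : Layout} {u v w : ∀ n, Γ.Data n → Fin n}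

theorem PolyDecSet.fst {B : ∀ n, Γ.Data n → Set (Fin n)} (h : PolyDecSet Γ B) :
    PolyDecSet (Γ.prod Y) fun n p => B n p.1 := fun r =>
  (h r).comap (Γ' := (Γ.prod Y).elem r) (fun _ p => (p.1.1, p.2))
    (max_le_max_right _ (le_max_left _ _)) fun hs => ⟨hs.1.1, hs.2⟩

theorem PolyDecSet.mem {B : ∀ n, Γ.Data n → Set (Fin n)} (h : PolyDecSet Γ B) (hu : IsElem Γ u) :
    PolyDec Γ fun n x => u n x ∈ B n x :=
  .of_elem (P := fun n x w => w ∈ B n x) h hu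

theorem PolyDecRel.fst {R : ∀ n, Γ.Data n → Fin n → Fin n → Prop} (h : PolyDecRel Γ R) :
    PolyDecRel (Γ.prod Y) fun n p => R n p.1 := fun r r' =>
  (h r r').comap (Γ' := ((Γ.prod Y).elem r).elem r') (fun _ p => ((p.1.1.1, p.1.2), p.2))
    (max_le_max_right _ (max_le_max_right _ (le_max_left _ _)))
    fun hs => ⟨⟨hs.1.1.1, hs.1.2⟩, hs.2⟩

theorem PolyDecRel.app {R : ∀ n, Γ.Data n → Fin n → Fin n → Prop} (h : PolyDecRel Γ R)
    (hu : IsElem Γ u) (hv : IsElem Γ v) : PolyDec Γ fun n x => R n x (u n x) (v n x) :=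
  .of_elem (P := fun n x w => R n x w (v n x))
    (fun r => .of_elem (Γ := Γ.elem r) (P := fun n p w => R n p.1 p.2 w) (h r) hv.fst) hu

theorem PolyDecRel₃.app {R : ∀ n, Γ.Data n → Fin n → Fin n → Fin n → Prop} (h : PolyDecRel₃ Γ R)
    (hu : IsElem Γ u) : PolyDecRel Γ fun n x => R n x (u n x) := fun r r' =>
  .of_elem (Γ := (Γ.elem r).elem r') (P := fun n p w => R n p.1.1 w p.1.2 p.2) (fun r'' =>
    (h r'' r r').comap (Γ' := ((Γ.elem r).elem r').elem r'')
      (fun _ p => (((p.1.1.1, p.2), p.1.1.2), p.1.2))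
      (by simp only [Context.prod]; omega)
      fun hs => ⟨⟨⟨hs.1.1.1, hs.2⟩, hs.1.1.2⟩, hs.1.2⟩) hu.fst.fst

theorem PolyDecRel₃.fst {R : ∀ n, Γ.Data n → Fin n → Fin n → Fin n → Prop}
    (h : PolyDecRel₃ Γ R) : PolyDecRel₃ (Γ.prod Y) fun n p => R n p.1 := fun r r' r'' =>
  (h r r' r'').comap (Γ' := (((Γ.prod Y).elem r).elem r').elem r'')
    (fun _ p => (((p.1.1.1.1, p.1.1.2), p.1.2), p.2))
    (by simp only [Context.prod]; omega)
    fun hs => ⟨⟨⟨hs.1.1.1.1, hs.1.1.2⟩, hs.1.2⟩, hs.2⟩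

end Closure

theorem PolyDec.leastFixed {k : ℕ}
    {F : ∀ n, Γ.Data n → ((Fin k → Fin n) → Prop) → (Fin k → Fin n) → Prop}
    {I : ∀ n, Γ.Data n → (Fin k → Fin n) → Prop} {w : ∀ n, Γ.Data n → Fin k → Fin n}
    (hF : ∀ a r, PolyDec ((Γ.tables a 1 k).vec r k) fun n p => F n p.1.1 (p.1.2 0) p.2)
    (hmono : ∀ n x, Monotone (F n x)) (hI : ∀ n x, IsLeast {S | F n x S ≤ S} (I n x))
    (hw : ∀ i, IsElem Γ fun n x => w n x i) : PolyDec Γ fun n x => I n x (w n x) := by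
  refine (iterate (m := 1) k (F := fun n x T _ => F n x (T 0)) (Q := fun n x T => T 0 (w n x))
    (fun a r _ => hF a r) fun a => table (isTable_snd 0) fun i => (hw i).fst).of_iff fun n x => ?_
  have heval : Function.Semiconj (fun T : Fin 1 → (Fin k → Fin n) → Prop => T 0)
      (fun T _ => F n x (T 0)) (F n x) := fun _ => rfl
  have hcard : Nat.card (Fin k → Fin n) = n ^ k := by simp
  rw [← iterate_card_eq_of_isLeast (hmono n x) (hI n x), hcard]
  exact iff_of_eq (congrFun (heval.iterate_right _ _) _)

variable {B C : ∀ n, Γ.Data n → Set (Fin n)} {T P q : ∀ n, Γ.Data n → Fin n → Fin n → Prop}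
  {p a : ∀ n, Γ.Data n → Fin n → Fin n → Fin n → Prop}
  {R : ∀ n, Γ.Data n → (Fin 3 → Fin n) → Prop} {r u v w x y : ∀ n, Γ.Data n → Fin n}

theorem PolyDec.linked (hB : PolyDecSet Γ B) (hu : IsElem Γ u) (hv : IsElem Γ v) :
    PolyDec Γ fun n x => Linked (Γ.graph x) (B n x) (u n x) (v n x) := by
  refine leastFixed (k := 1) (w := fun n x => ![v n x])
    (F := fun n x S z => (z 0 = u n x ∧ u n x ∉ B n x) ∨
      ∃ y, S ![y] ∧ (Γ.graph x).Adj y (z 0) ∧ z 0 ∉ B n x)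
    (I := fun n x z => Linked (Γ.graph x) (B n x) (u n x) (z 0)) (fun a r => ?_) ?_ ?_ ?_
  · refine .or (.and (.eq (isElem_snd_apply 0) hu.fst.fst) (hB.fst.fst.mem hu.fst.fst).not)
      (.ex fun r' => .and ?_ (.and (.adj isElem_snd (isElem_snd_apply 0).fst)
        (hB.fst.fst.fst.mem (isElem_snd_apply 0).fst).not))
    exact table (Γ := ((Γ.tables a 1 1).vec r 1).elem r') (w := fun _ p => ![p.2])
      (isTable_snd 0).fst.fst (Fin.forall_fin_one.2 isElem_snd)
  · exact fun n x S S' hS z => Or.imp_right fun ⟨y, hy, h⟩ => ⟨y, hS _ hy, h⟩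
  · refine fun n x => ⟨?_, fun S hS z hz => ?_⟩
    · rintro z (⟨hz, hz'⟩ | ⟨y, hy, hadj, hz⟩)
      · exact (congrArg (Linked _ _ _) hz).mpr (.refl hz')
      · exact hy.tail hadj hz
    · have hind : S ![z 0] := hz.induction_on (p := fun y => S ![y])
        (hS _ (.inl ⟨rfl, hz.left⟩)) fun y y' _ hy ih hadj => hS _ (.inr ⟨y, ih, hadj, hy.right⟩)
      rwa [(funext (Fin.forall_fin_one.2 rfl) : z = ![z 0])]
  · exact Fin.forall_fin_one.2 hv

theorem PolyDec.treeEdge (hC : PolyDecSet Γ C) (hr : IsElem Γ r) (hT : PolyDecRel Γ T)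
    (hx : IsElem Γ x) (hy : IsElem Γ y) :
    PolyDec Γ fun n d => TreeEdge (Γ.graph d) (C n d) (r n d) (T n d) (x n d) (y n d) := by
  refine leastFixed (k := 2) (w := fun n d => ![x n d, y n d])
    (F := fun n d S z => (z 0 = r n d ∧ z 1 ∈ C n d ∧ (Γ.graph d).Adj (r n d) (z 1)) ∨
      ∃ v, S ![v, z 0] ∧ z 1 ∈ C n d ∧ (Γ.graph d).Adj (z 0) (z 1) ∧ z 1 ≠ v ∧ ¬ T n d v (z 1))
    (I := fun n d z => TreeEdge (Γ.graph d) (C n d) (r n d) (T n d) (z 0) (z 1))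
    (fun a i => ?_) ?_ ?_ ?_
  · have h₀ := isElem_snd_apply (Γ := Γ.tables a 1 2) (r := i) (0 : Fin 2)
    have h₁ := isElem_snd_apply (Γ := Γ.tables a 1 2) (r := i) (1 : Fin 2)
    refine .or (.and (.eq h₀ hr.fst.fst) (.and (hC.fst.fst.mem h₁) (.adj hr.fst.fst h₁)))
      (.ex fun i' => .and ?_ (.and (hC.fst.fst.fst.mem h₁.fst) (.and (.adj h₀.fst h₁.fst)
        (.and (.not (.eq h₁.fst isElem_snd)) (.not (hT.fst.fst.fst.app isElem_snd h₁.fst))))))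
    exact table (Γ := ((Γ.tables a 1 2).vec i 2).elem i') (w := fun n p => ![p.2, p.1.2 0])
      (isTable_snd 0).fst.fst (Fin.forall_fin_two.2 ⟨isElem_snd, h₀.fst⟩)
  · exact fun n d S S' hS z => Or.imp_right fun ⟨v, hv, h⟩ => ⟨v, hS _ hv, h⟩
  · refine fun n d => ⟨?_, fun S hS z hz => ?_⟩
    · rintro z (⟨hz, hC, hadj⟩ | ⟨v, hv, hC, hadj, hne, hT⟩)
      · exact (congrArg (TreeEdge _ _ _ _ · _) hz).mpr (.root hC hadj)
      · exact .step hv hC hadj hne hT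
    · have hind : ∀ {x y}, TreeEdge (Γ.graph d) (C n d) (r n d) (T n d) x y → S ![x, y] := by
        intro x y hxy
        induction hxy with
        | root hz hadj => exact hS _ (.inl ⟨rfl, hz, hadj⟩)
        | step _ hz hadj hne hT ih => exact hS _ (.inr ⟨_, ih, hz, hadj, hne, hT⟩)
      rw [(funext (Fin.forall_fin_two.2 ⟨rfl, rfl⟩) : z = ![z 0, z 1])]
      exact hind hz
  · exact Fin.forall_fin_two.2 ⟨hx, hy⟩

theorem PolyDec.inTree (hC : PolyDecSet Γ C) (hr : IsElem Γ r) (hT : PolyDecRel Γ T)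
    (hy : IsElem Γ y) :
    PolyDec Γ fun n d => InTree (Γ.graph d) (C n d) (r n d) (T n d) (y n d) :=
  .or (.eq hy hr) (.ex fun _ => treeEdge hC.fst hr.fst hT.fst isElem_snd hy.fst)

theorem PolyDecSet.closedNbhd (hx : IsElem Γ x) :
    PolyDecSet Γ fun n d => closedNbhd (Γ.graph d) (x n d) := fun _ =>
  .or (.eq isElem_snd hx.fst) (.adj hx.fst isElem_snd)

theorem PolyDecSet.component (hB : PolyDecSet Γ B) (hu : IsElem Γ u) :
    PolyDecSet Γ fun n d => component (Γ.graph d) (B n d) (u n d) := fun _ =>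
  .linked hB.fst hu.fst isElem_snd

theorem PolyDec.hangs (hC : PolyDecSet Γ C) (hr : IsElem Γ r) (hT : PolyDecRel Γ T)
    (hx : IsElem Γ x) (hu : IsElem Γ u) :
    PolyDec Γ fun n d => Hangs (Γ.graph d) (C n d) (r n d) (T n d) (x n d) (u n d) :=
  .and (hT.app hx hu) (.ex fun _ => .ex fun _ =>
    .and (treeEdge hC.fst.fst hr.fst.fst hT.fst.fst hx.fst.fst isElem_snd.fst)
      (.and (linked (.closedNbhd hx.fst.fst) hu.fst.fst isElem_snd)
        (.adj isElem_snd.fst isElem_snd)))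

theorem PolyDec.isContact (hB : PolyDecSet Γ B) (hu : IsElem Γ u) (hw : IsElem Γ w) :
    PolyDec Γ fun n d => IsContact (Γ.graph d) (B n d) (u n d) (w n d) :=
  .and (hB.mem hw) (.ex fun _ =>
    .and (linked hB.fst hu.fst isElem_snd) (.adj hw.fst isElem_snd))

theorem PolyDec.isUniform (hB : PolyDecSet Γ B) (hu : IsElem Γ u) (hv : IsElem Γ v) :
    PolyDec Γ fun n d => IsUniform (Γ.graph d) (B n d) (u n d) (v n d) :=
  .all fun _ => .all fun _ => .all fun _ =>
    .imp (isContact hB.fst.fst.fst hu.fst.fst.fst isElem_snd.fst.fst)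
      (.imp (isContact hB.fst.fst.fst hu.fst.fst.fst isElem_snd.fst)
        (.imp (linked hB.fst.fst.fst hv.fst.fst.fst isElem_snd)
          (.imp (.adj isElem_snd.fst.fst isElem_snd) (.adj isElem_snd.fst isElem_snd))))

theorem PolyDec.minLT (hB : PolyDecSet Γ B) (hu : IsElem Γ u) (hv : IsElem Γ v) :
    PolyDec Γ fun n d => MinLT (Γ.graph d) (B n d) (u n d) (v n d) :=
  .ex fun _ => .and (linked hB.fst hu.fst isElem_snd) (.all fun _ =>
    .imp (linked hB.fst.fst hv.fst.fst isElem_snd) (.lt isElem_snd.fst isElem_snd))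

theorem PolyDec.below (hB : PolyDecSet Γ B) (hu : IsElem Γ u) (hv : IsElem Γ v) :
    PolyDec Γ fun n d => Below (Γ.graph d) (B n d) (u n d) (v n d) :=
  .and (isUniform hB hu hv) (.and (.or (.not (isUniform hB hv hu)) (minLT hB hu hv))
    (.and (.ex fun _ => isContact hB.fst hu.fst isElem_snd)
      (.all fun _ => .imp (isContact hB.fst hu.fst isElem_snd) (.adj isElem_snd hv.fst))))

theorem PolyDec.isValidTree (hC : PolyDecSet Γ C) (hr : IsElem Γ r) (hT : PolyDecRel Γ T) :
    PolyDec Γ fun n d => IsValidTree (Γ.graph d) (C n d) (r n d) (T n d) := by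
  refine PolyDec.of_iff ?_ fun n d => isValidTree_iff.symm
  refine .and ?_ (.and ?_ (.and ?_ (.and ?_ (.and ?_ (.and ?_ (.and ?_ ?_))))))
  · exact .all fun _ => .all fun _ => .all fun _ =>
      have hC := hC.fst.fst.fst; have hr := hr.fst.fst.fst; have hT := hT.fst.fst.fst
      .imp (treeEdge hC hr hT isElem_snd.fst.fst isElem_snd)
        (.imp (treeEdge hC hr hT isElem_snd.fst isElem_snd) (.eq isElem_snd.fst.fst isElem_snd.fst))
  · exact .all fun _ => .not (treeEdge hC.fst hr.fst hT.fst isElem_snd hr.fst)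
  · exact .all fun _ => .all fun _ =>
      have hC := hC.fst.fst; have hr := hr.fst.fst; have hT := hT.fst.fst
      .imp (inTree hC hr hT isElem_snd.fst) (.imp (inTree hC hr hT isElem_snd)
        (.imp (.adj isElem_snd.fst isElem_snd) (.or (treeEdge hC hr hT isElem_snd.fst isElem_snd)
          (treeEdge hC hr hT isElem_snd isElem_snd.fst))))
  · exact .all fun _ => .all fun _ =>
      have hC := hC.fst.fst; have hr := hr.fst.fst; have hT := hT.fst.fst
      .imp (hangs hC hr hT isElem_snd.fst isElem_snd) (.not (inTree hC hr hT isElem_snd))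
  · exact .all fun _ => .all fun _ => .all fun _ =>
      have hC := hC.fst.fst.fst; have hr := hr.fst.fst.fst; have hT := hT.fst.fst.fst
      .imp (hangs hC hr hT isElem_snd.fst.fst isElem_snd.fst) (.imp (inTree hC hr hT isElem_snd)
        (.imp (.adj isElem_snd isElem_snd.fst) (treeEdge hC hr hT isElem_snd.fst.fst isElem_snd)))
  · exact .all fun _ => .all fun _ => .all fun _ =>
      have hC := hC.fst.fst.fst; have hr := hr.fst.fst.fst; have hT := hT.fst.fst.fst
      .imp (hangs hC hr hT isElem_snd.fst.fst isElem_snd.fst) (.imp (hC.mem isElem_snd)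
        (.imp (.not (inTree hC hr hT isElem_snd)) (.imp (.adj isElem_snd isElem_snd.fst)
          (.not (PolyDecSet.mem (.closedNbhd isElem_snd.fst.fst) isElem_snd)))))
  · exact .all fun _ => .all fun _ => .all fun _ =>
      have hC := hC.fst.fst.fst; have hr := hr.fst.fst.fst; have hT := hT.fst.fst.fst
      .imp (.not (hC.mem isElem_snd.fst.fst)) (.imp (inTree hC hr hT isElem_snd.fst)
        (.imp (inTree hC hr hT isElem_snd) (.imp (.adj isElem_snd.fst.fst isElem_snd.fst)
          (.imp (.adj isElem_snd.fst.fst isElem_snd) (.eq isElem_snd.fst isElem_snd)))))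
  · exact .all fun _ => .all fun _ => .all fun _ =>
      have hC := hC.fst.fst.fst; have hr := hr.fst.fst.fst; have hT := hT.fst.fst.fst
      have hN := PolyDecSet.closedNbhd isElem_snd.fst.fst
      .imp (hangs hC hr hT isElem_snd.fst.fst isElem_snd.fst)
        (.imp (hangs hC hr hT isElem_snd.fst.fst isElem_snd)
          (.imp (.not (linked hN isElem_snd.fst isElem_snd))
            (.or (isUniform hN isElem_snd.fst isElem_snd)
              (isUniform hN isElem_snd isElem_snd.fst))))

theorem PolyDec.nestPrec (hB : PolyDecSet Γ B) (hq : PolyDecRel Γ q) (hu : IsElem Γ u)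
    (hv : IsElem Γ v) :
    PolyDec Γ fun n d => nestPrec (Γ.graph d) (B n d) (q n d) (u n d) (v n d) :=
  .or (.and (linked hB hu hv) (hq.app hu hv)) (below hB hu hv)

theorem PolyDec.nestAdj (hB : PolyDecSet Γ B) (hq : PolyDecRel Γ q) (hu : IsElem Γ u)
    (hv : IsElem Γ v) :
    PolyDec Γ fun n d => nestAdj (Γ.graph d) (B n d) (q n d) (u n d) (v n d) :=
  .and (linked hB hu hv) (hq.app hu hv)

theorem PolyDec.treePrec (hC : PolyDecSet Γ C) (hr : IsElem Γ r) (hT : PolyDecRel Γ T)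
    (hp : PolyDecRel₃ Γ p) (hu : IsElem Γ u) (hv : IsElem Γ v) :
    PolyDec Γ fun n d => treePrec (Γ.graph d) (C n d) (r n d) (T n d) (p n d) (u n d) (v n d) :=
  .or (hangs hC hr hT hv hu) (.ex fun _ =>
    .and (hangs hC.fst hr.fst hT.fst isElem_snd hu.fst)
      (.and (hangs hC.fst hr.fst hT.fst isElem_snd hv.fst)
        (nestPrec (.closedNbhd isElem_snd) (hp.fst.app isElem_snd) hu.fst hv.fst)))

theorem PolyDec.treeAdj (hC : PolyDecSet Γ C) (hr : IsElem Γ r) (hT : PolyDecRel Γ T)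
    (ha : PolyDecRel₃ Γ a) (hu : IsElem Γ u) (hv : IsElem Γ v) :
    PolyDec Γ fun n d => treeAdj (Γ.graph d) (C n d) (r n d) (T n d) (a n d) (u n d) (v n d) :=
  .and (.adj hu hv) (.or (treeEdge hC hr hT hv hu)
    (.or (.and (inTree hC hr hT hu) (.and (hC.mem hv) (.not (inTree hC hr hT hv))))
      (.ex fun _ => .and (hangs hC.fst hr.fst hT.fst isElem_snd hu.fst)
        (.and (hangs hC.fst hr.fst hT.fst isElem_snd hv.fst)
          (nestAdj (.closedNbhd isElem_snd) (ha.fst.app isElem_snd) hu.fst hv.fst)))))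

theorem PolyDecRel.fits (hP : PolyDecRel Γ P) (hC : PolyDecSet Γ C) :
    PolyDecRel Γ fun n d => Fits (Γ.graph d) (P n d) (C n d) := fun _ _ =>
  have hN := PolyDecSet.closedNbhd isElem_snd.fst
  .and (hC.fst.fst.mem isElem_snd.fst) (.and (.not (hN.mem isElem_snd))
    (.and (.all fun _ => .imp (.linked hN.fst isElem_snd.fst isElem_snd)
      (hC.fst.fst.fst.mem isElem_snd)) (hP.fst.fst.app isElem_snd.fst isElem_snd)))

theorem PolyDec.isGoodRoot (hP : PolyDecRel Γ P) (hC : PolyDecSet Γ C) (hr : IsElem Γ r) :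
    PolyDec Γ fun n d => IsGoodRoot (Γ.graph d) (P n d) (C n d) (r n d) :=
  .and (hC.mem hr) (isValidTree hC hr (hP.fits hC))

theorem PolyDec.isLeastRoot (hP : PolyDecRel Γ P) (hC : PolyDecSet Γ C) (hr : IsElem Γ r) :
    PolyDec Γ fun n d => IsLeastRoot (Γ.graph d) (P n d) (C n d) (r n d) :=
  .and (isGoodRoot hP hC hr) (.all fun _ =>
    .imp (isGoodRoot hP.fst hC.fst isElem_snd) (.not (.lt isElem_snd hr.fst)))

theorem PolyDec.isRecognized (hP : PolyDecRel Γ P) (hB : PolyDecSet Γ B) (hu : IsElem Γ u) :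
    PolyDec Γ fun n d => IsRecognized (Γ.graph d) (P n d) (B n d) (u n d) :=
  .ex fun _ => isGoodRoot hP.fst (.component hB.fst hu.fst) isElem_snd

theorem PolyDec.compPrec (hP : PolyDecRel Γ P) (hp : PolyDecRel₃ Γ p) (hB : PolyDecSet Γ B)
    (hu : IsElem Γ u) (hv : IsElem Γ v) :
    PolyDec Γ fun n d => compPrec (Γ.graph d) (P n d) (p n d) (B n d) (u n d) (v n d) :=
  .ex fun _ =>
    have hC := PolyDecSet.component hB.fst hu.fst
    .and (isLeastRoot hP.fst hC isElem_snd)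
      (treePrec hC isElem_snd (hP.fst.fits hC) hp.fst hu.fst hv.fst)

theorem PolyDec.compAdj (hP : PolyDecRel Γ P) (ha : PolyDecRel₃ Γ a) (hB : PolyDecSet Γ B)
    (hu : IsElem Γ u) (hv : IsElem Γ v) :
    PolyDec Γ fun n d => compAdj (Γ.graph d) (P n d) (a n d) (B n d) (u n d) (v n d) :=
  .ex fun _ =>
    have hC := PolyDecSet.component hB.fst hu.fst
    .and (isLeastRoot hP.fst hC isElem_snd)
      (treeAdj hC isElem_snd (hP.fst.fits hC) ha.fst hu.fst hv.fst)

theorem IsTable.polyDecRel_diag (hR : IsTable Γ 3 R) :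
    PolyDecRel Γ fun n d x u => R n d ![x, u, u] := fun r r' =>
  .table (Γ := (Γ.elem r).elem r') (w := fun _ e => ![e.1.2, e.2, e.2]) hR.fst.fst
    (Fin.forall_fin_succ.2 ⟨isElem_snd.fst, Fin.forall_fin_two.2 ⟨isElem_snd, isElem_snd⟩⟩)

theorem IsTable.polyDecRel₃ (hR : IsTable Γ 3 R) :
    PolyDecRel₃ Γ fun n d x u v => R n d ![x, u, v] := fun r r' r'' =>
  .table (Γ := ((Γ.elem r).elem r').elem r'') (w := fun _ e => ![e.1.1.2, e.1.2, e.2])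
    hR.fst.fst.fst
    (Fin.forall_fin_succ.2 ⟨isElem_snd.fst.fst, Fin.forall_fin_two.2 ⟨isElem_snd.fst, isElem_snd⟩⟩)

theorem PolyDec.tableStep (a r : ℕ) (j : Fin 3) :
    PolyDec ((Γ.tables a 3 3).vec r 3) fun n d => tableStep (Γ.graph d.1.1) d.1.2 j d.2 := by
  have hP := (isTable_snd (Γ := Γ) (a := a) (k := 3) (0 : Fin 3)).fst (Y := .vec r 3)
  have hB := PolyDecSet.closedNbhd (isElem_snd_apply (Γ := Γ.tables a 3 3) (r := r) (0 : Fin 3))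
  have h₁ := isElem_snd_apply (Γ := Γ.tables a 3 3) (r := r) (1 : Fin 3)
  have h₂ := isElem_snd_apply (Γ := Γ.tables a 3 3) (r := r) (2 : Fin 3)
  fin_cases j
  · exact isRecognized hP.polyDecRel_diag hB h₁
  · exact compPrec hP.polyDecRel_diag (isTable_snd 1).fst.polyDecRel₃ hB h₁ h₂
  · exact compAdj hP.polyDecRel_diag (isTable_snd 2).fst.polyDecRel₃ hB h₁ h₂

theorem PolyDec.finalTables {Q : ∀ n, Γ.Data n → (Fin 3 → (Fin 3 → Fin n) → Prop) → Prop}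
    (hQ : ∀ a, PolyDec (Γ.tables a 3 3) fun n d => Q n d.1 d.2) :
    PolyDec Γ fun n d => Q n d (finalTables (Γ.graph d)) :=
  (iterate (F := fun _ d => Recognition.tableStep (Γ.graph d)) 1
    (fun a r j => tableStep a r j) hQ).of_iff fun n d => by simp [Recognition.finalTables]

theorem polyDecSet_empty : PolyDecSet Γ fun _ _ => ∅ := fun _ => .const False

theorem PolyDec.accepts : PolyDec Γ fun _ d => Accepts (Γ.graph d) :=
  finalTables (Q := fun _ d R => ∀ u, IsRecognized (Γ.graph d) (fun x u => R 0 ![x, u, u]) ∅ u)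
    fun _ => .all fun _ =>
      isRecognized (isTable_snd 0).fst.polyDecRel_diag polyDecSet_empty isElem_snd

theorem PolyDec.outPrec (hu : IsElem Γ u) (hv : IsElem Γ v) :
    PolyDec Γ fun n d => outPrec (Γ.graph d) (u n d) (v n d) :=
  finalTables (Q := fun n d R => Recognition.compPrec (Γ.graph d) (fun x u => R 0 ![x, u, u])
    (fun x u v => R 1 ![x, u, v]) ∅ (u n d) (v n d)) fun _ =>
      compPrec (isTable_snd 0).polyDecRel_diag (isTable_snd 1).polyDecRel₃ polyDecSet_empty
        hu.fst hv.fst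

theorem PolyDec.outAdj (hu : IsElem Γ u) (hv : IsElem Γ v) :
    PolyDec Γ fun n d => outAdj (Γ.graph d) (u n d) (v n d) :=
  finalTables (Q := fun n d R => Recognition.compAdj (Γ.graph d) (fun x u => R 0 ![x, u, u])
    (fun x u v => R 2 ![x, u, v]) ∅ (u n d) (v n d)) fun _ =>
      compAdj (isTable_snd 0).polyDecRel_diag (isTable_snd 2).polyDecRel₃ polyDecSet_empty
        hu.fst hv.fst

theorem stored_graphInput {n : ℕ} (G : SimpleGraph (Fin n)) :
    Context.graphOnly.Stored G (graphInput G) := by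
  refine ⟨rfl, fun u v => ?_⟩
  have hadj : (∃ i j : Fin n, (u * n + v : ℕ) = i * n + j ∧ G.Adj i j) ↔ G.Adj u v := by
    refine ⟨fun ⟨i, j, hpos, h⟩ => ?_, fun h => ⟨u, v, rfl, h⟩⟩
    have hij : ![v, u] = ![j, i] := position_injective (by simpa [position, add_comm] using hpos)
    obtain ⟨rfl, rfl⟩ : v = j ∧ u = i := ⟨congrFun hij 0, congrFun hij 1⟩
    exact h
  classical exact if_congr ((and_iff_right rfl).trans hadj) rfl rfl

theorem rel_eq_of_stored {n a m : ℕ} {R : Fin m → (Fin 2 → Fin n) → Prop} {s : State}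
    (h : (Layout.tables a m 2).Stored R s) (j : Fin m) :
    s.rel n (a + j) = fun u v => R j ![v, u] := by
  funext u v
  have hentry := h j ![v, u]
  rw [show position ![v, u] = u * n + v by simp [position, add_comm]] at hentry
  rw [State.rel, hentry, boolVal_eq_one]

theorem exists_program_of_polyDec {R : ∀ n, SimpleGraph (Fin n) → Fin 2 → (Fin 2 → Fin n) → Prop}
    {P : ∀ n, SimpleGraph (Fin n) → Prop}
    (hR : ∀ r j, PolyDec (Context.graphOnly.vec r 2) fun n d => R n d.1 j d.2)
    (hP : PolyDec .graphOnly P) :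
    ∃ (c : Cmd) (p : Polynomial ℕ), ∀ n (G : SimpleGraph (Fin n)),
      Runs c (graphInput G) (p.eval n) fun s => s.reg 0 = boolVal (P n G) ∧
        s.rel n 1 = (fun u v => R n G 0 ![v, u]) ∧ s.rel n 2 = fun u v => R n G 1 ![v, u] := by
  have hbase {b : ℕ} (hb : 0 < b) : Context.graphOnly.base ≤ b := hb
  have hstored n (G : SimpleGraph (Fin n)) s s' (hs : Context.graphOnly.Stored G s)
      (h : s.EqOn (Set.Iio 3) (Set.Iio 3 \ Set.Ico 1 (1 + 2)) s') : Context.graphOnly.Stored G s' :=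
    Context.graphOnly.stored_of_eqOn hs (hbase three_pos) (hbase one_pos)
      (h.mono le_rfl (PolyDec.Iio_subset_Iio_sdiff_Ico le_rfl (by simp)))
  obtain ⟨c, p, hc⟩ := PolyDec.exists_tabulate (A := 1) (hR 3) (hbase three_pos) le_rfl hstored
  obtain ⟨d, q, hd⟩ := hP 3 (hbase three_pos)
  refine ⟨.seq c (.seq d (.assign 0 (.var 3))), p + (q + 2), fun n G => ?_⟩
  have hinput := stored_graphInput G
  refine (Runs.seq ((hc n G _ hinput).mono le_rfl fun s ⟨hs, htab⟩ => .seq ((hd n G s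
    (hstored n G _ s hinput hs)).mono le_rfl fun s' ⟨hs', hval⟩ => .assign ⟨?_, ?_, ?_⟩))).mono
    (by simp [Expr.cost]) fun _ h => h
  · simpa [Expr.eval] using hval
  all_goals
    funext u v
    simp only [State.rel, State.arr_setReg]
    rw [hs'.2 (by simp)]
  · exact congrFun₂ (rel_eq_of_stored htab 0) u v
  · exact congrFun₂ (rel_eq_of_stored htab 1) u v

theorem exists_recognition_program :
    ∃ (c : Cmd) (p : Polynomial ℕ), ∀ n (G : SimpleGraph (Fin n)),
      Runs c (graphInput G) (p.eval n) fun s => s.reg 0 = boolVal (Accepts G) ∧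
        s.rel n 1 = outPrec G ∧ s.rel n 2 = outAdj G :=
  exists_program_of_polyDec
    (R := fun _ G j v => ![outPrec G (v 1) (v 0), outAdj G (v 1) (v 0)] j) (fun _ =>
      Fin.forall_fin_two.2 ⟨.outPrec (isElem_snd_apply 1) (isElem_snd_apply 0),
        .outAdj (isElem_snd_apply 1) (isElem_snd_apply 0)⟩) .accepts

end RAM

theorem mainTheorem3 :
    ∃ (c : RAM.Cmd) (p : Polynomial ℕ), ∀ n : ℕ, 1 ≤ n → ∀ G : SimpleGraph (Fin n),
      ∃ (s : RAM.State) (t : ℕ), RAM.Exec c (RAM.graphInput G) s t ∧ t ≤ p.eval n ∧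
        ((s.reg 0 = 1 ∧ IsBurlingGraph G ∧
            IsBurlingSet (s.rel n 1) (s.rel n 2) ∧ G = SimpleGraph.fromRel (s.rel n 2)) ∨
          (s.reg 0 = 0 ∧ ¬ IsBurlingGraph G ∧
            ¬ ∃ prec adj : Fin n → Fin n → Prop,
              IsBurlingSet prec adj ∧ G = SimpleGraph.fromRel adj)) := by
  obtain ⟨c, p, hc⟩ := RAM.exists_recognition_program
  refine ⟨c, p, fun n hn G => ?_⟩
  have : Nonempty (Fin n) := ⟨⟨0, hn⟩⟩
  obtain ⟨s, t, hexec, ht, haccept, hprec, hadj⟩ := hc n G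
  refine ⟨s, t, hexec, ht, ?_⟩
  rw [haccept, hprec, hadj]
  by_cases h : Recognition.Accepts G
  · have hs := h.isRepOn.isBurlingSet
    have hG := h.isRepOn.eq_fromRel
    exact .inl ⟨RAM.boolVal_of_pos h, hG ▸ hs.isBurlingGraph, hs, hG⟩
  · have hnot : ¬ ∃ prec adj, IsBurlingSet prec adj ∧ G = SimpleGraph.fromRel adj :=
      fun ⟨_, _, hs, hG⟩ => h (Recognition.accepts_of_isBurlingSet hs hG)
    exact .inr ⟨RAM.boolVal_of_neg h, fun hB => hnot hB.exists_isBurlingSet, hnot⟩
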